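/- We work over $\mathbb C$; genus means arithmetic genus. An integral projective curve $C$ in a hyperplane $H\cong\mathbb P^3$ of $\mathbb P^4$ is called canonically embedded in $H$ if it is Gorenstein, its canonical (dualizing) sheaf satisfies $\omega_C\cong\mathcal O_H(1)|_C$, and the embedding $C\hookrightarrow H$ is the map given by the complete linear system $|\omega_C|$ (that is, $H^0(H,\mathcal O_H(1))\to H^0(C,\mathcal O_C(1))$ is bijective). A curve has planar singularities if its Zariski tangent space has dimension at most $2$ at every point. $\mathrm{Sing}\,X$ denotes the set of singular points of $X$. A K3 surface is a smooth projective surface $S$ with $\Omega^2_S\cong\mathcal O_S$ and $H^1(S,\mathcal O_S)=0$. **Lemma (existence of a K3 surface in $\mathbb P^4$ with given hyperplane sections).** Let $H\ne H'$ be hyperplanes in $\mathbb P^4$, and let $C\subset H$, $C'\subset H'$ be integral curves of genus $4$ that are canonically embedded in $H$ and $H'$ respectively. Let $Q$ (resp. $Q'$) be the unique quadric surface in $H$ (resp. $H'$) that contains $C$ (resp. $C'$). Assume that 1. $C'\cap H=C\cap H'$ and $Q'\cap H=Q\cap H'$ as subschemes of $H\cap H'$; 2. $C$ and $C'$ have only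 planar singularities; 3. $\mathrm{Sing}\,Q'\cap\mathrm{Sing}\,Q=\emptyset$ and $\mathrm{Sing}\,C\cap\mathrm{Sing}\,C'=\emptyset$. Then there is a smooth (integral) K3 surface $S\subset\mathbb P^4$ which is the scheme-theoretic intersection of a quadric hypersurface and a cubic hypersurface and satisfies $S\cap H=C$ and $S\cap H'=C'$ as schemes. -/

import Mathlib

open MvPolynomial
open scoped LinearAlgebra.Projectivization KaehlerDifferential

noncomputable section

/-- Polynomials in the homogeneous coordinates `x_0, …, x_n` of complex projective space `ℙⁿ`. -/
abbrev PolyRing (n : ℕ) : Type := MvPolynomial (Fin (n + 1)) ℂ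

/-- A closed subscheme of `ℙⁿ` over `ℂ`, given by its saturated homogeneous ideal. (Closed
subschemes of `ℙⁿ` correspond bijectively to the homogeneous ideals `I` with
`(I : (x_0, …, x_n)) = I`; the empty subscheme corresponds to the unit ideal.) -/
@[ext]
structure ClosedSubscheme (n : ℕ) where
  ideal : Ideal (PolyRing n)
  homogeneous : ∀ f ∈ ideal, ∀ d : ℕ, homogeneousComponent d f ∈ ideal
  saturated : ∀ f : PolyRing n, (∀ i, X i * f ∈ ideal) → f ∈ ideal

namespace ClosedSubscheme

variable {n : ℕ}

/-- The closed subscheme of `ℙⁿ` cut out by a set `F` of homogeneous polynomials: its ideal is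
the smallest saturated homogeneous ideal that contains `F`, that is, the saturation of `(F)`. -/
def zeroScheme (F : Set (PolyRing n)) : ClosedSubscheme n where
  ideal := sInf {I | F ⊆ I ∧ (∀ f ∈ I, ∀ d : ℕ, homogeneousComponent d f ∈ I) ∧
    ∀ f : PolyRing n, (∀ i, X i * f ∈ I) → f ∈ I}
  homogeneous := fun f hf d => by
    rw [Submodule.mem_sInf] at hf ⊢
    exact fun I hI => hI.2.1 f (hf I hI) d
  saturated := fun f hf => by
    rw [Submodule.mem_sInf]
    intro I hI
    exact hI.2.2 f fun i => (Submodule.mem_sInf.mp (hf i)) I hI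

/-- The hypersurface `V(f)`. -/
def hypersurface (f : PolyRing n) : ClosedSubscheme n := zeroScheme {f}

/-- The scheme-theoretic intersection. -/
def inter (X Y : ClosedSubscheme n) : ClosedSubscheme n :=
  zeroScheme ((X.ideal : Set (PolyRing n)) ∪ Y.ideal)

/-- `X` is a closed subscheme of `Y`. -/
def IsContainedIn (X Y : ClosedSubscheme n) : Prop := Y.ideal ≤ X.ideal

/-- `H` is a hyperplane. -/
def IsHyperplane (H : ClosedSubscheme n) : Prop :=
  ∃ l : PolyRing n, l.IsHomogeneous 1 ∧ l ≠ 0 ∧ H = hypersurface l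

/-- `Q` is a quadric hypersurface in the hyperplane `H`. -/
def IsQuadricIn (Q H : ClosedSubscheme n) : Prop :=
  ∃ q : PolyRing n, q.IsHomogeneous 2 ∧ q ∉ H.ideal ∧ Q = H.inter (hypersurface q)

/-- `X` is the intersection of a quadric hypersurface and a cubic hypersurface. -/
def IsQuadricCubicIntersection (X : ClosedSubscheme n) : Prop :=
  ∃ g h : PolyRing n, g.IsHomogeneous 2 ∧ g ≠ 0 ∧ h.IsHomogeneous 3 ∧ h ≠ 0 ∧
    X = (hypersurface g).inter (hypersurface h)

/-- `X` has dimension `d`: its homogeneous coordinate ring has Krull dimension `d + 1`. -/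
def HasDim (X : ClosedSubscheme n) (d : ℕ) : Prop :=
  ringKrullDim (PolyRing n ⧸ X.ideal) = ((d + 1 : ℕ) : WithBot ℕ∞)

/-- The closed points of `X`. -/
def points (X : ClosedSubscheme n) : Set (ℙ ℂ (Fin (n + 1) → ℂ)) :=
  {p | ∀ f ∈ X.ideal, eval p.rep f = 0}

/-- The tangent space at `p` of the affine cone over `X`. At a point `p` of `X` it contains the
line `p`, and its quotient by that line is the Zariski tangent space of `X` at `p`; so its
dimension is `1 + dim T_p X`. -/
def coneTangentSpace (X : ClosedSubscheme n) (p : ℙ ℂ (Fin (n + 1) → ℂ)) :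
    Submodule ℂ (Fin (n + 1) → ℂ) where
  carrier := {w | ∀ f ∈ X.ideal, ∑ i, eval p.rep (pderiv i f) * w i = 0}
  zero_mem' := by intro f _; simp
  add_mem' := by
    intro v w hv hw f hf
    simp only [Pi.add_apply, mul_add, Finset.sum_add_distrib]
    rw [hv f hf, hw f hf, add_zero]
  smul_mem' := by
    intro c w hw f hf
    have h := congrArg (c * ·) (hw f hf)
    simp only [Finset.mul_sum, mul_zero] at h
    rw [← h]
    refine Finset.sum_congr rfl fun i _ => ?_
    simp only [Pi.smul_apply, smul_eq_mul]
    ring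

/-- The singular points of an equidimensional `X`: the points `p` with `dim T_p X ≠ dim X`
(both sides are compared after adding `1`). -/
def singularLocus (X : ClosedSubscheme n) : Set (ℙ ℂ (Fin (n + 1) → ℂ)) :=
  {p | p ∈ X.points ∧
    ((Module.finrank ℂ (X.coneTangentSpace p) : ℕ) : WithBot ℕ∞) ≠
      ringKrullDim (PolyRing n ⧸ X.ideal)}

/-- Every (singular) point of the curve `X` is planar: the Zariski tangent space has dimension at
most `2`. -/
def HasPlanarSingularities (X : ClosedSubscheme n) : Prop :=
  ∀ p ∈ X.singularLocus, Module.finrank ℂ (X.coneTangentSpace p) ≤ 3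

end ClosedSubscheme

/-- An integral closed subscheme of `ℙⁿ`. -/
structure ProjVariety (n : ℕ) extends ClosedSubscheme n where
  prime : ideal.IsPrime

namespace ProjVariety

variable {n : ℕ} (V : ProjVariety n)

/-- The homogeneous coordinate ring `ℂ[x_0, …, x_n] / I`. -/
abbrev CoordRing : Type := PolyRing n ⧸ V.ideal

instance : V.ideal.IsPrime := V.prime

/-- The field of fractions of the homogeneous coordinate ring. Sections of the sheaves `𝒪_V(m)`
over nonempty open sets are elements of it. -/
abbrev K : Type := FractionRing V.CoordRing

/-- The class of a polynomial. -/
def form (f : PolyRing n) : V.K := algebraMap V.CoordRing V.K (Ideal.Quotient.mk V.ideal f)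

/-- The class of a homogeneous coordinate. -/
def coord (i : Fin (n + 1)) : V.K := V.form (X i)

/-- The indices of the nonempty standard charts `V ∩ {x_i ≠ 0}`; these charts cover `V`. -/
abbrev Chart : Type := {i : Fin (n + 1) // (X i : PolyRing n) ∉ V.ideal}

theorem form_mul (f g : PolyRing n) : V.form (f * g) = V.form f * V.form g := by simp [form]

theorem form_add (f g : PolyRing n) : V.form (f + g) = V.form f + V.form g := by simp [form]

theorem form_pow (f : PolyRing n) (k : ℕ) : V.form (f ^ k) = V.form f ^ k := by simp [form]

theorem form_C (c : ℂ) : V.form (C c) = algebraMap ℂ V.K c := by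
  rw [IsScalarTower.algebraMap_apply ℂ V.CoordRing V.K]
  rfl

/-- The product of the coordinates that belong to a tuple of charts. -/
def denom {r : ℕ} (t : Fin (r + 1) → V.Chart) : PolyRing n := ∏ j, X (t j).1

theorem denom_pow_isHomogeneous {r : ℕ} (t : Fin (r + 1) → V.Chart) (k : ℕ) :
    (V.denom t ^ k).IsHomogeneous (k * (r + 1)) := by
  have h : (V.denom t).IsHomogeneous (r + 1) := by
    have := IsHomogeneous.prod (R := ℂ) Finset.univ
      (fun j : Fin (r + 1) => (X (t j).1 : PolyRing n)) (fun _ => 1) (fun j _ => isHomogeneous_X _ _)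
    simpa [denom] using this
  rw [mul_comm]
  exact h.pow k

/-- The sections of `𝒪_V(m)` over the intersection `V ∩ {x_{t 0} ≠ 0, …, x_{t r} ≠ 0}` of
standard charts: the fractions `a / (x_{t 0} ⋯ x_{t r}) ^ k` with `a` homogeneous of degree
`m + k (r + 1)`. -/
def sections (m : ℤ) {r : ℕ} (t : Fin (r + 1) → V.Chart) : Submodule ℂ V.K where
  carrier := {z | ∃ (k d : ℕ) (a : PolyRing n), a.IsHomogeneous d ∧
    (d : ℤ) = m + k * (r + 1) ∧ z * V.form (V.denom t ^ k) = V.form a}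
  zero_mem' := by
    refine ⟨m.natAbs, (m + m.natAbs * (r + 1)).toNat, 0, isHomogeneous_zero _ _ _, ?_,
      by simp [form]⟩
    have h : 0 ≤ m + m.natAbs * (r + 1 : ℤ) := by
      have h1 : (0 : ℤ) ≤ (m.natAbs : ℤ) * r := by positivity
      have h2 : (m.natAbs : ℤ) * (r + 1) = m.natAbs * r + m.natAbs := by ring
      omega
    rw [Int.toNat_of_nonneg h]
  add_mem' := by
    rintro y z ⟨k, d, a, ha, hd, hy⟩ ⟨l, e, b, hb, he, hz⟩
    have hD : d + l * (r + 1) = e + k * (r + 1) := by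
      zify; rw [hd, he]; ring
    refine ⟨k + l, d + l * (r + 1), a * V.denom t ^ l + b * V.denom t ^ k, ?_, ?_, ?_⟩
    · refine (ha.mul (V.denom_pow_isHomogeneous t l)).add ?_
      rw [hD]
      exact hb.mul (V.denom_pow_isHomogeneous t k)
    · push_cast; rw [hd]; ring
    · simp only [form_add, form_mul, pow_add, ← hy, ← hz]; ring
  smul_mem' := by
    rintro c z ⟨k, d, a, ha, hd, hz⟩
    refine ⟨k, d, C c * a, ?_, hd, ?_⟩
    · simpa using (isHomogeneous_C (Fin (n + 1)) c).mul ha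
    · rw [form_mul, form_C, ← hz, Algebra.smul_def, mul_assoc]

theorem coord_mul_mem_sections {m : ℤ} {r : ℕ} {t : Fin (r + 1) → V.Chart} (i : Fin (n + 1))
    {z : V.K} (hz : z ∈ V.sections m t) : V.coord i * z ∈ V.sections (m + 1) t := by
  obtain ⟨k, d, a, ha, hd, hz⟩ := hz
  refine ⟨k, 1 + d, X i * a, (isHomogeneous_X ℂ i).mul ha, by push_cast; rw [hd]; ring, ?_⟩
  rw [form_mul, ← hz, coord, mul_assoc]

/-- The global sections `H⁰(V, 𝒪_V(m))`. -/
def H0 (m : ℤ) : Submodule ℂ V.K := ⨅ i : V.Chart, V.sections m ![i]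

/-- The Čech 1-cocycles of `𝒪_V(m)` for the covering of `V` by the standard charts. -/
def Z1 (m : ℤ) : Submodule ℂ (V.Chart → V.Chart → V.K) where
  carrier := {c | (∀ i j, c i j ∈ V.sections m ![i, j]) ∧
    ∀ i j k, c i j + c j k = c i k}
  zero_mem' := ⟨fun _ _ => zero_mem _, by simp⟩
  add_mem' := fun {b c} hb hc => ⟨fun i j => add_mem (hb.1 i j) (hc.1 i j), fun i j k => by
    simp only [Pi.add_apply, ← hb.2 i j k, ← hc.2 i j k]; ring⟩
  smul_mem' := fun a c hc => ⟨fun i j => (V.sections m _).smul_mem a (hc.1 i j), fun i j k => by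
    simp only [Pi.smul_apply, ← hc.2 i j k, smul_add]⟩

/-- The Čech 1-coboundaries of `𝒪_V(m)`. -/
def B1 (m : ℤ) : Submodule ℂ (V.Chart → V.Chart → V.K) where
  carrier := {c | ∃ s : V.Chart → V.K, (∀ i, s i ∈ V.sections m ![i]) ∧
    ∀ i j, c i j = s j - s i}
  zero_mem' := ⟨0, fun _ => zero_mem _, by simp⟩
  add_mem' := by
    rintro b c ⟨s, hs, hb⟩ ⟨t, ht, hc⟩
    exact ⟨s + t, fun i => add_mem (hs i) (ht i), fun i j => by
      simp only [Pi.add_apply, hb, hc]; ring⟩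
  smul_mem' := by
    rintro a c ⟨s, hs, hc⟩
    exact ⟨a • s, fun i => (V.sections m _).smul_mem a (hs i), fun i j => by
      simp only [Pi.smul_apply, hc, smul_sub]⟩

/-- The cohomology group `H¹(V, 𝒪_V(m))`, as Čech cohomology of the standard affine covering. -/
abbrev H1 (m : ℤ) : Type := V.Z1 m ⧸ (V.B1 m).submoduleOf (V.Z1 m)

/-- Multiplication by `x_i` on cochains. -/
def mulCochain (i : Fin (n + 1)) :
    (V.Chart → V.Chart → V.K) →ₗ[ℂ] (V.Chart → V.Chart → V.K) where
  toFun c := fun j k => V.coord i * c j k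
  map_add' b c := by ext j k; simp [mul_add]
  map_smul' a c := by ext j k; simp

theorem mulCochain_mem_Z1 (i : Fin (n + 1)) {m : ℤ} {c : V.Chart → V.Chart → V.K}
    (hc : c ∈ V.Z1 m) : V.mulCochain i c ∈ V.Z1 (m + 1) :=
  ⟨fun j k => V.coord_mul_mem_sections i (hc.1 j k), fun j k l => by
    simp only [mulCochain, LinearMap.coe_mk, AddHom.coe_mk, ← hc.2 j k l, mul_add]⟩

theorem mulCochain_mem_B1 (i : Fin (n + 1)) {m : ℤ} {c : V.Chart → V.Chart → V.K}
    (hc : c ∈ V.B1 m) : V.mulCochain i c ∈ V.B1 (m + 1) := by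
  obtain ⟨s, hs, hc⟩ := hc
  exact ⟨fun j => V.coord i * s j, fun j => V.coord_mul_mem_sections i (hs j), fun j k => by
    simp only [mulCochain, LinearMap.coe_mk, AddHom.coe_mk, hc, mul_sub]⟩

/-- Multiplication by `x_i`, as a map `H¹(V, 𝒪_V(m)) → H¹(V, 𝒪_V(m + 1))`. -/
def mulH1 (i : Fin (n + 1)) (m : ℤ) : V.H1 m →ₗ[ℂ] V.H1 (m + 1) :=
  Submodule.mapQ _ _ ((V.mulCochain i).restrict fun _ hc => V.mulCochain_mem_Z1 i hc)
    fun _ hc => V.mulCochain_mem_B1 i hc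

/-- `V` is a curve. -/
def IsCurve : Prop := V.HasDim 1

/-- The arithmetic genus `h¹(V, 𝒪_V)` of an integral projective curve over `ℂ`. -/
def arithmeticGenus : ℕ := Module.finrank ℂ (V.H1 0)

/-- For a curve `V` with canonical (dualizing) sheaf `ω_V`: there is an isomorphism
`𝒪_V(r) ≅ ω_V`.

By definition of the dualizing sheaf, `H⁰(V, ω_V(-m)) = Hom(𝒪_V(m), ω_V)` is the dual space of
`H¹(V, 𝒪_V(m))`; so `ω_V` is the sheaf that belongs to the graded module
`⨁ₘ H⁰(V, ω_V(-m)) = ⨁ₘ H¹(V, 𝒪_V(m))^*`, on which `x_i` acts by the transpose of multiplication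
by `x_i`. An isomorphism of sheaves `𝒪_V(r) ≅ ω_V` is the same as an isomorphism `φ` of the graded
modules of sections of all their twists. -/
def CanonicalSheafIsTwist (r : ℤ) : Prop :=
  ∃ φ : ∀ m : ℤ, V.H0 (r - m) ≃ₗ[ℂ] Module.Dual ℂ (V.H1 m),
    ∀ (m : ℤ) (i : Fin (n + 1)) (s : V.H0 (r - (m + 1))) (xs : V.H0 (r - m)),
      (xs : V.K) = V.coord i * s → ∀ c : V.H1 m, φ m xs c = φ (m + 1) s (V.mulH1 i m c)

/-- The integral curve `V` is canonically embedded in the linear subspace `H` of `ℙⁿ`: it lies in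
`H`, its canonical sheaf is isomorphic to `𝒪_V(1)` (in particular invertible, so that `V` is
Gorenstein), and its embedding is the map given by all sections of the canonical sheaf, that is,
the restriction `H⁰(H, 𝒪_H(1)) → H⁰(V, 𝒪_V(1))` is bijective. -/
def IsCanonicallyEmbeddedIn (H : ClosedSubscheme n) : Prop :=
  V.IsContainedIn H ∧ V.CanonicalSheafIsTwist 1 ∧
    (∀ l : PolyRing n, l.IsHomogeneous 1 → l ∈ V.ideal → l ∈ H.ideal) ∧
    ∀ s ∈ V.H0 1, ∃ l : PolyRing n, l.IsHomogeneous 1 ∧ s = V.form l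

/-- `V` is smooth. -/
def IsSmooth : Prop := V.singularLocus = ∅

/-- The coordinate ring of the affine chart `V ∩ {x_i ≠ 0}`. -/
def chartRing (i : V.Chart) : Subalgebra ℂ V.K where
  carrier := V.sections 0 ![i]
  add_mem' := fun ha hb => add_mem ha hb
  mul_mem' := by
    rintro y z ⟨k, d, a, ha, hd, hy⟩ ⟨l, e, b, hb, he, hz⟩
    refine ⟨k + l, d + e, a * b, ha.mul hb, ?_, ?_⟩
    · push_cast at hd he ⊢; rw [hd, he]; ring
    · simp only [form_mul, pow_add, ← hy, ← hz]; ring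
  algebraMap_mem' := fun c =>
    ⟨0, 0, C c, isHomogeneous_C _ _, by simp, by rw [form_C]; simp [form]⟩

/-- The regular 2-forms on the chart `V ∩ {x_i ≠ 0}` of a smooth `V`, with coordinate ring `A`:
the `A`-module generated by all `da ∧ db` with `a, b ∈ A`. For smooth `V` the module `Ω²` of `A`
over `ℂ` is torsion-free, hence embeds in the 2-forms of the function field of `V` and in
those of its extension field `V.K`. -/
def regularTwoForms (i : V.Chart) : Submodule (V.chartRing i) (⋀[V.K]^2 Ω[V.K⁄ℂ]) :=
  Submodule.span (V.chartRing i) {η | ∃ a b : V.chartRing i,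
    η = exteriorPower.ιMulti V.K 2
      ![KaehlerDifferential.D ℂ V.K (a : V.K), KaehlerDifferential.D ℂ V.K (b : V.K)]}

/-- For a smooth surface `V`: the sheaf `Ω²_V` is isomorphic to `𝒪_V`, that is, there is a 2-form
`η ≠ 0` that generates the module of regular 2-forms on every chart. -/
def TwoFormsTrivial : Prop :=
  ∃ η : ⋀[V.K]^2 Ω[V.K⁄ℂ], η ≠ 0 ∧
    ∀ i : V.Chart, V.regularTwoForms i = Submodule.span (V.chartRing i) {η}

/-- `V` is a (smooth) K3 surface: a smooth projective surface with `Ω²_V ≅ 𝒪_V` and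
`H¹(V, 𝒪_V) = 0`. -/
def IsK3Surface : Prop :=
  V.HasDim 2 ∧ V.IsSmooth ∧ V.TwoFormsTrivial ∧ Subsingleton (V.H1 0)

end ProjVariety

end

/-! ### Homogeneous ideals of polynomial rings -/

namespace MvPolynomial

variable {σ k : Type*} [Field k]

/-! Equations of one curve. A canonical curve `C` of genus four in the hyperplane `l = 0` is the
complete intersection of `l`, its quadric `q` and a cubic `c`, and it is projectively normal: all
sections of `𝒪_C(m)` are forms of degree `m` (`ProjVariety.canonicalEquations`). Let `Γ` be the
section of `C` by a coordinate hyperplane `y = 0`, and let the linear form `z` have no zero on `Γ`.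
The duality between `H⁰(1 - m)` and `H¹(m)` and the exact sequence of `Γ` give `h⁰(m) = 1, 4, 9, 15,
…`, growing by `6 = 2g - 2` from degree two on. As `z` is a unit on `Γ`, sections of degree at least
four are combinations of `y` and `z` with sections of one degree less, and so in large degrees all
sections are forms. Comparison with the Hilbert function `(m + 1)²` of the quadric surface excludes
a second quadric, excludes missing forms in degree three, and leaves room for one cubic, whose
complete intersection with the quadric already has the Hilbert function of `C`.

Common equations. The equations `q'` and `c'` of `C'` vanish on `C' ∩ H = C ∩ H'`. By projective
normality of `C`, forms `a` and `b` exist such that `g = q' - a l'` and `f = c' - b l'` vanish on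
`C`; they still vanish on `C'`. The same `g` and `f` thus define both curves in their hyperplanes
(`CanonicalEquations.exists_common`), and so do `G = g + t l l'` and `F = f + l l' L` for every
scalar `t` and linear form `L`.

Smoothness (`CanonicalEquations.exists_smooth`). At a smooth point of `C` the gradients of `l`, `g`,
`f` are independent, hence so are those of `G` and `F`. The curves have finitely many singular
points. At one with `l' ≠ 0`, planarity leaves at most one bad value of `L`, once `t` is such that
`G` is smooth there. A point with `l = l' = 0` is smooth on one of the curves, because the singular
loci are disjoint. Off both hyperplanes a Bertini argument applies: the coefficients of `L` are
algebraically independent over a countable field that contains all other data, and a point of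
tangency would bound the transcendence degree of these coefficients by four. This needs `G` to have
no singular point there, which fails for at most two values of `t`.

The K3 property (`CanonicalEquations.isK3Surface`). The ideal `(G, F)` is prime because it becomes
the prime ideal of `C` after adding the nonzerodivisor `l`. Projective normality of `C` makes
multiplication by `l` injective on `H¹(S, 𝒪(m))` for `m ≥ 0`, while a power of `l` kills each class,
so `H¹(S, 𝒪) = 0`. The residue form, obtained by dividing the Euler contraction of `dx_a ∧ dx_b ∧
dx_e` by the complementary Jacobian minor of `(G, F)`, has weight zero because `2 + 3 = 5`, and it
generates the regular two-forms on every chart. -/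

theorem homogeneousComponent_mul_of_isHomogeneous {f : MvPolynomial σ k} {e : ℕ}
    (hf : f.IsHomogeneous e) (a : MvPolynomial σ k) (d : ℕ) :
    homogeneousComponent (d + e) (a * f) = homogeneousComponent d a * f := by
  conv_lhs => rw [← sum_homogeneousComponent a, Finset.sum_mul, map_sum]
  have h : ∀ i, homogeneousComponent (d + e) (homogeneousComponent i a * f) =
      if i = d then homogeneousComponent i a * f else 0 := by
    intro i
    rw [homogeneousComponent_of_mem ((homogeneousComponent_isHomogeneous i a).mul hf)]
    simp only [Nat.add_right_cancel_iff, eq_comm]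
  simp only [h, Finset.sum_ite_eq', Finset.mem_range]
  split_ifs with hd
  · rfl
  · rw [homogeneousComponent_eq_zero _ _ (by omega), zero_mul]

theorem homogeneousComponent_mul_of_lt {f : MvPolynomial σ k} {e d : ℕ}
    (hf : f.IsHomogeneous e) (a : MvPolynomial σ k) (h : d < e) :
    homogeneousComponent d (a * f) = 0 := by
  conv_lhs => rw [← sum_homogeneousComponent a, Finset.sum_mul, map_sum]
  refine Finset.sum_eq_zero fun i _ => ?_
  rw [homogeneousComponent_of_mem ((homogeneousComponent_isHomogeneous i a).mul hf),
    if_neg (by omega)]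

/-- An ideal is homogeneous if it contains the homogeneous components of its elements. -/
def IsHomogIdeal (I : Ideal (MvPolynomial σ k)) : Prop :=
  ∀ f ∈ I, ∀ d : ℕ, homogeneousComponent d f ∈ I

theorem isHomogIdeal_bot : IsHomogIdeal (⊥ : Ideal (MvPolynomial σ k)) := by
  intro f hf d
  rw [Ideal.mem_bot] at hf
  simp [hf]

theorem IsHomogIdeal.sup {I J : Ideal (MvPolynomial σ k)} (hI : IsHomogIdeal I)
    (hJ : IsHomogIdeal J) : IsHomogIdeal (I ⊔ J) := by
  intro f hf d
  obtain ⟨a, ha, b, hb, rfl⟩ := Submodule.mem_sup.mp hf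
  rw [map_add]
  exact Submodule.add_mem_sup (hI a ha d) (hJ b hb d)

theorem isHomogIdeal_span_singleton {f : MvPolynomial σ k} {e : ℕ} (hf : f.IsHomogeneous e) :
    IsHomogIdeal (Ideal.span {f}) := by
  intro g hg d
  obtain ⟨a, rfl⟩ := Ideal.mem_span_singleton'.mp hg
  rcases lt_or_ge d e with h | h
  · rw [homogeneousComponent_mul_of_lt hf a h]; exact zero_mem _
  · obtain ⟨c, rfl⟩ := Nat.exists_eq_add_of_le' h
    rw [homogeneousComponent_mul_of_isHomogeneous hf]
    exact Ideal.mul_mem_left _ _ (Ideal.mem_span_singleton_self f)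

/-- In the component of degree `d + e` of `f = i + a * g`, only the component of degree `d` of `a`
contributes. -/
theorem IsHomogIdeal.exists_of_mem_sup_span {I : Ideal (MvPolynomial σ k)} (hI : IsHomogIdeal I)
    {f g : MvPolynomial σ k} {d e : ℕ} (hf : f.IsHomogeneous (d + e)) (hg : g.IsHomogeneous e)
    (h : f ∈ I ⊔ Ideal.span {g}) : ∃ a : MvPolynomial σ k, a.IsHomogeneous d ∧ f - a * g ∈ I := by
  obtain ⟨i, hi, b, hb, rfl⟩ := Submodule.mem_sup.mp h
  obtain ⟨a, rfl⟩ := Ideal.mem_span_singleton'.mp hb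
  refine ⟨homogeneousComponent d a, homogeneousComponent_isHomogeneous d a, ?_⟩
  have h1 := homogeneousComponent_eq_self hf
  rw [map_add, homogeneousComponent_mul_of_isHomogeneous hg] at h1
  rw [← h1, add_sub_cancel_right]
  exact hI i hi _

theorem IsHomogIdeal.mem_of_mem_sup_span_of_lt {I : Ideal (MvPolynomial σ k)}
    (hI : IsHomogIdeal I) {f g : MvPolynomial σ k} {d e : ℕ} (hf : f.IsHomogeneous d)
    (hg : g.IsHomogeneous e) (hde : d < e) (h : f ∈ I ⊔ Ideal.span {g}) : f ∈ I := by
  obtain ⟨i, hi, b, hb, rfl⟩ := Submodule.mem_sup.mp h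
  obtain ⟨a, rfl⟩ := Ideal.mem_span_singleton'.mp hb
  have h1 := homogeneousComponent_eq_self hf
  rw [map_add, homogeneousComponent_mul_of_lt hg a hde, add_zero] at h1
  rw [← h1]
  exact hI i hi _

theorem IsHomogIdeal.le_of_forall_homogeneous {I J : Ideal (MvPolynomial σ k)}
    (hI : IsHomogIdeal I) (h : ∀ d, ∀ f ∈ I, f.IsHomogeneous d → f ∈ J) : I ≤ J := by
  intro f hf
  rw [← sum_homogeneousComponent f]
  exact Ideal.sum_mem _ fun i _ => h i _ (hI f hf i) (homogeneousComponent_isHomogeneous i f)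

/-- The homogeneous elements of degree `m` of an ideal. -/
noncomputable def degreePart (I : Ideal (MvPolynomial σ k)) (m : ℕ) :
    Submodule k (MvPolynomial σ k) :=
  homogeneousSubmodule σ k m ⊓ I.restrictScalars k

theorem mem_degreePart {I : Ideal (MvPolynomial σ k)} {m : ℕ} {f : MvPolynomial σ k} :
    f ∈ degreePart I m ↔ f.IsHomogeneous m ∧ f ∈ I := Iff.rfl

theorem finiteDimensional_homogeneousSubmodule [Finite σ] (m : ℕ) :
    FiniteDimensional k (homogeneousSubmodule σ k m) :=
  Module.Finite.iff_fg.mpr (homogeneousSubmodule_fg σ k m)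

theorem finiteDimensional_degreePart [Finite σ] (I : Ideal (MvPolynomial σ k)) (m : ℕ) :
    FiniteDimensional k (degreePart I m) :=
  have := finiteDimensional_homogeneousSubmodule (σ := σ) (k := k) m
  Submodule.finiteDimensional_inf_left _ _

/-- The monomials of degree `m` are a basis; they correspond to multisets of size `m`, which are
counted by stars and bars. -/
theorem finrank_homogeneousSubmodule [Fintype σ] [DecidableEq σ] (m : ℕ) :
    Module.finrank k (homogeneousSubmodule σ k m) = (Fintype.card σ + m - 1).choose m := by
  rw [homogeneousSubmodule_eq_finsupp_supported,
    (AddMonoidAlgebra.supportedEquivFinsupp {d : σ →₀ ℕ | d.degree = m}).finrank_eq]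
  have e : ↑{d : σ →₀ ℕ | d.degree = m} ≃ Sym σ m :=
    (Equiv.subtypeEquivRight fun d => by
      rw [Set.mem_ofPred_eq, Finsupp.degree_apply]; rfl).trans (Sym.equivNatSum σ m).symm
  have : Fintype ↑{d : σ →₀ ℕ | d.degree = m} := Fintype.ofEquiv _ e.symm
  rw [← Sym.card_sym_eq_choose, ← Fintype.card_congr e]
  exact Module.finrank_finsupp_self k

theorem degreePart_mono {I J : Ideal (MvPolynomial σ k)} (h : I ≤ J) (m : ℕ) :
    degreePart I m ≤ degreePart J m := inf_le_inf_left _ h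

/-- Dimension count for a homogeneous ideal and a homogeneous nonzerodivisor modulo it. -/
theorem finrank_degreePart_sup_span [Finite σ] {I : Ideal (MvPolynomial σ k)}
    (hI : IsHomogIdeal I) {g : MvPolynomial σ k} {e : ℕ} (hg : g.IsHomogeneous e)
    (hreg : ∀ a, a * g ∈ I → a ∈ I) (m : ℕ) :
    Module.finrank k (degreePart (I ⊔ Ideal.span {g}) (m + e)) + Module.finrank k (degreePart I m) =
      Module.finrank k (homogeneousSubmodule σ k m) +
        Module.finrank k (degreePart I (m + e)) := by
  have h1 := finiteDimensional_homogeneousSubmodule (σ := σ) (k := k) m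
  have h2 := finiteDimensional_degreePart I m
  have h3 := finiteDimensional_degreePart I (m + e)
  have h4 := finiteDimensional_degreePart (I ⊔ Ideal.span {g}) (m + e)
  have hsup : degreePart (I ⊔ Ideal.span {g}) (m + e) =
      degreePart I (m + e) ⊔ (homogeneousSubmodule σ k m).map (LinearMap.mulRight k g) := by
    apply le_antisymm
    · intro f hf
      obtain ⟨a, ha, hfa⟩ := hI.exists_of_mem_sup_span hf.1 hg hf.2
      have : f = (f - a * g) + a * g := by ring
      rw [this]
      refine Submodule.add_mem_sup ⟨?_, hfa⟩ ⟨a, ha, rfl⟩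
      exact IsHomogeneous.sub hf.1 (ha.mul hg)
    · refine sup_le (degreePart_mono le_sup_left _) ?_
      rintro _ ⟨a, ha, rfl⟩
      exact ⟨IsHomogeneous.mul ha hg,
        Ideal.mem_sup_right (Ideal.mul_mem_left _ _ (Ideal.mem_span_singleton_self g))⟩
  -- Multiplication by `g` is injective only for `g ≠ 0`; for `g = 0` regularity forces `I` to be
  -- the unit ideal.
  by_cases hg0 : g = 0
  · subst hg0
    have htop : ∀ a, a ∈ I := fun a => hreg a (by simp)
    have e1 : degreePart I m = homogeneousSubmodule σ k m :=
      inf_eq_left.mpr fun a _ => htop a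
    have e2 : degreePart (I ⊔ Ideal.span {0}) (m + e) = degreePart I (m + e) := by
      simp
    rw [e1, e2, add_comm]
  have hinf : degreePart I (m + e) ⊓ (homogeneousSubmodule σ k m).map (LinearMap.mulRight k g) =
      (degreePart I m).map (LinearMap.mulRight k g) := by
    apply le_antisymm
    · rintro _ ⟨h, a, ha, rfl⟩
      exact ⟨a, ⟨ha, hreg a h.2⟩, rfl⟩
    · rintro _ ⟨a, ha, rfl⟩
      exact ⟨⟨IsHomogeneous.mul ha.1 hg, Ideal.mul_mem_right _ _ ha.2⟩, a, ha.1, rfl⟩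
  have hinj : Function.Injective (LinearMap.mulRight k g) := fun a b hab =>
    mul_right_cancel₀ hg0 hab
  have hmain := Submodule.finrank_sup_add_finrank_inf_eq (degreePart I (m + e))
    ((homogeneousSubmodule σ k m).map (LinearMap.mulRight k g))
  rw [← hsup, hinf, ← (Submodule.equivMapOfInjective _ hinj _).finrank_eq,
    ← (Submodule.equivMapOfInjective _ hinj _).finrank_eq] at hmain
  rw [hmain, add_comm]

theorem degreePart_sup_span_of_lt {I : Ideal (MvPolynomial σ k)}
    (hI : IsHomogIdeal I) {g : MvPolynomial σ k} {e m : ℕ} (hg : g.IsHomogeneous e) (h : m < e) :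
    degreePart (I ⊔ Ideal.span {g}) m = degreePart I m := by
  apply le_antisymm _ (degreePart_mono le_sup_left m)
  exact fun f hf => ⟨hf.1, hI.mem_of_mem_sup_span_of_lt hf.1 hg h hf.2⟩

theorem degreePart_bot (m : ℕ) : degreePart (⊥ : Ideal (MvPolynomial σ k)) m = ⊥ :=
  inf_eq_right.mpr fun f hf => by
    rw [Submodule.restrictScalars_mem, Ideal.mem_bot] at hf
    rw [hf]; exact zero_mem _

theorem homogeneous_eq_C {f : MvPolynomial σ k} (hf : f.IsHomogeneous 0) : ∃ c : k, f = C c :=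
  ⟨coeff 0 f, totalDegree_eq_zero_iff_eq_C.mp ((totalDegree_zero_iff_isHomogeneous σ).mpr hf)⟩

/-- If `A / l` is a domain and `l` a homogeneous nonzerodivisor of positive degree of the graded
ring `A`, then `A` is a domain. -/
theorem isPrime_of_isPrime_sup_span {I : Ideal (MvPolynomial σ k)} (hI : IsHomogIdeal I)
    {l : MvPolynomial σ k} (hl : l.IsHomogeneous 1) (hreg : ∀ a, a * l ∈ I → a ∈ I)
    (hp : (I ⊔ Ideal.span {l}).IsPrime) : I.IsPrime := by
  -- Induction on the total degree: a factor that lies in `I + (l)` is a multiple of `l` modulo `I`,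
  -- and `l` can be cancelled.
  have key : ∀ N d e : ℕ, d + e = N → ∀ a b : MvPolynomial σ k, a.IsHomogeneous d →
      b.IsHomogeneous e → a * b ∈ I → a ∈ I ∨ b ∈ I := by
    intro N
    induction N using Nat.strong_induction_on with
    | _ N ih =>
      have step : ∀ d e : ℕ, d + e = N → ∀ a b : MvPolynomial σ k, a.IsHomogeneous d →
          b.IsHomogeneous e → a * b ∈ I → a ∈ I ⊔ Ideal.span {l} → a ∈ I ∨ b ∈ I := by
        intro d e hde a b ha hb hab hal
        rcases d with _ | d
        · exact Or.inl (hI.mem_of_mem_sup_span_of_lt ha hl one_pos hal)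
        · obtain ⟨c, hc, hac⟩ := hI.exists_of_mem_sup_span ha hl hal
          have h1 : c * b ∈ I := by
            apply hreg
            have : c * b * l = a * b - (a - c * l) * b := by ring
            rw [this]
            exact I.sub_mem hab (I.mul_mem_right _ hac)
          rcases ih (d + e) (by omega) d e rfl c b hc hb h1 with h | h
          · left
            have : a = (a - c * l) + c * l := by ring
            rw [this]
            exact I.add_mem hac (I.mul_mem_right _ h)
          · exact Or.inr h
      intro d e hde a b ha hb hab
      rcases hp.mem_or_mem (Ideal.mem_sup_left hab) with h | h
      · exact step d e hde a b ha hb hab h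
      · exact (step e d (by omega) b a hb ha (by rwa [mul_comm]) h).symm
  have htop : I ≠ ⊤ := fun h => hp.ne_top (by rw [h, top_sup_eq])
  let _ := MvPolynomial.gradedAlgebra (σ := σ) (R := k)
  have hI' : I.IsHomogeneous (homogeneousSubmodule σ k) := by
    intro i f hf
    have := hI f hf i
    rwa [← decomposition.decompose'_apply] at this
  refine hI'.isPrime_of_homogeneous_mem_or_mem htop ?_
  rintro x y ⟨d, hx⟩ ⟨e, hy⟩ hxy
  exact key (d + e) d e rfl x y hx hy hxy

end MvPolynomial

/-! ### Linear forms -/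

namespace MvPolynomial

theorem IsHomogeneous.eq_sum_coeff {n : ℕ} {l : PolyRing n} (hl : l.IsHomogeneous 1) :
    ∃ a : Fin (n + 1) → ℂ, l = ∑ i, C (a i) * X i := by
  have h : l ∈ homogeneousSubmodule (Fin (n + 1)) ℂ 1 := hl
  rw [homogeneousSubmodule_one_eq_span_X, Submodule.mem_span_range_iff_exists_fun] at h
  obtain ⟨a, rfl⟩ := h
  exact ⟨a, by simp [smul_eq_C_mul]⟩

theorem isHomogeneous_sum_C_mul_X {n : ℕ} (a : Fin (n + 1) → ℂ) :
    (∑ i, C (a i) * X i : PolyRing n).IsHomogeneous 1 :=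
  IsHomogeneous.sum _ _ _ fun _ _ => isHomogeneous_C_mul_X _ _

/-- Elimination of a variable with the help of a linear form. -/
theorem exists_elimination {n : ℕ} {l : PolyRing n} (hl : l.IsHomogeneous 1) (h0 : l ≠ 0) :
    ∃ (k : Fin (n + 1)) (π : PolyRing n →ₐ[ℂ] MvPolynomial {i : Fin (n + 1) // i ≠ k} ℂ)
      (ι : MvPolynomial {i : Fin (n + 1) // i ≠ k} ℂ →ₐ[ℂ] PolyRing n),
      (∀ f, π (ι f) = f) ∧ (∀ f, f - ι (π f) ∈ Ideal.span {l}) ∧ (∀ f,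
          π f = 0 ↔ f ∈ Ideal.span {l}) ∧
      (∀ f d, f.IsHomogeneous d → (π f).IsHomogeneous d) ∧
      ∀ f d, f.IsHomogeneous d → (ι f).IsHomogeneous d := by
  obtain ⟨a, rfl⟩ := hl.eq_sum_coeff
  obtain ⟨k, hk⟩ : ∃ k, a k ≠ 0 := by
    by_contra! h
    exact h0 (by simp [h])
  set l : PolyRing n := ∑ i, C (a i) * X i with hl_def
  let s : MvPolynomial {i : Fin (n + 1) // i ≠ k} ℂ := ∑ i, C (-(a k)⁻¹ * a i.1) * X i
  let π : PolyRing n →ₐ[ℂ] MvPolynomial {i : Fin (n + 1) // i ≠ k} ℂ :=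
    aeval fun i => if h : i ≠ k then X ⟨i, h⟩ else s
  let ι : MvPolynomial {i : Fin (n + 1) // i ≠ k} ℂ →ₐ[ℂ] PolyRing n := rename Subtype.val
  have hπX : ∀ i : {i : Fin (n + 1) // i ≠ k}, π (X i.1) = X i := fun i => by
    simp [π, i.2]
  have hπk : π (X k) = s := by simp [π]
  have hπι : ∀ f, π (ι f) = f := by
    intro f
    have : π.comp ι = AlgHom.id ℂ _ := by
      apply MvPolynomial.algHom_ext
      intro i
      simp [ι, hπX]
    exact DFunLike.congr_fun this f
  have hls : l = C (a k) * X k + ∑ i : {i : Fin (n + 1) // i ≠ k}, C (a i.1) * X i.1 := by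
    rw [hl_def, ← Finset.add_sum_erase _ _ (Finset.mem_univ k)]
    congr 1
    refine (Finset.sum_subtype _ (fun i => ?_) _)
    simp
  have hιs : X k - ι s = C (a k)⁻¹ * l := by
    rw [hls, mul_add, ← mul_assoc, ← C_mul, inv_mul_cancel₀ hk, C_1, one_mul, sub_eq_add_neg,
      Finset.mul_sum]
    congr 1
    simp only [s, ι, map_sum, map_mul, rename_C, rename_X, ← Finset.sum_neg_distrib]
    refine Finset.sum_congr rfl fun i _ => ?_
    simp only [map_neg, neg_mul, neg_neg]
    ring
  have hπl : π l = 0 := by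
    rw [hls]
    simp only [map_add, map_mul, map_sum, hπX, hπk, algHom_C, algebraMap_eq, s, Finset.mul_sum]
    rw [← Finset.sum_add_distrib]
    refine Finset.sum_eq_zero fun i _ => ?_
    have h1 : a k * (-(a k)⁻¹ * a i.1) + a i.1 = 0 := by field_simp; ring
    have h2 := congrArg (C (σ := {i : Fin (n + 1) // i ≠ k})) h1
    rw [map_add, map_mul, map_mul, map_zero] at h2
    linear_combination X i * h2
  have hsub : ∀ f, f - ι (π f) ∈ Ideal.span {l} := by
    intro f
    rw [← Ideal.Quotient.eq]
    have : (Ideal.Quotient.mkₐ ℂ (Ideal.span {l})) =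
        (Ideal.Quotient.mkₐ ℂ (Ideal.span {l})).comp (ι.comp π) := by
      apply MvPolynomial.algHom_ext
      intro i
      simp only [AlgHom.comp_apply, Ideal.Quotient.mkₐ_eq_mk]
      rw [Ideal.Quotient.eq]
      by_cases hi : i = k
      · subst hi
        rw [hπk, hιs]
        exact Ideal.mul_mem_left _ _ (Ideal.mem_span_singleton_self l)
      · have := hπX ⟨i, hi⟩
        simp only at this
        rw [this]
        simp [ι]
    exact DFunLike.congr_fun this f
  refine ⟨k, π, ι, hπι, hsub, fun f => ⟨fun h => ?_, fun h => ?_⟩, fun f d hf => ?_,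
      fun f d hf => ?_⟩
  · simpa [h] using hsub f
  · obtain ⟨b, rfl⟩ := Ideal.mem_span_singleton'.mp h
    rw [map_mul, hπl, mul_zero]
  · rw [← one_mul d]
    refine hf.aeval _ fun i => ?_
    split_ifs with h
    · exact isHomogeneous_X _ _
    · exact IsHomogeneous.sum _ _ _ fun _ _ => isHomogeneous_C_mul_X _ _
  · change (rename Subtype.val f).IsHomogeneous d
    exact hf.rename_isHomogeneous

theorem isPrime_span_linear {n : ℕ} {l : PolyRing n} (hl : l.IsHomogeneous 1) (h0 : l ≠ 0) :
    (Ideal.span {l}).IsPrime := by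
  obtain ⟨k, π, ι, -, -, hker, -, -⟩ := exists_elimination hl h0
  have : Ideal.span {l} = RingHom.ker π := by
    ext f; rw [RingHom.mem_ker, hker]
  rw [this]
  exact RingHom.ker_isPrime _

/-- A factorisation of a quadratic form might a priori have inhomogeneous factors; this passes to
their leading linear forms. -/
theorem homogeneousComponent_two_mul {σ : Type*} {a b : MvPolynomial σ ℂ} (ha : a.totalDegree ≤ 1)
    (hb : b.totalDegree ≤ 1) : homogeneousComponent 2 (a * b) =
      homogeneousComponent 1 a * homogeneousComponent 1 b := by
  have hdec : ∀ a : MvPolynomial σ ℂ, a.totalDegree ≤ 1 →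
      a = homogeneousComponent 0 a + homogeneousComponent 1 a := by
    intro a ha
    conv_lhs => rw [← sum_homogeneousComponent a]
    rw [Finset.sum_subset (Finset.range_mono (show a.totalDegree + 1 ≤ 2 by omega))]
    · simp [Finset.sum_range_succ]
    · intro i _ hi
      exact homogeneousComponent_eq_zero _ _ (by simpa using hi)
  conv_lhs => rw [hdec a ha, hdec b hb]
  have h := homogeneousComponent_isHomogeneous (R := ℂ) (σ := σ)
  rw [add_mul, mul_add, mul_add]
  simp only [map_add]
  rw [homogeneousComponent_of_mem ((h 0 a).mul (h 0 b)),
      homogeneousComponent_of_mem ((h 0 a).mul (h 1 b)),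
    homogeneousComponent_of_mem ((h 1 a).mul (h 0 b)),
        homogeneousComponent_of_mem ((h 1 a).mul (h 1 b))]
  simp

/-- A quadric in a hyperplane that contains a nondegenerate integral subscheme is integral. -/
theorem isPrime_span_linear_sup_span_quadric {n : ℕ} {I : Ideal (PolyRing n)} (hI : I.IsPrime)
    {l q : PolyRing n} (hl : l.IsHomogeneous 1) (h0 : l ≠ 0) (hlI : l ∈ I)
    (hlin : ∀ f, f.IsHomogeneous 1 → f ∈ I → f ∈ Ideal.span {l})
    (hq : q.IsHomogeneous 2) (hqI : q ∈ I) (hql : q ∉ Ideal.span {l}) :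
    (Ideal.span {l} ⊔ Ideal.span {q}).IsPrime := by
  obtain ⟨k, π, ι, hπι, hsub, hker, hπd, hιd⟩ := exists_elimination hl h0
  have hπq : π q ≠ 0 := fun h => hql ((hker q).mp h)
  have hspan : Ideal.span {l} ≤ I := (Ideal.span_singleton_le_iff_mem I).mpr hlI
  have hirr : Irreducible (π q) := by
    constructor
    · intro hu
      obtain ⟨c, hc, hc'⟩ := MvPolynomial.isUnit_iff_eq_C_of_isReduced.mp hu
      have := (hπd q 2 hq).inj_right (hc' ▸ isHomogeneous_C _ c) hπq
      omega
    · intro a b hab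
      have ha0 : a ≠ 0 := by rintro rfl; simp [hab] at hπq
      have hb0 : b ≠ 0 := by rintro rfl; simp [hab] at hπq
      have hdeg : a.totalDegree + b.totalDegree = 2 := by
        rw [← totalDegree_mul_of_isDomain ha0 hb0, ← hab, (hπd q 2 hq).totalDegree hπq]
      have hunit : ∀ a : MvPolynomial {i : Fin (n + 1) // i ≠ k} ℂ, a ≠ 0 → a.totalDegree = 0 →
          IsUnit a := by
        intro a ha0 ha
        rw [totalDegree_eq_zero_iff_eq_C] at ha
        rw [ha]
        refine (IsUnit.mk0 _ ?_).map C
        intro h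
        rw [h, C_0] at ha
        exact ha0 ha
      by_cases ha : a.totalDegree = 0
      · exact Or.inl (hunit a ha0 ha)
      by_cases hb : b.totalDegree = 0
      · exact Or.inr (hunit b hb0 hb)
      exfalso
      have h2 := homogeneousComponent_two_mul (a := a) (b := b) (by omega) (by omega)
      rw [← hab, homogeneousComponent_eq_self (hπd q 2 hq)] at h2
      -- The product of the two leading forms lies in the prime `I`, so one of them does; but `I`
      -- has no linear forms outside `(l)`, and that factor is zero after the elimination.
      have hmem : ι (homogeneousComponent 1 a) * ι (homogeneousComponent 1 b) ∈ I := by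
        rw [← map_mul, ← h2]
        have := I.sub_mem hqI (hspan (hsub q))
        simpa using this
      have hz : ∀ c : MvPolynomial {i : Fin (n + 1) // i ≠ k} ℂ, c.IsHomogeneous 1 → ι c ∈ I →
          c = 0 := by
        intro c hc hcI
        rw [← hπι c, hker]
        exact hlin _ (hιd c 1 hc) hcI
      rcases hI.mem_or_mem hmem with h | h
      · rw [hz _ (homogeneousComponent_isHomogeneous _ _) h, zero_mul] at h2
        exact hπq h2
      · rw [hz _ (homogeneousComponent_isHomogeneous _ _) h, mul_zero] at h2
        exact hπq h2
  have hprime : (Ideal.span {π q}).IsPrime :=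
    (Ideal.span_singleton_prime hπq).mpr hirr.prime
  have : Ideal.span {l} ⊔ Ideal.span {q} = (Ideal.span {π q}).comap π := by
    apply le_antisymm
    · refine sup_le ?_ ?_
      · rw [Ideal.span_singleton_le_iff_mem, Ideal.mem_comap,
          (hker l).mpr (Ideal.mem_span_singleton_self l)]
        exact zero_mem _
      · rw [Ideal.span_singleton_le_iff_mem, Ideal.mem_comap]
        exact Ideal.mem_span_singleton_self _
    · intro f hf
      obtain ⟨b, hb⟩ := Ideal.mem_span_singleton'.mp (Ideal.mem_comap.mp hf)
      have h1 : f - ι b * q ∈ Ideal.span {l} := by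
        rw [← hker, map_sub, map_mul, hπι, hb, sub_self]
      have : f = (f - ι b * q) + ι b * q := by ring
      rw [this]
      exact Submodule.add_mem_sup h1 (Ideal.mul_mem_left _ _ (Ideal.mem_span_singleton_self q))
  rw [this]
  exact Ideal.comap_isPrime _ _

/-! ### Points of projective space as prime ideals -/

variable {n : ℕ}

/-- The homogeneous ideal of the point of projective space with coordinates `v`. -/
noncomputable def pointIdeal (v : Fin (n + 1) → ℂ) : Ideal (PolyRing n) :=
  RingHom.ker (aeval (R := ℂ) fun i => Polynomial.C (v i) * (Polynomial.X : Polynomial ℂ))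

theorem aeval_line {v : Fin (n + 1) → ℂ} {f : PolyRing n} {d : ℕ} (hf : f.IsHomogeneous d) :
    aeval (R := ℂ) (fun i => Polynomial.C (v i) * (Polynomial.X : Polynomial ℂ)) f =
      Polynomial.C (eval v f) * Polynomial.X ^ d := by
  rw [aeval_def, eval₂_eq', eval_eq', map_sum, Finset.sum_mul]
  refine Finset.sum_congr rfl fun s hs => ?_
  have hd : ∑ i, s i = d := by
    have := hf.degree_eq_sum_deg_support hs
    rw [this]
    exact (Finset.sum_subset (Finset.subset_univ _) (by simp)).symm
  simp only [mul_pow, Finset.prod_mul_distrib, Finset.prod_pow_eq_pow_sum, hd, map_mul, map_prod,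
    map_pow, Polynomial.algebraMap_eq, mul_assoc]

instance (v : Fin (n + 1) → ℂ) : (pointIdeal v).IsPrime := RingHom.ker_isPrime _

theorem mem_pointIdeal {v : Fin (n + 1) → ℂ} {f : PolyRing n} {d : ℕ} (hf : f.IsHomogeneous d) :
    f ∈ pointIdeal v ↔ eval v f = 0 := by
  rw [pointIdeal, RingHom.mem_ker, aeval_line hf]
  simp

theorem IsHomogIdeal.le_pointIdeal {I : Ideal (PolyRing n)} (hI : IsHomogIdeal I)
    {v : Fin (n + 1) → ℂ} (hv : ∀ f ∈ I, eval v f = 0) : I ≤ pointIdeal v :=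
  hI.le_of_forall_homogeneous fun _ f hf hd => (mem_pointIdeal hd).mpr (hv f hf)

/-- The line over a point contains the origin of the affine cone. This lengthens a chain of primes
ending at a point by one. -/
theorem pointIdeal_lt {v : Fin (n + 1) → ℂ} (hv : v ≠ 0) :
    pointIdeal v < RingHom.ker (eval (0 : Fin (n + 1) → ℂ)) := by
  refine lt_of_le_of_ne ?_ ?_
  · intro f hf
    rw [pointIdeal, RingHom.mem_ker] at hf
    have := congrArg (Polynomial.eval 0) hf
    rw [RingHom.mem_ker]
    have e : (Polynomial.evalRingHom (0 : ℂ)).comp (eval₂Hom (algebraMap ℂ (Polynomial ℂ)) fun i =>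
        Polynomial.C (v i) * (Polynomial.X : Polynomial ℂ)) = eval (0 : Fin (n + 1) → ℂ) := by
      apply MvPolynomial.ringHom_ext
      · intro r; simp
      · intro i; simp
    rw [← e, RingHom.comp_apply]
    simpa [aeval_def] using this
  · intro h
    apply hv
    ext i
    have : (X i : PolyRing n) ∈ pointIdeal v := by
      rw [h, RingHom.mem_ker]; simp
    simpa using (mem_pointIdeal (isHomogeneous_X ℂ i)).mp this

theorem no_chain_of_ringKrullDim {R : Type*} [CommRing R] {I P P' P'' : Ideal R} {d : ℕ}
    [I.IsPrime] [P.IsPrime] [P'.IsPrime] [P''.IsPrime] (hd : ringKrullDim (R ⧸ I) = (d : ℕ))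
    (hd2 : d ≤ 2) (h1 : I < P) (h2 : P < P') (h3 : P' < P'') : False := by
  rw [ringKrullDim_quotient] at hd
  let s : LTSeries (PrimeSpectrum.zeroLocus (R := R) I) :=
    { length := 3
      toFun := ![⟨⟨I, inferInstance⟩, le_refl I⟩, ⟨⟨P, inferInstance⟩, h1.le⟩,
        ⟨⟨P', inferInstance⟩, (h1.trans h2).le⟩, ⟨⟨P'', inferInstance⟩,
            (h1.trans (h2.trans h3)).le⟩]
      step := by
        intro i
        fin_cases i
        · exact h1
        · exact h2
        · exact h3 }
  have := Order.LTSeries.length_le_krullDim s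
  rw [hd] at this
  have h3 : (3 : ℕ) ≤ d := by exact_mod_cast this
  omega

/-- On an integral curve, the points of a proper closed subset are minimal primes. -/
theorem pointIdeal_mem_minimalPrimes {I : Ideal (PolyRing n)} [I.IsPrime]
    (hd : ringKrullDim (PolyRing n ⧸ I) = ((2 : ℕ) : WithBot ℕ∞)) {f : PolyRing n} (hf : f ∉ I)
    {v : Fin (n + 1) → ℂ} (hv : v ≠ 0) (h : I ⊔ Ideal.span {f} ≤ pointIdeal v) :
    pointIdeal v ∈ (I ⊔ Ideal.span {f}).minimalPrimes := by
  obtain ⟨P, hP, hPv⟩ := Ideal.exists_minimalPrimes_le h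
  have hPp : P.IsPrime := hP.1.1
  rcases hPv.eq_or_lt with h1 | h1
  · rwa [← h1]
  -- Otherwise `I`, `P`, the ideal of the point and the irrelevant ideal would form a chain of
  -- length three above `I`.
  · exfalso
    have hIP : I < P := by
      refine lt_of_le_of_ne (le_sup_left.trans hP.1.2) ?_
      rintro rfl
      exact hf (hP.1.2 (Ideal.mem_sup_right (Ideal.mem_span_singleton_self f)))
    have : (RingHom.ker (eval (0 : Fin (n + 1) → ℂ))).IsPrime := RingHom.ker_isPrime _
    exact no_chain_of_ringKrullDim hd le_rfl hIP h1 (pointIdeal_lt hv)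

theorem exists_smul_of_pointIdeal_le {v w : Fin (n + 1) → ℂ} (hv : v ≠ 0)
    (h : pointIdeal v ≤ pointIdeal w) : ∃ c : ℂ, w = c • v := by
  obtain ⟨i, hi⟩ : ∃ i, v i ≠ 0 := by
    by_contra! h0
    exact hv (_root_.funext h0)
  refine ⟨w i / v i, _root_.funext fun j => ?_⟩
  have hom : (C (v i) * X j - C (v j) * X i : PolyRing n).IsHomogeneous 1 :=
    (isHomogeneous_C_mul_X _ _).sub (isHomogeneous_C_mul_X _ _)
  have := h ((mem_pointIdeal hom).mpr (by simp; ring))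
  rw [mem_pointIdeal hom] at this
  simp only [map_sub, map_mul, eval_C, eval_X] at this
  simp only [Pi.smul_apply, smul_eq_mul]
  field_simp
  linear_combination this

/-- The projective Nullstellensatz. -/
theorem exists_X_pow_mem {J : Ideal (PolyRing n)}
    (h : ∀ v : Fin (n + 1) → ℂ, (∀ f ∈ J, eval v f = 0) → v = 0) (i : Fin (n + 1)) :
    ∃ N : ℕ, (X i : PolyRing n) ^ N ∈ J := by
  have : (X i : PolyRing n) ∈ vanishingIdeal ℂ (zeroLocus ℂ J) := by
    rw [mem_vanishingIdeal_iff]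
    intro v hv
    have : v = 0 := h v fun f hf => by
      have := (mem_zeroLocus_iff.mp hv) f hf
      simpa [aeval_eq_eval] using this
    simp [this]
  rw [vanishingIdeal_zeroLocus_eq_radical] at this
  exact this

/-- Existence of a hyperplane that avoids the intersection of a curve with another hyperplane. -/
theorem exists_linear_disjoint {I : Ideal (PolyRing n)} [I.IsPrime] (hI : IsHomogIdeal I)
    (hd : ringKrullDim (PolyRing n ⧸ I) = ((2 : ℕ) : WithBot ℕ∞)) {y : PolyRing n}
    (hy : y.IsHomogeneous 1) (hyI : y ∉ I) :
    ∃ z : PolyRing n, z.IsHomogeneous 1 ∧ ∃ N : ℕ, ∀ i,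
        X i ^ N ∈ I ⊔ Ideal.span {y} ⊔ Ideal.span {z} := by
  have hfin := (I ⊔ Ideal.span {y}).finite_minimalPrimes_of_isNoetherianRing
  -- The condition discards primes that contain every coordinate: they define no projective point,
  -- and no linear form avoids them.
  let T := {P ∈ (I ⊔ Ideal.span {y}).minimalPrimes | ∃ i, X i ∉ P}
  have hT : T.Finite := hfin.subset (Set.sep_subset _ _)
  let p : Ideal (PolyRing n) → Submodule ℂ (Fin (n + 1) → ℂ) := fun P =>
    { carrier := {a | (∑ i, C (a i) * X i : PolyRing n) ∈ P}
      zero_mem' := by simp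
      add_mem' := fun {a b} ha hb => by
        simp only [Set.mem_ofPred_eq, Pi.add_apply, C_add, add_mul, Finset.sum_add_distrib] at *
        exact P.add_mem ha hb
      smul_mem' := fun c a ha => by
        simp only [Set.mem_ofPred_eq, Pi.smul_apply, smul_eq_mul, C_mul, mul_assoc,
          ← Finset.mul_sum] at *
        exact P.mul_mem_left _ ha }
  have hp : ∀ P ∈ hT.toFinset, p P ≠ ⊤ := by
    intro P hP htop
    obtain ⟨-, i, hi⟩ := hT.mem_toFinset.mp hP
    apply hi
    have : Pi.single i 1 ∈ p P := by rw [htop]; trivial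
    change (∑ j, C ((Pi.single i 1 : Fin (n + 1) → ℂ) j) * X j : PolyRing n) ∈ P at this
    rw [Finset.sum_eq_single i] at this
    · simpa using this
    · intro j _ hj; simp [hj]
    · simp
  -- A vector space over an infinite field is not a finite union of proper subspaces.
  have hne := Subspace.biUnion_ne_univ_of_top_notMem (s := hT.toFinset.image p) (by
    intro h
    obtain ⟨P, hP, h⟩ := Finset.mem_image.mp h
    exact hp P hP h)
  obtain ⟨a, ha⟩ := (Set.ne_univ_iff_exists_notMem _).mp hne
  simp only [Finset.mem_image, Set.mem_iUnion, not_exists] at ha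
  have hzP : ∀ P ∈ T, (∑ i, C (a i) * X i : PolyRing n) ∉ P := fun P hP hz =>
    ha (p P) ⟨P, hT.mem_toFinset.mpr hP, rfl⟩ hz
  have hz := isHomogeneous_sum_C_mul_X a
  refine ⟨_, hz, ?_⟩
  set z : PolyRing n := ∑ i, C (a i) * X i
  have hN : ∀ i, ∃ N : ℕ, (X i : PolyRing n) ^ N ∈ I ⊔ Ideal.span {y} ⊔ Ideal.span {z} := by
    apply exists_X_pow_mem
    intro v hv
    by_contra hv0
    have h1 : I ⊔ Ideal.span {y} ≤ pointIdeal v :=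
      (hI.sup (isHomogIdeal_span_singleton hy)).le_pointIdeal fun f hf =>
        hv f (Ideal.mem_sup_left hf)
    refine hzP (pointIdeal v) ⟨pointIdeal_mem_minimalPrimes hd hyI hv0 h1, ?_⟩ ?_
    · by_contra! h
      exact hv0 (_root_.funext fun i => by
        simpa using (mem_pointIdeal (isHomogeneous_X ℂ i)).mp (h i))
    · exact (mem_pointIdeal hz).mpr (hv z (Ideal.mem_sup_right (Ideal.mem_span_singleton_self z)))
  choose N hN using hN
  refine ⟨∑ i, N i, fun i => ?_⟩
  exact Ideal.pow_mem_of_pow_mem _ (hN i) (Finset.single_le_sum (f := N)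
    (fun _ _ => Nat.zero_le _) (Finset.mem_univ i))

end MvPolynomial

/-! ### Sections of twisting sheaves -/

namespace ProjVariety

variable {n : ℕ} (V : ProjVariety n)

/-! Shortcuts for the instance search. -/

noncomputable instance : DistribMulAction V.CoordRing V.CoordRing := inferInstance

noncomputable instance : Field V.K := inferInstance

noncomputable instance : CommRing V.K := inferInstance

noncomputable instance : Add V.K := inferInstance

noncomputable instance : Sub V.K := inferInstance


noncomputable instance : Mul V.K := inferInstance

noncomputable instance : Div V.K := inferInstance

noncomputable instance : AddCommMonoid V.K := inferInstance

noncomputable instance : AddCommGroup V.K := inferInstance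

noncomputable instance : AddGroup V.K := inferInstance

noncomputable instance : Algebra ℂ V.K := inferInstance

noncomputable instance : Module ℂ V.K := inferInstance

noncomputable instance : SMul ℂ V.K := inferInstance

noncomputable instance : DivisionRing V.K := inferInstance

noncomputable instance : CommGroupWithZero V.K := inferInstance

noncomputable instance : GroupWithZero V.K := inferInstance

noncomputable instance : DivInvMonoid V.K := inferInstance

noncomputable instance : Inv V.K := inferInstance

instance : IsLeftCancelMulZero V.K := inferInstance

instance : CharZero V.K := charZero_of_injective_algebraMap (algebraMap ℂ V.K).injective

/-- The class of a polynomial, as a homomorphism of algebras. -/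
noncomputable def formHom : PolyRing n →ₐ[ℂ] V.K :=
  (IsScalarTower.toAlgHom ℂ V.CoordRing V.K).comp (Ideal.Quotient.mkₐ ℂ V.ideal)

theorem formHom_apply (f : PolyRing n) : V.formHom f = V.form f := rfl

theorem form_eq_zero {f : PolyRing n} : V.form f = 0 ↔ f ∈ V.ideal := by
  rw [form, map_eq_zero_iff _ (IsFractionRing.injective V.CoordRing V.K),
    Ideal.Quotient.eq_zero_iff_mem]

theorem form_eq_form {f g : PolyRing n} : V.form f = V.form g ↔ f - g ∈ V.ideal := by
  rw [← sub_eq_zero, ← V.formHom_apply, ← V.formHom_apply, ← map_sub, V.formHom_apply,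
    V.form_eq_zero]

theorem form_sub (f g : PolyRing n) : V.form (f - g) = V.form f - V.form g :=
  map_sub V.formHom f g

theorem form_smul (c : ℂ) (f : PolyRing n) : V.form (c • f) = c • V.form f :=
  map_smul V.formHom c f

theorem form_zero : V.form 0 = 0 := map_zero V.formHom

theorem form_one : V.form 1 = 1 := map_one V.formHom

theorem coord_ne_zero (i : V.Chart) : V.coord i.1 ≠ 0 := fun h => i.2 (V.form_eq_zero.mp h)

theorem mem_sections_one {m : ℤ} {i : V.Chart} {z : V.K} :
    z ∈ V.sections m ![i] ↔ ∃ (k d : ℕ) (a : PolyRing n), a.IsHomogeneous d ∧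
      (d : ℤ) = m + k ∧ z * V.coord i.1 ^ k = V.form a := by
  change (∃ (k d : ℕ) (a : PolyRing n), _) ↔ _
  simp [denom, coord, form_pow]

theorem mem_sections_two {m : ℤ} {i j : V.Chart} {z : V.K} :
    z ∈ V.sections m ![i, j] ↔ ∃ (k d : ℕ) (a : PolyRing n), a.IsHomogeneous d ∧
      (d : ℤ) = m + k * 2 ∧ z * (V.coord i.1 * V.coord j.1) ^ k = V.form a := by
  change (∃ (k d : ℕ) (a : PolyRing n), _) ↔ _
  simp [denom, coord, form_pow, form_mul, one_add_one_eq_two]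

variable {V}

theorem form_mul_mem_sections {m : ℤ} {r : ℕ} {t : Fin (r + 1) → V.Chart} {f : PolyRing n} {e : ℕ}
    (hf : f.IsHomogeneous e) {z : V.K} (hz : z ∈ V.sections m t) :
    V.form f * z ∈ V.sections (m + e) t := by
  obtain ⟨k, d, a, ha, hd, hz⟩ := hz
  refine ⟨k, e + d, f * a, hf.mul ha, by push_cast; rw [hd]; ring, ?_⟩
  rw [form_mul, ← hz, mul_assoc]

theorem mem_sections_two_of_left {m : ℤ} {i : V.Chart} (j : V.Chart) {z : V.K}
    (hz : z ∈ V.sections m ![i]) : z ∈ V.sections m ![i, j] := by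
  rw [mem_sections_one] at hz
  obtain ⟨k, d, a, ha, hd, hz⟩ := hz
  rw [mem_sections_two]
  refine ⟨k, d + k, a * X j.1 ^ k, ha.mul (isHomogeneous_X_pow _ _), by push_cast; rw [hd]; ring,
      ?_⟩
  rw [form_mul, ← hz, form_pow, mul_pow, mul_assoc]
  rfl

theorem mem_sections_two_comm {m : ℤ} {i j : V.Chart} {z : V.K}
    (hz : z ∈ V.sections m ![i, j]) : z ∈ V.sections m ![j, i] := by
  rw [mem_sections_two] at hz ⊢
  simpa only [mul_comm (V.coord j.1)] using hz

theorem mem_sections_two_of_right {m : ℤ} (i : V.Chart) {j : V.Chart} {z : V.K}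
    (hz : z ∈ V.sections m ![j]) : z ∈ V.sections m ![i, j] :=
  mem_sections_two_comm (mem_sections_two_of_left i hz)

theorem mem_sections_of_coord_pow_mul {m : ℤ} {i : V.Chart} {z : V.K} (k : ℕ)
    (hz : V.coord i.1 ^ k * z ∈ V.sections (m + k) ![i]) : z ∈ V.sections m ![i] := by
  rw [mem_sections_one] at hz ⊢
  obtain ⟨l, d, a, ha, hd, hz⟩ := hz
  refine ⟨k + l, d, a, ha, by push_cast; rw [hd]; ring, ?_⟩
  rw [← hz]; ring

theorem mem_sections_two_of_coord_pow_mul {m : ℤ} {i j : V.Chart} {z : V.K} (k : ℕ)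
    (hz : V.coord i.1 ^ k * z ∈ V.sections (m + k) ![i, j]) : z ∈ V.sections m ![i, j] := by
  rw [mem_sections_two] at hz ⊢
  obtain ⟨l, d, a, ha, hd, hz⟩ := hz
  refine ⟨k + l, d + k, a * X j.1 ^ k, ha.mul (isHomogeneous_X_pow _ _),
    by push_cast; rw [hd]; ring, ?_⟩
  rw [form_mul, ← hz, form_pow]
  change _ = _ * V.coord j.1 ^ k
  ring

theorem exists_coord_pow_mul_mem {m : ℤ} {i j : V.Chart} {z : V.K}
    (hz : z ∈ V.sections m ![i, j]) :
    ∃ k : ℕ, ∀ l ≥ k, V.coord i.1 ^ l * z ∈ V.sections (m + l) ![j] := by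
  rw [mem_sections_two] at hz
  obtain ⟨k, d, a, ha, hd, hz⟩ := hz
  refine ⟨k, fun l hl => ?_⟩
  obtain ⟨e, rfl⟩ := Nat.exists_eq_add_of_le hl
  rw [mem_sections_one]
  refine ⟨k, d + e, a * X i.1 ^ e, ha.mul (isHomogeneous_X_pow _ _),
    by push_cast; rw [hd]; ring, ?_⟩
  rw [form_mul, ← hz, form_pow]
  change _ = _ * V.coord i.1 ^ e
  ring

theorem mem_H0 {m : ℤ} {z : V.K} : z ∈ V.H0 m ↔ ∀ i : V.Chart, z ∈ V.sections m ![i] := by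
  simp [H0]

theorem form_mem_sections {m : ℤ} {i : V.Chart} {f : PolyRing n} {d : ℕ}
    (hf : f.IsHomogeneous d) (hd : (d : ℤ) = m) : V.form f ∈ V.sections m ![i] := by
  rw [mem_sections_one]
  exact ⟨0, d, f, hf, by simpa using hd, by simp⟩

theorem form_mem_H0 {m : ℤ} {f : PolyRing n} {d : ℕ} (hf : f.IsHomogeneous d) (hd : (d : ℤ) = m) :
    V.form f ∈ V.H0 m := mem_H0.mpr fun _ => form_mem_sections hf hd

theorem form_mul_mem_H0 {m : ℤ} {f : PolyRing n} {e : ℕ} (hf : f.IsHomogeneous e) {z : V.K}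
    (hz : z ∈ V.H0 m) : V.form f * z ∈ V.H0 (m + e) :=
  mem_H0.mpr fun i => form_mul_mem_sections hf (mem_H0.mp hz i)

theorem coord_mul_mem_H0 {m : ℤ} (i : Fin (n + 1)) {z : V.K} (hz : z ∈ V.H0 m) :
    V.coord i * z ∈ V.H0 (m + 1) := form_mul_mem_H0 (isHomogeneous_X ℂ i) hz

variable (V)

/-- The global sections of `𝒪_V(m)` that are given by forms of degree `m`. -/
noncomputable def forms (m : ℕ) : Submodule ℂ V.K :=
  (homogeneousSubmodule (Fin (n + 1)) ℂ m).map V.formHom.toLinearMap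

variable {V}

theorem mem_forms {m : ℕ} {z : V.K} :
    z ∈ V.forms m ↔ ∃ f : PolyRing n, f.IsHomogeneous m ∧ V.form f = z := Iff.rfl

theorem forms_le_H0 (m : ℕ) : V.forms m ≤ V.H0 m := by
  rintro _ ⟨f, hf, rfl⟩
  exact form_mem_H0 hf rfl

instance finiteDimensional_forms (m : ℕ) : FiniteDimensional ℂ (V.forms m) :=
  have := finiteDimensional_homogeneousSubmodule (σ := Fin (n + 1)) (k := ℂ) m
  Module.Finite.map (homogeneousSubmodule (Fin (n + 1)) ℂ m) V.formHom.toLinearMap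

theorem finrank_forms_add (m : ℕ) :
    Module.finrank ℂ (V.forms m) + Module.finrank ℂ (degreePart V.ideal m) =
      Module.finrank ℂ (homogeneousSubmodule (Fin (n + 1)) ℂ m) := by
  have := finiteDimensional_homogeneousSubmodule (σ := Fin (n + 1)) (k := ℂ) m
  have h := LinearMap.finrank_range_add_finrank_ker
    (V.formHom.toLinearMap.domRestrict (homogeneousSubmodule (Fin (n + 1)) ℂ m))
  rw [← h, LinearMap.range_domRestrict]
  congr 1
  have e : degreePart V.ideal m = (LinearMap.ker (V.formHom.toLinearMap.domRestrict
      (homogeneousSubmodule (Fin (n + 1)) ℂ m))).map (Submodule.subtype _) := by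
    ext f
    simp only [Submodule.mem_map, LinearMap.mem_ker, Submodule.subtype_apply, Subtype.exists,
      LinearMap.domRestrict_apply, mem_degreePart]
    constructor
    · rintro ⟨h1, h2⟩
      exact ⟨f, h1, V.form_eq_zero.mpr h2, rfl⟩
    · rintro ⟨g, h1, h2, rfl⟩
      exact ⟨h1, V.form_eq_zero.mp h2⟩
  rw [e]
  exact (Submodule.equivMapOfInjective _ (Submodule.subtype_injective _) _).symm.finrank_eq

theorem exists_coord_pow_mul_mem_forms {m : ℕ} {z : V.K} {i : V.Chart}
    (hz : z ∈ V.sections m ![i]) : ∃ k : ℕ, V.coord i.1 ^ k * z ∈ V.forms (m + k) := by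
  rw [mem_sections_one] at hz
  obtain ⟨k, d, a, ha, hd, hz⟩ := hz
  obtain rfl : d = m + k := by exact_mod_cast hd
  exact ⟨k, a, ha, by rw [mul_comm]; exact hz.symm⟩

theorem form_mul_mem_forms {m e : ℕ} {f : PolyRing n} (hf : f.IsHomogeneous e) {z : V.K}
    (hz : z ∈ V.forms m) : V.form f * z ∈ V.forms (m + e) := by
  obtain ⟨g, hg, rfl⟩ := hz
  exact mem_forms.mpr ⟨f * g, by simpa only [add_comm m e] using hf.mul hg, V.form_mul f g⟩

/-- A linear form acts nilpotently modulo a graded family of subspaces if all coordinates do. -/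
theorem exists_form_pow_smul_mem {E : Type*} [AddCommGroup E] [Module ℂ E] [Module V.K E]
    [IsScalarTower ℂ V.K E] (N : ℕ → Submodule ℂ E)
    (hN : ∀ d i, ∀ e ∈ N d, V.coord i • e ∈ N (d + 1)) (e : E)
    (h : ∀ i, ∃ k : ℕ, V.coord i ^ k • e ∈ N k) {w : PolyRing n} (hw : w.IsHomogeneous 1) :
    ∃ k : ℕ, V.form w ^ k • e ∈ N k := by
  obtain ⟨a, rfl⟩ := hw.eq_sum_coeff
  have hform : V.form (∑ i, C (a i) * X i) = ∑ i, a i • V.coord i := by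
    rw [← formHom_apply, map_sum]
    refine Finset.sum_congr rfl fun i _ => ?_
    rw [formHom_apply, ← smul_eq_C_mul, form_smul]; rfl
  rw [hform]
  let w (s : Finset (Fin (n + 1))) : V.K := ∑ i ∈ s, a i • V.coord i
  have hlin : ∀ s d j, ∀ e ∈ N d, w s ^ j • e ∈ N (d + j) := by
    intro s d j e he
    induction j with
    | zero => simpa using he
    | succ j ih =>
      rw [pow_succ', mul_smul, Finset.sum_smul, ← add_assoc]
      refine Submodule.sum_mem _ fun i _ => ?_
      rw [smul_assoc]
      exact Submodule.smul_mem _ _ (hN _ _ _ ih)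
  suffices H : ∀ s, ∃ k : ℕ, w s ^ k • e ∈ N k from H Finset.univ
  intro s
  induction s using Finset.induction_on with
  | empty => exact ⟨1, by simp [w]⟩
  | insert i s hi ih =>
    obtain ⟨k, hk⟩ := ih
    obtain ⟨l, hl⟩ := h i
    have hl' : w {i} ^ l • e ∈ N l := by
      simp only [w, Finset.sum_singleton, smul_pow, smul_assoc]
      exact Submodule.smul_mem _ _ hl
    have hw : w (insert i s) = w {i} + w s := by
      simp [w, Finset.sum_insert hi]
    refine ⟨l + k, ?_⟩
    rw [hw, add_pow, Finset.sum_smul]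
    refine Submodule.sum_mem _ fun m hm => ?_
    have hm' : m ≤ l + k := by simpa [Nat.lt_succ_iff] using hm
    rw [mul_comm, mul_smul, Nat.cast_smul_eq_nsmul]
    refine nsmul_mem ?_ _
    -- In each binomial term either the new summand occurs at least `l` times or the old sum more
    -- than `k` times.
    rcases le_or_gt l m with h1 | h1
    · obtain ⟨j, rfl⟩ := Nat.exists_eq_add_of_le h1
      have := hlin s _ (l + k - (l + j)) _ (hlin {i} _ j _ hl')
      rw [← mul_smul, ← mul_smul, show l + j + (l + k - (l + j)) = l + k by omega] at this
      convert! this using 2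
      ring
    · have := hlin {i} _ m _ (hlin s _ (l - m) _ hk)
      rw [← mul_smul, ← mul_smul, show k + (l - m) + m = l + k by omega] at this
      convert! this using 2
      rw [mul_assoc, ← pow_add, show l - m + k = l + k - m by omega]

end ProjVariety

/-! ### Sections over a hyperplane section of a projective variety -/

theorem mem_submoduleOf_iff {R M : Type*} [Semiring R] [AddCommMonoid M] [Module R M]
    {N P : Submodule R M} {x : P} : x ∈ N.submoduleOf P ↔ (x : M) ∈ N := Iff.rfl

namespace ProjVariety

variable {n : ℕ} (V : ProjVariety n) (i₀ : V.Chart)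

/-- Families of sections of `𝒪_V(m + 1)` on the charts that agree on the hyperplane section
`x_{i₀} = 0`. -/
def hyperplaneCochains (m : ℤ) : Submodule ℂ (V.Chart → V.K) where
  carrier := {s | (∀ i, s i ∈ V.sections (m + 1) ![i]) ∧
    ∀ i j, ∃ c ∈ V.sections m ![i, j], s j - s i = V.coord i₀.1 * c}
  zero_mem' := ⟨fun _ => zero_mem _, fun _ _ => ⟨0, zero_mem _, by simp⟩⟩
  add_mem' := by
    rintro s t ⟨hs, hs'⟩ ⟨ht, ht'⟩
    refine ⟨fun i => add_mem (hs i) (ht i), fun i j => ?_⟩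
    obtain ⟨c, hc, h⟩ := hs' i j
    obtain ⟨d, hd, h'⟩ := ht' i j
    exact ⟨c + d, add_mem hc hd, by rw [mul_add, ← h, ← h', Pi.add_apply, Pi.add_apply]; ring⟩
  smul_mem' := by
    rintro a s ⟨hs, hs'⟩
    refine ⟨fun i => Submodule.smul_mem _ a (hs i), fun i j => ?_⟩
    obtain ⟨c, hc, h⟩ := hs' i j
    exact ⟨a • c, Submodule.smul_mem _ a hc, by
      rw [mul_smul_comm, ← h, Pi.smul_apply, Pi.smul_apply, smul_sub]⟩

/-- Families of sections of `𝒪_V(m + 1)` on the charts that vanish on the hyperplane section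
`x_{i₀} = 0`. -/
def vanishingCochains (m : ℤ) : Submodule ℂ (V.Chart → V.K) where
  carrier := {s | ∀ i, ∃ u ∈ V.sections m ![i], s i = V.coord i₀.1 * u}
  zero_mem' := fun _ => ⟨0, zero_mem _, by simp⟩
  add_mem' := by
    intro s t hs ht i
    obtain ⟨u, hu, h⟩ := hs i
    obtain ⟨v, hv, h'⟩ := ht i
    exact ⟨u + v, add_mem hu hv, by rw [Pi.add_apply, h, h', mul_add]⟩
  smul_mem' := by
    intro a s hs i
    obtain ⟨u, hu, h⟩ := hs i
    exact ⟨a • u, Submodule.smul_mem _ a hu, by rw [Pi.smul_apply, h, mul_smul_comm]⟩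

/-- Sections of `𝒪(m + 1)` on the hyperplane section `x_{i₀} = 0` of `V`. -/
abbrev HyperplaneSections (m : ℤ) : Type :=
  V.hyperplaneCochains i₀ m ⧸ (V.vanishingCochains i₀ m).submoduleOf (V.hyperplaneCochains i₀ m)

variable {V} in
theorem coord_mul_mem_sections_succ {m : ℤ} {r : ℕ} {t : Fin (r + 1) → V.Chart} {z : V.K}
    (hz : z ∈ V.sections m t) : V.coord i₀.1 * z ∈ V.sections (m + 1) t :=
  V.coord_mul_mem_sections i₀.1 hz

/-- The connecting homomorphism on cochains. -/
noncomputable def connectingCochain (m : ℤ) : V.hyperplaneCochains i₀ m →ₗ[ℂ] V.Z1 m where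
  toFun s := ⟨fun i j => (V.coord i₀.1)⁻¹ * (s.1 j - s.1 i), fun i j => by
      obtain ⟨c, hc, h⟩ := s.2.2 i j
      change (V.coord i₀.1)⁻¹ * (s.1 j - s.1 i) ∈ _
      rwa [h, inv_mul_cancel_left₀ (V.coord_ne_zero i₀)], fun i j k => by ring⟩
  map_add' s t := by
    ext i j
    simp only [Submodule.coe_add, Pi.add_apply]
    ring
  map_smul' a s := by
    ext i j
    simp only [Submodule.coe_smul, Pi.smul_apply, RingHom.id_apply, ← smul_sub, mul_smul_comm]

theorem coord_mul_connectingCochain {m : ℤ} (s : V.hyperplaneCochains i₀ m) (i j : V.Chart) :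
    V.coord i₀.1 * (V.connectingCochain i₀ m s).1 i j = s.1 j - s.1 i :=
  mul_inv_cancel_left₀ (V.coord_ne_zero i₀) _

/-- The connecting homomorphism. -/
noncomputable def connecting (m : ℤ) : V.HyperplaneSections i₀ m →ₗ[ℂ] V.H1 m :=
  Submodule.mapQ _ _ (V.connectingCochain i₀ m) (by
    intro s hs
    rw [Submodule.mem_comap, mem_submoduleOf_iff]
    rw [mem_submoduleOf_iff] at hs
    choose u hu h using hs
    refine ⟨u, hu, fun i j => mul_left_cancel₀ (V.coord_ne_zero i₀) ?_⟩
    rw [coord_mul_connectingCochain, mul_sub, ← h, ← h])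

/-- Restriction of global sections to a hyperplane section. -/
noncomputable def restrictHyperplane (m : ℤ) : V.H0 (m + 1) →ₗ[ℂ] V.HyperplaneSections i₀ m :=
  (Submodule.mkQ _).comp
    (LinearMap.codRestrict (V.hyperplaneCochains i₀ m)
      ((LinearMap.pi fun _ : V.Chart => LinearMap.id).comp (V.H0 (m + 1)).subtype) fun s =>
        ⟨fun i => mem_H0.mp s.2 i, fun i j => ⟨0, zero_mem _, by simp⟩⟩)

theorem restrictHyperplane_eq_zero {m : ℤ} {s : V.H0 (m + 1)} :
    V.restrictHyperplane i₀ m s = 0 ↔ ∃ u ∈ V.H0 m, s.1 = V.coord i₀.1 * u := by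
  rw [restrictHyperplane, LinearMap.comp_apply, Submodule.mkQ_apply, Submodule.Quotient.mk_eq_zero,
    mem_submoduleOf_iff]
  constructor
  · intro h
    choose u hu h using h
    refine ⟨(V.coord i₀.1)⁻¹ * s.1, mem_H0.mpr fun i => ?_, ?_⟩
    · have := h i
      change s.1 = _ at this
      rw [this, inv_mul_cancel_left₀ (V.coord_ne_zero i₀)]
      exact hu i
    · rw [mul_inv_cancel_left₀ (V.coord_ne_zero i₀)]
  · rintro ⟨u, hu, h⟩ i
    exact ⟨u, mem_H0.mp hu i, h⟩

/-- If the cocycle `(s_j - s_i) / x_{i₀}` is the coboundary of `u`, then the sections `s_i - x_{i₀}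
u_i` glue to a global section with the same restriction. -/
theorem ker_connecting (m : ℤ) :
    LinearMap.ker (V.connecting i₀ m) = LinearMap.range (V.restrictHyperplane i₀ m) := by
  ext s
  obtain ⟨s, rfl⟩ := Submodule.mkQ_surjective _ s
  rw [LinearMap.mem_ker, connecting, Submodule.mkQ_apply, Submodule.mapQ_apply,
    Submodule.Quotient.mk_eq_zero, mem_submoduleOf_iff, LinearMap.mem_range]
  constructor
  · rintro ⟨u, hu, h⟩
    have h1 : ∀ i j, s.1 i - V.coord i₀.1 * u i = s.1 j - V.coord i₀.1 * u j := by
      intro i j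
      have := V.coord_mul_connectingCochain i₀ s i j
      rw [h, mul_sub] at this
      linear_combination this
    refine ⟨⟨s.1 i₀ - V.coord i₀.1 * u i₀, mem_H0.mpr fun i => ?_⟩, ?_⟩
    · rw [h1 i₀ i]
      exact sub_mem (s.2.1 i) (coord_mul_mem_sections_succ i₀ (hu i))
    · rw [restrictHyperplane, LinearMap.comp_apply, Submodule.mkQ_apply, eq_comm,
        Submodule.Quotient.eq, mem_submoduleOf_iff]
      refine fun i => ⟨u i, hu i, ?_⟩
      change s.1 i - (s.1 i₀ - V.coord i₀.1 * u i₀) = _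
      rw [h1 i₀ i]; ring
  · rintro ⟨t, ht⟩
    rw [restrictHyperplane, LinearMap.comp_apply, Submodule.mkQ_apply, eq_comm,
      Submodule.Quotient.eq, mem_submoduleOf_iff] at ht
    choose u hu h using ht
    have h' : ∀ i, s.1 i - t.1 = V.coord i₀.1 * u i := h
    refine ⟨u, hu, fun i j => mul_left_cancel₀ (V.coord_ne_zero i₀) ?_⟩
    rw [coord_mul_connectingCochain, mul_sub, ← h', ← h']
    ring

theorem mulH1_mk_eq_zero {i : Fin (n + 1)} {m : ℤ} {c : V.Z1 m} :
    V.mulH1 i m (Submodule.Quotient.mk c) = 0 ↔ V.mulCochain i c.1 ∈ V.B1 (m + 1) :=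
  (Submodule.Quotient.mk_eq_zero _).trans mem_submoduleOf_iff

/-- If `x_{i₀} c` is the coboundary of `s`, then `s` agrees modulo `x_{i₀}` on overlaps, and `c` is
its image. -/
theorem range_connecting (m : ℤ) :
    LinearMap.range (V.connecting i₀ m) = LinearMap.ker (V.mulH1 i₀.1 m) := by
  ext c
  obtain ⟨c, rfl⟩ := Submodule.mkQ_surjective _ c
  rw [LinearMap.mem_ker, Submodule.mkQ_apply, mulH1_mk_eq_zero, LinearMap.mem_range]
  constructor
  · rintro ⟨s, hs⟩
    obtain ⟨s, rfl⟩ := Submodule.mkQ_surjective _ s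
    rw [connecting, Submodule.mkQ_apply, Submodule.mapQ_apply, eq_comm,
      Submodule.Quotient.eq, mem_submoduleOf_iff] at hs
    obtain ⟨t, ht, h⟩ := hs
    refine ⟨s.1 + fun i => V.coord i₀.1 * t i,
      fun i => add_mem (s.2.1 i) (coord_mul_mem_sections_succ i₀ (ht i)), fun i j => ?_⟩
    have h1 := V.coord_mul_connectingCochain i₀ s i j
    have h2 : c.1 i j - (V.connectingCochain i₀ m s).1 i j = t j - t i := h i j
    change V.coord i₀.1 * c.1 i j = (s.1 j + V.coord i₀.1 * t j) - (s.1 i + V.coord i₀.1 * t i)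
    linear_combination V.coord i₀.1 * h2 + h1
  · rintro ⟨s, hs, h⟩
    refine ⟨Submodule.mkQ _ ⟨s, hs, fun i j => ⟨c.1 i j, c.2.1 i j, (h i j).symm⟩⟩, ?_⟩
    rw [connecting, Submodule.mkQ_apply, Submodule.mapQ_apply]
    congr 1
    ext i j
    refine mul_left_cancel₀ (V.coord_ne_zero i₀) ?_
    rw [coord_mul_connectingCochain]
    exact (h i j).symm

variable {V} {i₀}

theorem cast_mem_sections {a b : ℤ} {r : ℕ} {t : Fin (r + 1) → V.Chart} {z : V.K}
    (hz : z ∈ V.sections a t) (h : a = b) : z ∈ V.sections b t := h ▸ hz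

/-- By `h`, the form `z` is invertible modulo `x_{i₀}` where `x_i ≠ 0`, so it can be cancelled in a
congruence modulo `x_{i₀}`. The hypothesis `hdiv` covers single charts and overlaps at once. -/
theorem exists_eq_coord_mul {z : PolyRing n} {N : ℕ} {m : ℤ} {r : ℕ}
    {t : Fin (r + 1) → V.Chart} {i : V.Chart}
    (hdiv : ∀ (k : ℕ) w, V.coord i.1 ^ k * w ∈ V.sections (m + k) t → w ∈ V.sections m t)
    {a b : PolyRing n} (ha : a.IsHomogeneous N) (hb : b.IsHomogeneous N)
    (h : V.coord i.1 ^ (N + 1) = V.coord i₀.1 * V.form a + V.form z * V.form b)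
    {s u : V.K} (hs : s ∈ V.sections (m + 1) t) (hu : u ∈ V.sections (m + 1) t)
    (hsu : V.form z * s = V.coord i₀.1 * u) : ∃ u' ∈ V.sections m t, s = V.coord i₀.1 * u' := by
  have hx := pow_ne_zero (N + 1) (V.coord_ne_zero i)
  refine ⟨(V.form a * s + V.form b * u) / V.coord i.1 ^ (N + 1), hdiv (N + 1) _ ?_, ?_⟩
  · rw [mul_div_cancel₀ _ hx]
    exact cast_mem_sections (add_mem (form_mul_mem_sections ha hs) (form_mul_mem_sections hb hu))
      (by push_cast; ring)
  · rw [mul_div_assoc', eq_div_iff hx, h]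
    linear_combination V.form b * hsu

variable (V) in
/-- Multiplication by a linear form, on families of sections. -/
noncomputable def mulForm (z : PolyRing n) : (V.Chart → V.K) →ₗ[ℂ] (V.Chart → V.K) :=
  LinearMap.mulLeft ℂ (fun _ : V.Chart => V.form z)

theorem mulForm_mem {z : PolyRing n} (hz : z.IsHomogeneous 1) {m : ℤ} {s : V.Chart → V.K}
    (hs : s ∈ V.hyperplaneCochains i₀ m) : V.mulForm z s ∈ V.hyperplaneCochains i₀ (m + 1) :=
  ⟨fun i => form_mul_mem_sections hz (hs.1 i), fun i j => by
      obtain ⟨c, hc, h⟩ := hs.2 i j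
      refine ⟨V.form z * c, form_mul_mem_sections hz hc, ?_⟩
      change V.form z * s j - V.form z * s i = _
      rw [← mul_sub, h, mul_left_comm]⟩

/-- Multiplication by a linear form, on sections over a hyperplane section. -/
noncomputable def mulHyperplane {z : PolyRing n} (hz : z.IsHomogeneous 1) (m : ℤ) :
    V.HyperplaneSections i₀ m →ₗ[ℂ] V.HyperplaneSections i₀ (m + 1) :=
  Submodule.mapQ _ _ ((V.mulForm z).restrict fun _ => mulForm_mem hz) (by
    intro s hs i
    obtain ⟨u, hu, h⟩ := hs i
    refine ⟨V.form z * u, form_mul_mem_sections hz hu, ?_⟩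
    change V.form z * s.1 i = _
    have h' : s.1 i = V.coord i₀.1 * u := h
    rw [h', mul_left_comm])

theorem mulHyperplane_mk_eq_zero {z : PolyRing n} (hz : z.IsHomogeneous 1) {m : ℤ}
    {s : V.hyperplaneCochains i₀ m} : mulHyperplane hz m (Submodule.Quotient.mk s) = 0 ↔
      V.mulForm z s.1 ∈ V.vanishingCochains i₀ (m + 1) :=
  (Submodule.Quotient.mk_eq_zero _).trans mem_submoduleOf_iff

/-- Where `x_i ≠ 0`, the section `b / x_i ^ (N + 1)` of degree `-1` is inverse to `z` modulo
`x_{i₀}`, and these local inverses agree on overlaps modulo `x_{i₀}`. -/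
theorem mulHyperplane_bijective {z : PolyRing n} (hz : z.IsHomogeneous 1) {N : ℕ}
    (hx : ∀ i : V.Chart, ∃ a b : PolyRing n, a.IsHomogeneous N ∧ b.IsHomogeneous N ∧
      V.coord i.1 ^ (N + 1) = V.coord i₀.1 * V.form a + V.form z * V.form b) (m : ℤ) :
    Function.Bijective (mulHyperplane (i₀ := i₀) hz m) := by
  choose a b ha hb h using hx
  constructor
  · rw [← LinearMap.ker_eq_bot, LinearMap.ker_eq_bot']
    intro s hs
    obtain ⟨s, rfl⟩ := Submodule.mkQ_surjective _ s
    rw [Submodule.mkQ_apply, mulHyperplane_mk_eq_zero] at hs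
    rw [Submodule.mkQ_apply, Submodule.Quotient.mk_eq_zero, mem_submoduleOf_iff]
    intro i
    obtain ⟨u, hu, hsu⟩ := hs i
    exact exists_eq_coord_mul (fun k _ => mem_sections_of_coord_pow_mul k) (ha i) (hb i) (h i)
      (s.2.1 i) hu hsu
  · intro s
    obtain ⟨s, rfl⟩ := Submodule.mkQ_surjective _ s
    have hne : ∀ i : V.Chart, V.coord i.1 ^ (N + 1) ≠ 0 :=
      fun i => pow_ne_zero (N + 1) (V.coord_ne_zero i)
    let s' : V.Chart → V.K := fun i => V.form (b i) * s.1 i / V.coord i.1 ^ (N + 1)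
    let r : V.Chart → V.K := fun i => V.form (a i) * s.1 i / V.coord i.1 ^ (N + 1)
    have hdiv : ∀ (c : PolyRing n) (_ : c.IsHomogeneous N) (i : V.Chart),
        V.form c * s.1 i / V.coord i.1 ^ (N + 1) ∈ V.sections (m + 1) ![i] := by
      intro c hc i
      refine mem_sections_of_coord_pow_mul (N + 1) ?_
      rw [mul_div_cancel₀ _ (hne i)]
      exact cast_mem_sections (form_mul_mem_sections hc (s.2.1 i)) (by push_cast; ring)
    have hs' : ∀ i, V.form z * s' i = s.1 i - V.coord i₀.1 * r i := by
      intro i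
      simp only [s', r]
      rw [mul_div_assoc', mul_div_assoc', eq_sub_iff_add_eq, ← add_div, div_eq_iff (hne i), h i]
      ring
    have hsW : s' ∈ V.hyperplaneCochains i₀ m := by
      refine ⟨fun i => hdiv _ (hb i) i, fun i j => ?_⟩
      obtain ⟨c, hc, hcs⟩ := s.2.2 i j
      have h1 : ∀ w : V.Chart → V.K, (∀ i, w i ∈ V.sections (m + 1) ![i]) →
          w j - w i ∈ V.sections (m + 1) ![i, j] := fun w hw =>
        sub_mem (mem_sections_two_of_right i (hw j)) (mem_sections_two_of_left j (hw i))
      refine exists_eq_coord_mul (fun k _ => mem_sections_two_of_coord_pow_mul k) (ha i) (hb i)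
        (h i) (h1 s' fun i => hdiv _ (hb i) i)
        (sub_mem hc (h1 r fun i => hdiv _ (ha i) i)) ?_
      rw [mul_sub, hs', hs', mul_sub]
      linear_combination hcs
    refine ⟨Submodule.mkQ _ ⟨s', hsW⟩, ?_⟩
    refine Eq.symm ((Submodule.Quotient.eq _).mpr ?_)
    intro i
    refine ⟨r i, hdiv _ (ha i) i, ?_⟩
    change s.1 i - V.form z * s' i = _
    rw [hs' i]; ring

end ProjVariety

/-! ### Cohomology of canonically embedded curves of genus four -/

namespace ProjVariety

variable {n : ℕ} {V : ProjVariety n}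

theorem nonempty_chart (hg : V.arithmeticGenus ≠ 0) : Nonempty V.Chart := by
  by_contra h
  rw [not_nonempty_iff] at h
  apply hg
  have : Subsingleton (V.Z1 0) := ⟨fun a b => Subtype.ext (_root_.funext fun i => h.elim i)⟩
  have : Subsingleton (V.H1 0) := (Submodule.mkQ_surjective _).subsingleton
  exact Module.finrank_zero_of_subsingleton

theorem finrank_H1_eq (hK : V.CanonicalSheafIsTwist 1) {a m : ℤ} (h : a + m = 1) :
    Module.finrank ℂ (V.H1 m) = Module.finrank ℂ (V.H0 a) := by
  obtain rfl : a = 1 - m := by omega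
  obtain ⟨φ, -⟩ := hK
  rw [(φ m).finrank_eq, Subspace.dual_finrank_eq]

theorem finite_H1 (hK : V.CanonicalSheafIsTwist 1) {a m : ℤ} (h : a + m = 1)
    [Module.Finite ℂ (V.H0 a)] : Module.Finite ℂ (V.H1 m) := by
  obtain rfl : a = 1 - m := by omega
  obtain ⟨φ, -⟩ := hK
  have hd : Module.Finite ℂ (Module.Dual ℂ (V.H1 m)) := Module.Finite.equiv (φ m)
  have : Module.Free ℂ (V.H1 m) := Module.Free.of_divisionRing ℂ _
  exact (Module.finite_dual_iff ℂ).mp hd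

/-- Under duality the transpose is multiplication by a nonzero coordinate on global sections, which
is injective. -/
theorem mulH1_surjective (hK : V.CanonicalSheafIsTwist 1) (i₀ : V.Chart) (m : ℤ) :
    Function.Surjective (V.mulH1 i₀.1 m) := by
  obtain ⟨φ, hφ⟩ := hK
  rw [← LinearMap.dualMap_injective_iff, ← LinearMap.ker_eq_bot, LinearMap.ker_eq_bot']
  intro ψ hψ
  obtain ⟨s, rfl⟩ := (φ (m + 1)).surjective ψ
  have hs : V.coord i₀.1 * s.1 ∈ V.H0 (1 - m) := by
    have := coord_mul_mem_H0 i₀.1 s.2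
    rwa [show (1 - (m + 1) + 1 : ℤ) = 1 - m by ring] at this
  have h : φ m ⟨_, hs⟩ = 0 := by
    refine LinearMap.ext fun c => ?_
    rw [hφ m i₀.1 s ⟨_, hs⟩ rfl c]
    exact LinearMap.congr_fun hψ c
  rw [LinearEquiv.map_eq_zero_iff] at h
  have h' : V.coord i₀.1 * s.1 = 0 := congrArg Subtype.val h
  have : s = 0 := Subtype.ext ((mul_eq_zero.mp h').resolve_left (V.coord_ne_zero i₀))
  rw [this, map_zero]

/-- Multiplication by a coordinate, on global sections. -/
noncomputable def mulH0 (i : Fin (n + 1)) (m : ℤ) : V.H0 m →ₗ[ℂ] V.H0 (m + 1) :=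
  (LinearMap.mulLeft ℂ (V.coord i)).restrict fun _ => coord_mul_mem_H0 i

theorem mulH0_injective (i₀ : V.Chart) (m : ℤ) : Function.Injective (V.mulH0 i₀.1 m) :=
  fun _ _ h => Subtype.ext (mul_left_cancel₀ (V.coord_ne_zero i₀) (congrArg Subtype.val h))

theorem ker_restrictHyperplane (i₀ : V.Chart) (m : ℤ) :
    LinearMap.ker (V.restrictHyperplane i₀ m) = LinearMap.range (V.mulH0 i₀.1 m) := by
  ext s
  rw [LinearMap.mem_ker, restrictHyperplane_eq_zero, LinearMap.mem_range]
  constructor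
  · rintro ⟨u, hu, h⟩
    exact ⟨⟨u, hu⟩, Subtype.ext h.symm⟩
  · rintro ⟨u, rfl⟩
    exact ⟨u.1, u.2, rfl⟩

theorem finite_of_exact {k A B D : Type*} [Field k] [AddCommGroup A] [AddCommGroup B]
    [AddCommGroup D]
    [Module k A] [Module k B] [Module k D] {f : A →ₗ[k] B} {g : B →ₗ[k] D}
    (h : LinearMap.ker g = LinearMap.range f) [Module.Finite k A] [Module.Finite k D] :
    Module.Finite k B := by
  have h1 : Module.Finite k (LinearMap.ker g) := h ▸ inferInstance
  have h2 : Module.Finite k (B ⧸ LinearMap.ker g) :=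
    Module.Finite.equiv g.quotKerEquivRange.symm
  exact Module.Finite.of_submodule_quotient (LinearMap.ker g)

theorem finite_H0_succ (i₀ : V.Chart) (m : ℤ) [Module.Finite ℂ (V.H0 m)]
    [Module.Finite ℂ (V.HyperplaneSections i₀ m)] : Module.Finite ℂ (V.H0 (m + 1)) :=
  finite_of_exact (ker_restrictHyperplane i₀ m)

theorem finite_hyperplaneSections (i₀ : V.Chart) (m : ℤ) [Module.Finite ℂ (V.H0 (m + 1))]
    [Module.Finite ℂ (V.H1 m)] : Module.Finite ℂ (V.HyperplaneSections i₀ m) :=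
  finite_of_exact (V.ker_connecting i₀ m)

theorem finrank_range_restrictHyperplane (i₀ : V.Chart) (m : ℤ) [Module.Finite ℂ (V.H0 (m + 1))] :
    Module.finrank ℂ (LinearMap.range (V.restrictHyperplane i₀ m)) + Module.finrank ℂ (V.H0 m) =
      Module.finrank ℂ (V.H0 (m + 1)) := by
  rw [← LinearMap.finrank_range_add_finrank_ker (V.restrictHyperplane i₀ m),
    ker_restrictHyperplane, LinearMap.finrank_range_of_inj (mulH0_injective i₀ m)]

/-- Alternating sum of dimensions in `0 → H⁰(m) → H⁰(m + 1) → H⁰(Γ) → H¹(m) → H¹(m + 1)`, where `Γ`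
is the hyperplane section. -/
theorem finrank_hyperplaneSections (i₀ : V.Chart) (m : ℤ) [Module.Finite ℂ (V.H0 (m + 1))]
    [Module.Finite ℂ (V.HyperplaneSections i₀ m)] :
    Module.finrank ℂ (V.HyperplaneSections i₀ m) + Module.finrank ℂ (V.H0 m) =
      Module.finrank ℂ (V.H0 (m + 1)) + Module.finrank ℂ (LinearMap.ker (V.mulH1 i₀.1 m)) := by
  rw [← finrank_range_restrictHyperplane i₀ m,
    ← LinearMap.finrank_range_add_finrank_ker (V.connecting i₀ m), ker_connecting, range_connecting]
  omega

section Canonical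

variable (hK : V.CanonicalSheafIsTwist 1) (h1 : V.H0 1 ≤ V.forms 1) (hg : V.arithmeticGenus = 4)
include hK h1 hg

omit hK hg in
theorem finite_H0_one : Module.Finite ℂ (V.H0 1) :=
  Module.Finite.of_injective (Submodule.inclusion h1) (Submodule.inclusion_injective h1)

omit h1 in
theorem finrank_H0_one : Module.finrank ℂ (V.H0 1) = 4 := by
  rw [← finrank_H1_eq hK (show (1 : ℤ) + 0 = 1 by norm_num)]; exact hg

omit hK in
theorem finite_H0_zero : Module.Finite ℂ (V.H0 0) := by
  have := finite_H0_one h1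
  obtain ⟨i₀⟩ := nonempty_chart (V := V) (by omega)
  have : Module.Finite ℂ (V.H0 (0 + 1)) := finite_H0_one h1
  exact Module.Finite.of_injective (V.mulH0 i₀.1 0) (mulH0_injective i₀ 0)

omit hK in
-- The global functions form a finite-dimensional algebra inside a field, so they are integral over
-- the algebraically closed field `ℂ`. Finiteness holds because a coordinate embeds them in `H⁰(1)`.
theorem H0_zero_eq : V.H0 0 = Submodule.span ℂ {1} := by
  have hfin := finite_H0_zero h1 hg
  let A : Subalgebra ℂ V.K := ⨅ i : V.Chart, V.chartRing i
  have hA : Subalgebra.toSubmodule A = V.H0 0 := by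
    ext z
    rw [Subalgebra.mem_toSubmodule, Algebra.mem_iInf, mem_H0]
    rfl
  apply le_antisymm
  · intro z hz
    have hint : IsIntegral ℂ z := by
      refine IsIntegral.of_mem_of_fg A ?_ z ?_
      · rw [hA]; exact Module.Finite.iff_fg.mp hfin
      · rw [← Subalgebra.mem_toSubmodule, hA]; exact hz
    obtain ⟨c, hc⟩ := minpoly.mem_range_of_degree_eq_one ℂ z
      (IsAlgClosed.degree_eq_one_of_irreducible ℂ (minpoly.irreducible hint))
    rw [Submodule.mem_span_singleton]
    exact ⟨c, by rw [← hc, Algebra.algebraMap_eq_smul_one]⟩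
  · rw [Submodule.span_singleton_le_iff_mem, ← form_one]
    exact form_mem_H0 (isHomogeneous_one _ _) rfl

omit hK in
theorem finrank_H0_zero : Module.finrank ℂ (V.H0 0) = 1 := by
  rw [H0_zero_eq h1 hg]; exact finrank_span_singleton one_ne_zero

/-- A nonzero section of degree `-1` would embed the linear forms, of dimension at least four, into
`H⁰(0) = ℂ`. Powers of a coordinate carry lower degrees injectively into degree `-1`. -/
theorem H0_neg {m : ℤ} (hm : m < 0) : V.H0 m = ⊥ := by
  have hfin := finite_H0_one h1
  have hfin0 := finite_H0_zero h1 hg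
  obtain ⟨i₀⟩ := nonempty_chart (V := V) (by omega)
  have hm1 : V.H0 (-1) = ⊥ := by
    rw [Submodule.eq_bot_iff]
    intro s hs
    by_contra hs0
    have hmul : ∀ a ∈ V.forms 1, s * a ∈ V.H0 0 := by
      rintro _ ⟨f, hf, rfl⟩
      have := form_mul_mem_H0 hf hs
      rw [mul_comm]
      exact this
    let ψ : V.forms 1 →ₗ[ℂ] V.H0 0 := (LinearMap.mulLeft ℂ s).restrict hmul
    have hψ : Function.Injective ψ := fun a b h =>
      Subtype.ext (mul_left_cancel₀ hs0 (congrArg Subtype.val h))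
    have h2 := LinearMap.finrank_le_finrank_of_injective hψ
    have h3 := LinearMap.finrank_le_finrank_of_injective (Submodule.inclusion_injective h1)
    rw [finrank_H0_zero h1 hg] at h2
    rw [finrank_H0_one hK hg] at h3
    omega
  obtain ⟨k, rfl⟩ : ∃ k : ℕ, m = -1 - k := ⟨(-1 - m).toNat, by omega⟩
  rw [Submodule.eq_bot_iff]
  intro s hs
  have h := form_mul_mem_H0 (isHomogeneous_X_pow (R := ℂ) i₀.1 k) hs
  rw [show (-1 - (k : ℤ) + (k : ℕ) : ℤ) = -1 by ring, hm1, Submodule.mem_bot, form_pow] at h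
  exact (mul_eq_zero.mp h).resolve_left (pow_ne_zero _ (V.coord_ne_zero i₀))

theorem finite_H1_nat (m : ℕ) : Module.Finite ℂ (V.H1 m) := by
  have : Module.Finite ℂ (V.H0 (1 - m)) := by
    rcases m with _ | _ | m
    · exact finite_H0_one h1
    · exact finite_H0_zero h1 hg
    · rw [H0_neg hK h1 hg (by push_cast; omega)]; infer_instance
  exact finite_H1 hK (a := 1 - m) (by ring)

theorem finrank_H1_one : Module.finrank ℂ (V.H1 1) = 1 := by
  rw [finrank_H1_eq hK (show (0 : ℤ) + 1 = 1 by norm_num), finrank_H0_zero h1 hg]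

theorem subsingleton_H1 {m : ℕ} (hm : 2 ≤ m) : Subsingleton (V.H1 m) := by
  have := finite_H1_nat hK h1 hg m
  rw [← Module.finrank_zero_iff (R := ℂ), finrank_H1_eq hK (a := 1 - m) (by ring),
    H0_neg hK h1 hg (by omega)]
  exact finrank_bot ℂ V.K

variable {i₀ : V.Chart} {z : PolyRing n} (hz : z.IsHomogeneous 1) {N : ℕ}
    (hx : ∀ i : V.Chart, ∃ a b : PolyRing n, a.IsHomogeneous N ∧ b.IsHomogeneous N ∧
      V.coord i.1 ^ (N + 1) = V.coord i₀.1 * V.form a + V.form z * V.form b)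
include hz hx

/-- The number is the degree `2g - 2 = 6`. In the first case it arises as `(4 - 1) + (4 - 1)`, the
second difference being the kernel of the surjection `H¹(0) → H¹(1)`; multiplication by `z`
transports it to all degrees. -/
theorem hyperplaneSections_finite_and_finrank (m : ℕ) :
    Module.Finite ℂ (V.HyperplaneSections i₀ m) ∧
      Module.finrank ℂ (V.HyperplaneSections i₀ m) = 6 := by
  induction m with
  | zero =>
    have : Module.Finite ℂ (V.H0 ((0 : ℕ) + 1)) := finite_H0_one h1
    have := finite_H1_nat hK h1 hg 0
    have hfin := finite_hyperplaneSections (V := V) i₀ (0 : ℕ)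
    refine ⟨hfin, ?_⟩
    have h := finrank_hyperplaneSections (V := V) i₀ (0 : ℕ)
    have h2 := LinearMap.finrank_range_add_finrank_ker (V.mulH1 i₀.1 (0 : ℕ))
    rw [LinearMap.range_eq_top.mpr (mulH1_surjective hK i₀ _), finrank_top] at h2
    have h3 : Module.finrank ℂ (V.H1 ((0 : ℕ) + 1)) = 1 := finrank_H1_one hK h1 hg
    have h4 : Module.finrank ℂ (V.H1 (0 : ℕ)) = 4 := hg
    have h5 : Module.finrank ℂ (V.H0 ((0 : ℕ) + 1)) = 4 := finrank_H0_one hK hg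
    have h6 : Module.finrank ℂ (V.H0 (0 : ℕ)) = 1 := finrank_H0_zero h1 hg
    omega
  | succ m ih =>
    obtain ⟨ih1, ih2⟩ := ih
    let e := LinearEquiv.ofBijective _ (mulHyperplane_bijective (i₀ := i₀) hz hx m)
    exact ⟨Module.Finite.equiv e, by rw [← ih2]; exact e.finrank_eq.symm⟩

theorem finite_H0_nat (m : ℕ) : Module.Finite ℂ (V.H0 m) := by
  induction m with
  | zero => exact finite_H0_zero h1 hg
  | succ m ih =>
    have := (hyperplaneSections_finite_and_finrank hK h1 hg hz hx m).1
    exact finite_H0_succ i₀ m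

/-- The exact sequence gives `6 + 4 = h⁰(2) + h¹(1)`, with `h¹(1) = 1` and `h¹(2) = 0`. -/
theorem finrank_H0_two : Module.finrank ℂ (V.H0 2) = 9 := by
  obtain ⟨h2, h3⟩ := hyperplaneSections_finite_and_finrank hK h1 hg hz hx 1
  have : Module.Finite ℂ (V.H0 ((1 : ℕ) + 1)) := finite_H0_nat hK h1 hg hz hx 2
  have h := finrank_hyperplaneSections (V := V) i₀ (1 : ℕ)
  have : Subsingleton (V.H1 ((1 : ℕ) + 1)) := subsingleton_H1 hK h1 hg le_rfl
  have h4 : LinearMap.ker (V.mulH1 i₀.1 (1 : ℕ)) = ⊤ :=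
    (Submodule.eq_top_iff'.mpr fun c => Subsingleton.elim _ _)
  rw [h4, finrank_top, h3] at h
  have h5 : Module.finrank ℂ (V.H1 (1 : ℕ)) = 1 := finrank_H1_one hK h1 hg
  have h6 : Module.finrank ℂ (V.H0 (1 : ℕ)) = 4 := finrank_H0_one hK hg
  have h7 : Module.finrank ℂ (V.H0 ((1 : ℕ) + 1)) = Module.finrank ℂ (V.H0 2) := rfl
  omega

omit hz hx in
theorem restrictHyperplane_surjective {m : ℕ} (hm : 2 ≤ m) :
    Function.Surjective (V.restrictHyperplane i₀ m) := by
  rw [← LinearMap.range_eq_top, ← ker_connecting]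
  have := subsingleton_H1 hK h1 hg hm
  exact Submodule.eq_top_iff'.mpr fun c => Subsingleton.elim _ _

theorem finrank_H0_nat (m : ℕ) : Module.finrank ℂ (V.H0 (m + 2 : ℕ)) = 6 * m + 9 := by
  induction m with
  | zero => exact finrank_H0_two hK h1 hg hz hx
  | succ m ih =>
    have : Module.Finite ℂ (V.H0 ((m + 2 : ℕ) + 1)) := finite_H0_nat hK h1 hg hz hx (m + 2 + 1)
    have h := finrank_range_restrictHyperplane (V := V) i₀ (m + 2 : ℕ)
    rw [LinearMap.range_eq_top.mpr (restrictHyperplane_surjective hK h1 hg (by omega)),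
      finrank_top, (hyperplaneSections_finite_and_finrank hK h1 hg hz hx (m + 2)).2, ih] at h
    have h7 : Module.finrank ℂ (V.H0 ((m + 2 : ℕ) + 1)) =
      Module.finrank ℂ (V.H0 (m + 1 + 2 : ℕ)) := rfl
    omega

/-- In degrees at least four, sections are generated by sections of lower degree. -/
theorem exists_eq_add_of_mem_H0 {m : ℕ} {s : V.K} (hs : s ∈ V.H0 (m + 4 : ℕ)) :
    ∃ u ∈ V.H0 (m + 3 : ℕ), ∃ t ∈ V.H0 (m + 3 : ℕ),
      s = V.coord i₀.1 * u + V.form z * t := by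
  let s' : V.H0 (((m + 2 : ℕ) : ℤ) + 1 + 1) := ⟨s, hs⟩
  -- On the hyperplane section `s` is divisible by `z`, and the quotient lifts to a global section
  -- `t`; then `s - z t` vanishes there.
  obtain ⟨d, hd⟩ := (mulHyperplane_bijective (i₀ := i₀) hz hx (m + 2 : ℕ)).2
    (V.restrictHyperplane i₀ _ s')
  obtain ⟨t, rfl⟩ := restrictHyperplane_surjective hK h1 hg (m := m + 2) (by omega) d
  have ht : V.form z * t.1 ∈ V.H0 (((m + 2 : ℕ) : ℤ) + 1 + 1) := form_mul_mem_H0 hz t.2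
  have h0 : V.restrictHyperplane i₀ _ (s' - ⟨_, ht⟩) = 0 := by
    rw [map_sub, ← hd, sub_eq_zero]; rfl
  obtain ⟨u, hu, h⟩ := (restrictHyperplane_eq_zero V i₀).mp h0
  refine ⟨u, hu, t.1, t.2, ?_⟩
  have h' : s - V.form z * t.1 = V.coord i₀.1 * u := h
  linear_combination h'

/-- The sections of degree three that are generated by sections of degree two. -/
theorem finrank_sup_map_H0_two :
    14 ≤ Module.finrank ℂ ((V.H0 2).map (LinearMap.mulLeft ℂ (V.coord i₀.1)) ⊔
      (V.H0 2).map (LinearMap.mulLeft ℂ (V.form z)) : Submodule ℂ V.K) := by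
  have hf2 : Module.Finite ℂ (V.H0 2) := finite_H0_nat hK h1 hg hz hx 2
  have hf1 := finite_H0_one h1
  have hz0 : V.form z ≠ 0 := by
    intro hz0
    have h6 := (hyperplaneSections_finite_and_finrank hK h1 hg hz hx 0).2
    have : Subsingleton (V.HyperplaneSections i₀ (0 : ℕ)) := by
      refine subsingleton_of_forall_eq 0 fun d => ?_
      apply (mulHyperplane_bijective (i₀ := i₀) hz hx _).1
      rw [map_zero]
      obtain ⟨d, rfl⟩ := Submodule.mkQ_surjective _ d
      rw [Submodule.mkQ_apply, mulHyperplane_mk_eq_zero]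
      intro i
      refine ⟨0, zero_mem _, ?_⟩
      change V.form z * d.1 i = _
      rw [hz0, zero_mul, mul_zero]
    rw [Module.finrank_zero_of_subsingleton] at h6
    omega
  -- A relation `x_{i₀} u = z t` is a Koszul relation, since `z` is invertible on the hyperplane
  -- section. The overlap therefore has dimension at most `h⁰(1) = 4`, and `9 + 9 - 4 = 14`.
  have hle : (V.H0 2).map (LinearMap.mulLeft ℂ (V.coord i₀.1)) ⊓
      (V.H0 2).map (LinearMap.mulLeft ℂ (V.form z)) ≤
      (V.H0 1).map (LinearMap.mulLeft ℂ (V.form z * V.coord i₀.1)) := by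
    rintro _ ⟨⟨u, hu, rfl⟩, t, ht, h⟩
    have h' : V.form z * t = V.coord i₀.1 * u := h
    let t' : V.H0 (((1 : ℕ) : ℤ) + 1) := ⟨t, ht⟩
    have h0 : mulHyperplane (i₀ := i₀) hz _ (V.restrictHyperplane i₀ _ t') = 0 := by
      have ht' : V.form z * t ∈ V.H0 (((1 : ℕ) : ℤ) + 1 + 1) := form_mul_mem_H0 hz t'.2
      have : mulHyperplane (i₀ := i₀) hz _ (V.restrictHyperplane i₀ _ t') =
        V.restrictHyperplane i₀ _ ⟨_, ht'⟩ := rfl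
      rw [this, restrictHyperplane_eq_zero]
      exact ⟨u, hu, h'⟩
    rw [← map_zero (mulHyperplane (i₀ := i₀) hz _)] at h0
    obtain ⟨w, hw, h2⟩ := (restrictHyperplane_eq_zero V i₀).mp
      ((mulHyperplane_bijective (i₀ := i₀) hz hx _).1 h0)
    refine ⟨w, hw, ?_⟩
    have h2' : t = V.coord i₀.1 * w := h2
    change V.form z * V.coord i₀.1 * w = V.coord i₀.1 * u
    rw [← h', h2', mul_assoc]
  have hinj : ∀ a : V.K, a ≠ 0 → Function.Injective (LinearMap.mulLeft ℂ a) :=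
    fun a ha _ _ h => mul_left_cancel₀ ha h
  have h3 := Submodule.finrank_sup_add_finrank_inf_eq
    ((V.H0 2).map (LinearMap.mulLeft ℂ (V.coord i₀.1)))
    ((V.H0 2).map (LinearMap.mulLeft ℂ (V.form z)))
  have h4 := (Submodule.finrank_mono hle).trans (Submodule.finrank_map_le _ _)
  rw [← (Submodule.equivMapOfInjective _ (hinj _ (V.coord_ne_zero i₀)) _).finrank_eq,
    ← (Submodule.equivMapOfInjective _ (hinj _ hz0) _).finrank_eq,
    finrank_H0_two hK h1 hg hz hx] at h3
  rw [finrank_H0_one hK hg] at h4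
  omega

end Canonical

end ProjVariety

/-! ### Projective normality and equations of canonical curves of genus four -/

theorem finrank_homogeneousSubmodule_five (m : ℕ) :
    (24 : ℤ) * Module.finrank ℂ (homogeneousSubmodule (Fin (4 + 1)) ℂ m) =
      (m + 1) * (m + 2) * (m + 3) * (m + 4) := by
  rw [finrank_homogeneousSubmodule, Fintype.card_fin, show 4 + 1 + m - 1 = m + 4 by omega,
    Nat.choose_symm_of_eq_add rfl]
  have h := Nat.descFactorial_eq_factorial_mul_choose (m + 4) 4
  have h2 : (m + 4).descFactorial 4 = (m + 1) * (m + 2) * (m + 3) * (m + 4) := by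
    simp only [Nat.descFactorial_succ, Nat.descFactorial_zero]
    rw [show m + 4 - 3 = m + 1 by omega, show m + 4 - 2 = m + 2 by omega,
      show m + 4 - 1 = m + 3 by omega, Nat.sub_zero]
    ring
  rw [h2, show Nat.factorial 4 = 24 from rfl] at h
  exact_mod_cast h.symm

theorem finrank_degreePart_linear {l : PolyRing 4} (hl : l.IsHomogeneous 1) (h0 : l ≠ 0) (m : ℕ) :
    Module.finrank ℂ (degreePart (Ideal.span {l}) (m + 1)) =
      Module.finrank ℂ (homogeneousSubmodule (Fin (4 + 1)) ℂ m) := by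
  have h := finrank_degreePart_sup_span isHomogIdeal_bot hl (fun a ha => by
    rw [Ideal.mem_bot] at ha ⊢
    exact (mul_eq_zero.mp ha).resolve_right h0) m
  rw [bot_sup_eq, degreePart_bot, degreePart_bot, finrank_bot] at h
  simpa using h

theorem degreePart_linear_zero {l : PolyRing 4} (hl : l.IsHomogeneous 1) :
    degreePart (Ideal.span {l}) 0 = ⊥ := by
  have := degreePart_sup_span_of_lt isHomogIdeal_bot hl one_pos
  rwa [bot_sup_eq, degreePart_bot] at this

theorem isHomogIdeal_linear_sup_quadric {n : ℕ} {l q : PolyRing n} (hl : l.IsHomogeneous 1)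
    (hq : q.IsHomogeneous 2) : IsHomogIdeal (Ideal.span {l} ⊔ Ideal.span {q}) :=
  (isHomogIdeal_span_singleton hl).sup (isHomogIdeal_span_singleton hq)

/-- The Hilbert function of a quadric surface. -/
theorem finrank_degreePart_quadric {l q : PolyRing 4} (hl : l.IsHomogeneous 1) (h0 : l ≠ 0)
    (hq : q.IsHomogeneous 2) (hql : q ∉ Ideal.span {l}) (m : ℕ) :
    Module.finrank ℂ (degreePart (Ideal.span {l} ⊔ Ideal.span {q}) m) + (m + 1) ^ 2 =
      Module.finrank ℂ (homogeneousSubmodule (Fin (4 + 1)) ℂ m) := by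
  zify
  have hp := isPrime_span_linear hl h0
  have hr := finrank_homogeneousSubmodule_five
  rcases m with _ | _ | m
  · rw [degreePart_sup_span_of_lt (isHomogIdeal_span_singleton hl) hq (by norm_num),
      degreePart_linear_zero hl, finrank_bot]
    have := hr 0
    push_cast at *
    omega
  · rw [degreePart_sup_span_of_lt (isHomogIdeal_span_singleton hl) hq (by norm_num), zero_add,
      finrank_degreePart_linear hl h0 0]
    have h1 := hr 0
    have h2 := hr 1
    push_cast at *
    omega
  · have h := finrank_degreePart_sup_span (isHomogIdeal_span_singleton hl) hq (fun a ha =>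
      (hp.mem_or_mem ha).resolve_right hql) m
    rw [finrank_degreePart_linear hl h0 (m + 1)] at h
    have h1 := hr m
    have h2 := hr (m + 1)
    have h3 := hr (m + 1 + 1)
    rcases m with _ | m
    · rw [degreePart_linear_zero hl, finrank_bot] at h
      push_cast at *
      omega
    · rw [finrank_degreePart_linear hl h0 m] at h
      have h4 := hr m
      zify at h
      push_cast at *
      linarith

/-- The Hilbert function of a complete intersection on a quadric surface. -/
theorem finrank_degreePart_complete_intersection {l q f : PolyRing 4} (hl : l.IsHomogeneous 1)
    (h0 : l ≠ 0) (hq : q.IsHomogeneous 2) (hql : q ∉ Ideal.span {l})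
    (hp : (Ideal.span {l} ⊔ Ideal.span {q}).IsPrime) {e : ℕ} (hf : f.IsHomogeneous e)
    (hflq : f ∉ Ideal.span {l} ⊔ Ideal.span {q}) (m : ℕ) :
    Module.finrank ℂ
        (degreePart (Ideal.span {l} ⊔ Ideal.span {q} ⊔ Ideal.span {f}) (m + e)) +
      (m + e + 1) ^ 2 =
      Module.finrank ℂ (homogeneousSubmodule (Fin (4 + 1)) ℂ (m + e)) + (m + 1) ^ 2 := by
  have h := finrank_degreePart_sup_span (isHomogIdeal_linear_sup_quadric hl hq) hf (fun a ha =>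
      (hp.mem_or_mem ha).resolve_right hflq) m
  have h1 := finrank_degreePart_quadric hl h0 hq hql m
  have h2 := finrank_degreePart_quadric hl h0 hq hql (m + e)
  omega

namespace ProjVariety

variable {n : ℕ} {V : ProjVariety n}

theorem exists_form_pow_mul_mem_forms {m : ℕ} {s : V.K} (hs : s ∈ V.H0 m) {w : PolyRing n}
    (hw : w.IsHomogeneous 1) : ∃ k : ℕ, V.form w ^ k * s ∈ V.forms (m + k) := by
  have hN : ∀ d i, ∀ e ∈ V.forms (m + d), V.coord i • e ∈ V.forms (m + (d + 1)) :=
    fun d i e he => form_mul_mem_forms (isHomogeneous_X ℂ i) he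
  have hs' : ∀ i, ∃ k : ℕ, V.coord i ^ k • s ∈ V.forms (m + k) := by
    intro i
    by_cases hi : (X i : PolyRing n) ∈ V.ideal
    · refine ⟨1, ?_⟩
      have : V.coord i = 0 := V.form_eq_zero.mpr hi
      have h0 : V.coord i ^ 1 • s = 0 := by rw [this, pow_one, smul_eq_mul, zero_mul]
      exact h0 ▸ zero_mem (V.forms (m + 1))
    · obtain ⟨k, hk⟩ := exists_coord_pow_mul_mem_forms (mem_H0.mp hs ⟨i, hi⟩)
      exact ⟨k, hk⟩
  exact exists_form_pow_smul_mem (fun d => V.forms (m + d)) hN s hs' hw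

theorem exists_uniform_pow_mul_mem_forms {m : ℕ} [Module.Finite ℂ (V.H0 m)] {w : PolyRing n}
    (hw : w.IsHomogeneous 1) : ∃ K : ℕ, ∀ k ≥ K, ∀ s ∈ V.H0 m,
        V.form w ^ k * s ∈ V.forms (m + k) := by
  obtain ⟨S, hS⟩ := Module.Finite.iff_fg.mp ‹Module.Finite ℂ (V.H0 m)›
  have hmem : ∀ s : S, s.1 ∈ V.H0 m := fun s => hS ▸ Submodule.subset_span s.2
  choose k hk using fun s : S => exists_form_pow_mul_mem_forms (hmem s) hw
  refine ⟨∑ s, k s, fun K hK s hs => ?_⟩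
  rw [← hS] at hs
  induction hs using Submodule.span_induction with
  | mem s hs =>
    have hle : k ⟨s, hs⟩ ≤ K :=
      (Finset.single_le_sum (fun _ _ => Nat.zero_le _) (Finset.mem_univ _)).trans hK
    obtain ⟨j, rfl⟩ := Nat.exists_eq_add_of_le hle
    have := form_mul_mem_forms (hw.pow j) (hk ⟨s, hs⟩)
    rw [one_mul, form_pow, ← mul_assoc, ← pow_add, add_comm j, add_assoc] at this
    exact this
  | zero => rw [mul_zero]; exact zero_mem _
  | add a b _ _ ha hb => rw [mul_add]; exact add_mem ha hb
  | smul c a _ ha => rw [mul_smul_comm]; exact Submodule.smul_mem _ c ha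

theorem mem_forms_succ_induction {m : ℕ} {P : Submodule ℂ V.K}
    (h : ∀ w : PolyRing n, w.IsHomogeneous 1 → ∀ s ∈ V.forms m, V.form w * s ∈ P) :
    V.forms (m + 1) ≤ P := by
  rintro _ ⟨f, hf, rfl⟩
  rw [SetLike.mem_coe, ← homogeneousSubmodule_one_pow, pow_succ',
      homogeneousSubmodule_one_pow] at hf
  refine Submodule.mul_induction_on hf (fun w hw s hs => ?_) (fun a b ha hb => ?_)
  · change V.form (w * s) ∈ P
    rw [form_mul]
    exact h w hw _ ⟨s, hs, rfl⟩
  · rw [map_add]; exact add_mem ha hb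

section Canonical

variable (hK : V.CanonicalSheafIsTwist 1) (h1 : V.H0 1 ≤ V.forms 1) (hg : V.arithmeticGenus = 4)
  {i₀ : V.Chart} {z : PolyRing n} (hz : z.IsHomogeneous 1) {N : ℕ}
  (hx : ∀ i : V.Chart, ∃ a b : PolyRing n, a.IsHomogeneous N ∧ b.IsHomogeneous N ∧
    V.coord i.1 ^ (N + 1) = V.coord i₀.1 * V.form a + V.form z * V.form b)
include hK h1 hg hz hx

/-- Sections of degree `m + 3` are combinations of `y ^ a z ^ b s` with `a + b = m` and `s ∈ H⁰(3)`.
Since `H⁰(3)` is finite-dimensional, uniform powers of `y` and of `z` turn all such `s` into forms,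
and for large `m` one of the two exponents is large enough. -/
theorem exists_forall_H0_le_forms : ∃ M : ℕ, ∀ m ≥ M, V.H0 (m + 3 : ℕ) ≤ V.forms (m + 3) := by
  have hf := finite_H0_nat hK h1 hg hz hx 3
  obtain ⟨K, hKy⟩ := exists_uniform_pow_mul_mem_forms (V := V) (m := 3) (isHomogeneous_X ℂ i₀.1)
  obtain ⟨L, hLz⟩ := exists_uniform_pow_mul_mem_forms (V := V) (m := 3) hz
  have key : ∀ m a b : ℕ, K + L ≤ a + b + m → ∀ s ∈ V.H0 (m + 3 : ℕ),
      V.coord i₀.1 ^ a * V.form z ^ b * s ∈ V.forms (m + 3 + a + b) := by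
    intro m
    induction m with
    | zero =>
      intro a b hab s hs
      by_cases ha : K ≤ a
      · have := form_mul_mem_forms (hz.pow b) (hKy a ha s hs)
        rw [one_mul, form_pow, mul_left_comm, ← mul_assoc, add_right_comm,
          show 3 + b + a = 0 + 3 + a + b by ring] at this
        exact this
      · have := form_mul_mem_forms (isHomogeneous_X_pow i₀.1 a) (hLz b (by omega) s hs)
        rw [form_pow, ← mul_assoc, show 3 + b + a = 0 + 3 + a + b by ring] at this
        exact this
    | succ m ih =>
      intro a b hab s hs
      obtain ⟨u, hu, t, ht, rfl⟩ := exists_eq_add_of_mem_H0 hK h1 hg hz hx (m := m) hs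
      have h2 := ih (a + 1) b (by omega) u hu
      have h3 := ih a (b + 1) (by omega) t ht
      rw [show m + 3 + (a + 1) + b = m + 1 + 3 + a + b by ring] at h2
      rw [show m + 3 + a + (b + 1) = m + 1 + 3 + a + b by ring] at h3
      convert! add_mem h2 h3 using 1
      ring
  refine ⟨K + L, fun m hm s hs => ?_⟩
  simpa using key m 0 0 (by omega) s hs

theorem exists_finrank_forms : ∃ M : ℕ, ∀ m ≥ M,
    Module.finrank ℂ (V.forms (m + 3)) = 6 * m + 15 := by
  obtain ⟨M, hM⟩ := exists_forall_H0_le_forms hK h1 hg hz hx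
  refine ⟨M, fun m hm => ?_⟩
  have h2 := finrank_H0_nat hK h1 hg hz hx (m + 1)
  rw [show m + 1 + 2 = m + 3 by ring, le_antisymm (hM m hm) (forms_le_H0 _)] at h2
  omega

end Canonical

/-! ### Projective normality and the generators of the homogeneous ideal -/

section Equations

variable {V : ProjVariety 4}
  (hK : V.CanonicalSheafIsTwist 1) (h1 : V.H0 1 ≤ V.forms 1) (hg : V.arithmeticGenus = 4)
  {i₀ : V.Chart} {z : PolyRing 4} (hz : z.IsHomogeneous 1) {N : ℕ}
  (hx : ∀ i : V.Chart, ∃ a b : PolyRing 4, a.IsHomogeneous N ∧ b.IsHomogeneous N ∧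
    V.coord i.1 ^ (N + 1) = V.coord i₀.1 * V.form a + V.form z * V.form b)
  {l q : PolyRing 4} (hl : l.IsHomogeneous 1) (h0 : l ≠ 0) (hlV : l ∈ V.ideal)
  (hlin : ∀ f, f.IsHomogeneous 1 → f ∈ V.ideal → f ∈ Ideal.span {l})
  (hq : q.IsHomogeneous 2) (hqV : q ∈ V.ideal) (hql : q ∉ Ideal.span {l})
include hK h1 hg hz hx hl h0 hlV hlin hq hqV hql

/-- A second quadric `f` would put the curve in a complete intersection of degree four, with Hilbert
function `4M + 12` in degree `M + 3`, while the curve has `6M + 15`. Without it the forms of degree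
two have dimension `9 = h⁰(2)`. -/
theorem forms_two_eq : V.forms 2 = V.H0 2 ∧
    degreePart V.ideal 2 = degreePart (Ideal.span {l} ⊔ Ideal.span {q}) 2 := by
  have hp := isPrime_span_linear_sup_span_quadric V.prime hl h0 hlV hlin hq hqV hql
  have hlq : Ideal.span {l} ⊔ Ideal.span {q} ≤ V.ideal :=
    sup_le ((Ideal.span_singleton_le_iff_mem _).mpr hlV)
      ((Ideal.span_singleton_le_iff_mem _).mpr hqV)
  have hI2 : degreePart V.ideal 2 = degreePart (Ideal.span {l} ⊔ Ideal.span {q}) 2 := by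
    refine le_antisymm ?_ (degreePart_mono hlq 2)
    rintro f ⟨hf, hfV⟩
    refine ⟨hf, ?_⟩
    by_contra hflq
    obtain ⟨M, hM⟩ := exists_finrank_forms hK h1 hg hz hx
    have h2 := finrank_degreePart_complete_intersection hl h0 hq hql hp hf hflq (M + 1)
    have hle : Ideal.span {l} ⊔ Ideal.span {q} ⊔ Ideal.span {f} ≤ V.ideal :=
      sup_le hlq ((Ideal.span_singleton_le_iff_mem _).mpr hfV)
    have := finiteDimensional_degreePart V.ideal (M + 3)
    have h3 := Submodule.finrank_mono (degreePart_mono hle (M + 3))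
    have h4 := finrank_forms_add (V := V) (M + 3)
    have h5 := hM M le_rfl
    rw [show M + 1 + 2 = M + 3 by ring] at h2
    have h6 : (M + 3 + 1) ^ 2 = (M + 1 + 1) ^ 2 + 4 * M + 12 := by ring
    omega
  refine ⟨?_, hI2⟩
  have := finite_H0_nat hK h1 hg hz hx 2
  refine Submodule.eq_of_le_of_finrank_eq (forms_le_H0 2) ?_
  have h2 := finrank_degreePart_quadric hl h0 hq hql 2
  have h4 := finrank_forms_add (V := V) 2
  have h5 : Module.finrank ℂ (V.H0 2) = 9 := finrank_H0_two hK h1 hg hz hx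
  rw [hI2] at h4
  omega

/-- Products of `y` and `z` with quadratic forms already span dimension at least `14` of `15`. If
some section of degree three were not a form, they would span all cubic forms, and every later
degree would also come from multiplying by `y` and `z`. The Hilbert function of the forms would then
have nonincreasing differences, starting with `9 - 4 = 5`, against the growth `6` of the curve. -/
theorem forms_three_eq : V.forms 3 = V.H0 3 := by
  have hf3 : Module.Finite ℂ (V.H0 3) := finite_H0_nat hK h1 hg hz hx 3
  obtain ⟨h22, -⟩ := forms_two_eq hK h1 hg hz hx hl h0 hlV hlin hq hqV hql
  have h14 := finrank_sup_map_H0_two hK h1 hg hz hx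
  have h9 : Module.finrank ℂ (V.H0 2) = 9 := finrank_H0_two hK h1 hg hz hx
  have h4 : Module.finrank ℂ (V.H0 1) = 4 := finrank_H0_one hK hg
  have h15 : Module.finrank ℂ (V.H0 3) = 15 := finrank_H0_nat hK h1 hg hz hx 1
  have h11 : V.forms 1 = V.H0 1 := le_antisymm (forms_le_H0 1) h1
  rw [← h22] at h14 h9
  rw [← h11] at h4
  by_contra hne
  let P (m : ℕ) : Submodule ℂ V.K := (V.forms m).map (LinearMap.mulLeft ℂ (V.coord i₀.1)) ⊔
    (V.forms m).map (LinearMap.mulLeft ℂ (V.form z))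
  have hlt : Module.finrank ℂ (V.forms 3) < 15 := by
    rw [← h15]
    exact Submodule.finrank_lt_finrank_of_lt (lt_of_le_of_ne (forms_le_H0 3) hne)
  have hPle : ∀ m, P m ≤ V.forms (m + 1) := by
    intro m
    refine sup_le ?_ ?_
    · rintro _ ⟨s, hs, rfl⟩
      exact form_mul_mem_forms (isHomogeneous_X ℂ i₀.1) hs
    · rintro _ ⟨s, hs, rfl⟩
      exact form_mul_mem_forms hz hs
  -- Forms are generated in degree one, so the equality propagates from degree three.
  have hP : ∀ m, V.forms (m + 3) = P (m + 2) := by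
    intro m
    induction m with
    | zero =>
      refine (Submodule.eq_of_le_of_finrank_le (hPle 2) ?_).symm
      have h : 14 ≤ Module.finrank ℂ (P 2) := h14
      exact (Nat.le_of_lt_succ hlt).trans h
    | succ m ih =>
      refine le_antisymm (mem_forms_succ_induction fun w hw s hs => ?_) (hPle _)
      rw [ih] at hs
      obtain ⟨_, ⟨u, hu, rfl⟩, _, ⟨t, ht, rfl⟩, rfl⟩ := Submodule.mem_sup.mp hs
      rw [mul_add]
      refine Submodule.add_mem_sup ⟨V.form w * u, form_mul_mem_forms hw hu, ?_⟩
        ⟨V.form w * t, form_mul_mem_forms hw ht, ?_⟩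
      · exact mul_left_comm _ _ _
      · exact mul_left_comm _ _ _
  have hinj : ∀ a : V.K, a ≠ 0 → Function.Injective (LinearMap.mulLeft ℂ a) :=
    fun a ha _ _ h => mul_left_cancel₀ ha h
  have hy0 := V.coord_ne_zero i₀
  have hz0 : V.form z ≠ 0 := by
    intro hz0
    have : P 2 ≤ (V.forms 2).map (LinearMap.mulLeft ℂ (V.coord i₀.1)) := by
      refine sup_le le_rfl ?_
      rintro _ ⟨s, hs, rfl⟩
      rw [LinearMap.mulLeft_apply, hz0, zero_mul]
      exact zero_mem _
    have h := (Submodule.finrank_mono this).trans (Submodule.finrank_map_le _ _)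
    have : 14 ≤ Module.finrank ℂ (P 2) := h14
    omega
  -- The multiples of `z y` lie in both summands of `P (m + 2)`, which bounds the dimension of the
  -- sum.
  have hstep : ∀ m, Module.finrank ℂ (V.forms (m + 3)) + Module.finrank ℂ (V.forms (m + 1)) ≤
      2 * Module.finrank ℂ (V.forms (m + 2)) := by
    intro m
    have h := Submodule.finrank_sup_add_finrank_inf_eq
      ((V.forms (m + 2)).map (LinearMap.mulLeft ℂ (V.coord i₀.1)))
      ((V.forms (m + 2)).map (LinearMap.mulLeft ℂ (V.form z)))
    rw [← (Submodule.equivMapOfInjective _ (hinj _ hy0) _).finrank_eq,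
      ← (Submodule.equivMapOfInjective _ (hinj _ hz0) _).finrank_eq] at h
    have hle : (V.forms (m + 1)).map (LinearMap.mulLeft ℂ (V.form z * V.coord i₀.1)) ≤
        (V.forms (m + 2)).map (LinearMap.mulLeft ℂ (V.coord i₀.1)) ⊓
      (V.forms (m + 2)).map (LinearMap.mulLeft ℂ (V.form z)) := by
      rintro _ ⟨s, hs, rfl⟩
      refine ⟨⟨V.form z * s, form_mul_mem_forms hz hs, ?_⟩,
        ⟨V.coord i₀.1 * s, form_mul_mem_forms (isHomogeneous_X ℂ i₀.1) hs, ?_⟩⟩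
      · simp only [LinearMap.mulLeft_apply]; ring
      · simp only [LinearMap.mulLeft_apply]; ring
    have h2 := Submodule.finrank_mono hle
    rw [← (Submodule.equivMapOfInjective _ (hinj _ (mul_ne_zero hz0 hy0)) _).finrank_eq] at h2
    have h3 : Module.finrank ℂ (V.forms (m + 3)) = Module.finrank ℂ (P (m + 2)) := by rw [hP m]
    change _ = _ at h
    have h4 : Module.finrank ℂ (P (m + 2)) = Module.finrank ℂ
      ((V.forms (m + 2)).map (LinearMap.mulLeft ℂ (V.coord i₀.1)) ⊔
        (V.forms (m + 2)).map (LinearMap.mulLeft ℂ (V.form z)) : Submodule ℂ V.K) := rfl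
    omega
  have hbound : ∀ m, Module.finrank ℂ (V.forms (m + 2)) ≤ Module.finrank ℂ (V.forms (m + 1)) + 5 ∧
      Module.finrank ℂ (V.forms (m + 2)) ≤ 9 + 5 * m := by
    intro m
    induction m with
    | zero =>
      refine ⟨?_, h9.le⟩
      rw [show 0 + 2 = 2 from rfl, show 0 + 1 = 1 from rfl, h9, h4]
    | succ m ih =>
      have := hstep m
      have e1 : m + 1 + 2 = m + 3 := rfl
      have e2 : m + 1 + 1 = m + 2 := rfl
      rw [e1, e2]
      omega
  obtain ⟨M, hM⟩ := exists_finrank_forms hK h1 hg hz hx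
  have h5 := hM M le_rfl
  have h6 := (hbound (M + 1)).2
  rw [show M + 1 + 2 = M + 3 by ring] at h6
  omega

theorem H0_le_forms (m : ℕ) : V.H0 m ≤ V.forms m := by
  induction m using Nat.strong_induction_on with
  | _ m ih =>
    match m, ih with
    | 0, _ =>
      have : V.H0 (0 : ℕ) = Submodule.span ℂ {1} := H0_zero_eq h1 hg
      rw [this, Submodule.span_singleton_le_iff_mem]
      exact mem_forms.mpr ⟨1, isHomogeneous_one _ _, V.form_one⟩
    | 1, _ => exact h1
    | 2, _ => exact (forms_two_eq hK h1 hg hz hx hl h0 hlV hlin hq hqV hql).1.ge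
    | 3, _ => exact (forms_three_eq hK h1 hg hz hx hl h0 hlV hlin hq hqV hql).ge
    | m + 4, ih =>
      intro s hs
      obtain ⟨u, hu, t, ht, rfl⟩ := exists_eq_add_of_mem_H0 hK h1 hg hz hx hs
      exact add_mem (form_mul_mem_forms (isHomogeneous_X ℂ i₀.1) (ih (m + 3) (by omega) hu))
        (form_mul_mem_forms hz (ih (m + 3) (by omega) ht))

/-- In degree three the quadric surface has `16` independent forms and the curve only `15`, so a new
cubic exists. The complete intersection has Hilbert function `(m + 4)² - (m + 1)² = 6m + 15` in
degree `m + 3`, like the curve, and the inclusion of ideals is an equality. -/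
theorem exists_cubic : ∃ c : PolyRing 4, c.IsHomogeneous 3 ∧
    c ∉ Ideal.span {l} ⊔ Ideal.span {q} ∧
    V.ideal = Ideal.span {l} ⊔ Ideal.span {q} ⊔ Ideal.span {c} := by
  have hp := isPrime_span_linear_sup_span_quadric V.prime hl h0 hlV hlin hq hqV hql
  have hlq : Ideal.span {l} ⊔ Ideal.span {q} ≤ V.ideal :=
    sup_le ((Ideal.span_singleton_le_iff_mem _).mpr hlV)
      ((Ideal.span_singleton_le_iff_mem _).mpr hqV)
  have hforms : ∀ m : ℕ, V.forms m = V.H0 m := fun m => le_antisymm (forms_le_H0 m)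
    (H0_le_forms hK h1 hg hz hx hl h0 hlV hlin hq hqV hql m)
  have hr := finrank_homogeneousSubmodule_five
  have hQ := finrank_degreePart_quadric hl h0 hq hql
  have hV : ∀ m, Module.finrank ℂ (degreePart V.ideal (m + 2)) + (6 * m + 9) =
      Module.finrank ℂ (homogeneousSubmodule (Fin (4 + 1)) ℂ (m + 2)) := by
    intro m
    rw [← finrank_H0_nat hK h1 hg hz hx m, ← hforms, ← finrank_forms_add, add_comm]
  obtain ⟨c, ⟨hc, hcV⟩, hclq⟩ : ∃ c ∈ degreePart V.ideal 3,
      c ∉ Ideal.span {l} ⊔ Ideal.span {q} := by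
    by_contra! h
    have hle : degreePart V.ideal 3 ≤ degreePart (Ideal.span {l} ⊔ Ideal.span {q}) 3 :=
      fun f hf => ⟨hf.1, h f hf⟩
    have := finiteDimensional_degreePart (Ideal.span {l} ⊔ Ideal.span {q}) 3
    have h2 := Submodule.finrank_mono hle
    have h3 := hV 1
    have h4 := hQ 3
    rw [show 1 + 2 = 3 from rfl] at h3
    omega
  refine ⟨c, hc, hclq, ?_⟩
  have hle : Ideal.span {l} ⊔ Ideal.span {q} ⊔ Ideal.span {c} ≤ V.ideal :=
    sup_le hlq ((Ideal.span_singleton_le_iff_mem _).mpr hcV)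
  refine le_antisymm (IsHomogIdeal.le_of_forall_homogeneous V.homogeneous fun m f hf hfm => ?_) hle
  suffices h : degreePart V.ideal m ≤
      degreePart (Ideal.span {l} ⊔ Ideal.span {q} ⊔ Ideal.span {c}) m from (h ⟨hfm, hf⟩).2
  have hfd := finiteDimensional_degreePart V.ideal
  refine (Submodule.eq_of_le_of_finrank_le (degreePart_mono hle m) ?_).ge
  have hlow : ∀ m < 3, degreePart (Ideal.span {l} ⊔ Ideal.span {q} ⊔ Ideal.span {c}) m =
      degreePart (Ideal.span {l} ⊔ Ideal.span {q}) m := fun m hm =>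
    degreePart_sup_span_of_lt (isHomogIdeal_linear_sup_quadric hl hq) hc hm
  match m with
  | 0 =>
    rw [hlow 0 (by norm_num)]
    have h2 := finrank_forms_add (V := V) 0
    have h3 := hQ 0
    have h4 : Module.finrank ℂ (V.H0 (0 : ℕ)) = 1 := finrank_H0_zero h1 hg
    rw [hforms, h4] at h2
    omega
  | 1 =>
    rw [hlow 1 (by norm_num)]
    have h2 := finrank_forms_add (V := V) 1
    have h3 := hQ 1
    have h4 : Module.finrank ℂ (V.H0 (1 : ℕ)) = 4 := finrank_H0_one hK hg
    rw [hforms, h4] at h2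
    omega
  | 2 =>
    rw [hlow 2 (by norm_num), (forms_two_eq hK h1 hg hz hx hl h0 hlV hlin hq hqV hql).2]
  | m + 3 =>
    have h2 := finrank_degreePart_complete_intersection hl h0 hq hql hp hc hclq m
    have h3 := hV (m + 1)
    rw [show m + 1 + 2 = m + 3 by ring] at h3
    have h6 : (m + 3 + 1) ^ 2 = (m + 1) ^ 2 + 6 * m + 15 := by ring
    omega

end Equations

end ProjVariety

/-! ### Closed subschemes given by equations -/

namespace ClosedSubscheme

variable {n : ℕ}

theorem subset_zeroScheme (F : Set (PolyRing n)) : F ⊆ (zeroScheme F).ideal := fun _ hf =>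
  Submodule.mem_sInf.mpr fun _ hI => hI.1 hf

theorem zeroScheme_ideal_le {F : Set (PolyRing n)} (X : ClosedSubscheme n)
    (h : F ⊆ X.ideal) : (zeroScheme F).ideal ≤ X.ideal :=
  sInf_le ⟨h, X.homogeneous, X.saturated⟩

theorem ideal_le_inter_left (X Y : ClosedSubscheme n) : X.ideal ≤ (X.inter Y).ideal :=
  fun _ hf => subset_zeroScheme _ (Or.inl hf)

theorem ideal_le_inter_right (X Y : ClosedSubscheme n) : Y.ideal ≤ (X.inter Y).ideal :=
  fun _ hf => subset_zeroScheme _ (Or.inr hf)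

theorem mem_hypersurface (f : PolyRing n) : f ∈ (hypersurface f).ideal :=
  subset_zeroScheme _ rfl

/-- The saturation of a homogeneous ideal. -/
def saturation (I : Ideal (PolyRing n)) (hI : IsHomogIdeal I) : ClosedSubscheme n where
  ideal :=
    { carrier := {f | ∃ N : ℕ, ∀ i, X i ^ N * f ∈ I}
      zero_mem' := ⟨0, fun i => by simp⟩
      add_mem' := by
        rintro f g ⟨N, hN⟩ ⟨M, hM⟩
        refine ⟨N + M, fun i => ?_⟩
        have : X i ^ (N + M) * (f + g) = X i ^ M * (X i ^ N * f) + X i ^ N * (X i ^ M * g) := by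
          ring
        rw [this]
        exact I.add_mem (I.mul_mem_left _ (hN i)) (I.mul_mem_left _ (hM i))
      smul_mem' := by
        rintro c f ⟨N, hN⟩
        refine ⟨N, fun i => ?_⟩
        rw [smul_eq_mul, mul_left_comm]
        exact I.mul_mem_left _ (hN i) }
  homogeneous := by
    rintro f ⟨N, hN⟩ d
    refine ⟨N, fun i => ?_⟩
    have h := hI _ (hN i) (d + N)
    rwa [mul_comm, homogeneousComponent_mul_of_isHomogeneous (isHomogeneous_X_pow i N),
      mul_comm] at h
  saturated := by
    intro f hf
    choose N hN using hf
    refine ⟨∑ i, N i + 1, fun i => ?_⟩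
    have hle : N i ≤ ∑ i, N i := Finset.single_le_sum (fun _ _ => Nat.zero_le _) (Finset.mem_univ i)
    obtain ⟨k, hk⟩ := Nat.exists_eq_add_of_le hle
    rw [hk, show X i ^ (N i + k + 1) * f = X i ^ k * (X i ^ N i * (X i * f)) by ring]
    exact I.mul_mem_left _ (hN i i)

theorem exists_of_mem_inter {X Y : ClosedSubscheme n} {f : PolyRing n}
    (hf : f ∈ (X.inter Y).ideal) : ∃ N : ℕ, ∀ i, MvPolynomial.X i ^ N * f ∈ X.ideal ⊔ Y.ideal :=
  zeroScheme_ideal_le (saturation (X.ideal ⊔ Y.ideal) (IsHomogIdeal.sup X.homogeneous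
      Y.homogeneous))
    (fun _ hg => ⟨0, fun i => by
      rw [pow_zero, one_mul]
      exact hg.elim Ideal.mem_sup_left Ideal.mem_sup_right⟩) hf

/-- A homogeneous prime ideal other than the irrelevant one is saturated. -/
theorem saturated_of_isPrime {I : Ideal (PolyRing n)} (hI : I.IsPrime) {i : Fin (n + 1)}
    (hi : (X i : PolyRing n) ∉ I) (f : PolyRing n) (h : ∀ i, X i * f ∈ I) : f ∈ I :=
  (hI.mem_or_mem (h i)).resolve_left hi

theorem zeroScheme_ideal {F : Set (PolyRing n)} (X : ClosedSubscheme n) (h : F ⊆ X.ideal)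
    (hX : X.ideal ≤ Ideal.span F) : zeroScheme F = X :=
  ClosedSubscheme.ext (le_antisymm (zeroScheme_ideal_le X h)
    (hX.trans (Ideal.span_le.mpr (subset_zeroScheme F))))

theorem inter_eq {X Y Z : ClosedSubscheme n} (h : X.ideal ⊔ Y.ideal = Z.ideal) :
    X.inter Y = Z := by
  refine zeroScheme_ideal Z (fun f hf => ?_) ?_
  · exact h ▸ hf.elim (fun h => Ideal.mem_sup_left h) (fun h => Ideal.mem_sup_right h)
  · rw [← h, Ideal.span_union, Ideal.span_eq, Ideal.span_eq]

/-- The linear forms in `(l)` have dimension one, and all linear forms have dimension five. -/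
theorem exists_X_notMem_span {l : PolyRing 4} (hl : l.IsHomogeneous 1) (h0 : l ≠ 0) :
    ∃ i, (X i : PolyRing 4) ∉ Ideal.span {l} := by
  by_contra! h
  have h1 := finrank_degreePart_linear hl h0 0
  have h2 : (24 : ℤ) * Module.finrank ℂ (homogeneousSubmodule (Fin (4 + 1)) ℂ 0) = 24 :=
    (finrank_homogeneousSubmodule_five 0).trans (by norm_num)
  have h3 : (24 : ℤ) * Module.finrank ℂ (homogeneousSubmodule (Fin (4 + 1)) ℂ 1) = 120 :=
    (finrank_homogeneousSubmodule_five 1).trans (by norm_num)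
  have h4 : homogeneousSubmodule (Fin (4 + 1)) ℂ 1 ≤ degreePart (Ideal.span {l}) 1 := by
    intro f hf
    refine ⟨hf, ?_⟩
    obtain ⟨a, rfl⟩ := IsHomogeneous.eq_sum_coeff hf
    exact Ideal.sum_mem _ fun i _ => Ideal.mul_mem_left _ _ (h i)
  have := finiteDimensional_degreePart (Ideal.span {l}) 1
  have h5 := Submodule.finrank_mono h4
  rw [zero_add] at h1
  omega

theorem hypersurface_linear_ideal {l : PolyRing 4} (hl : l.IsHomogeneous 1) (h0 : l ≠ 0) :
    (hypersurface l).ideal = Ideal.span {l} := by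
  obtain ⟨i, hi⟩ := exists_X_notMem_span hl h0
  let Z : ClosedSubscheme 4 := ⟨Ideal.span {l}, isHomogIdeal_span_singleton hl,
    saturated_of_isPrime (isPrime_span_linear hl h0) hi⟩
  exact congrArg ideal (zeroScheme_ideal Z Ideal.subset_span le_rfl)

end ClosedSubscheme

namespace ProjVariety

variable {n : ℕ} {V : ProjVariety n}

/-! ### Derivations -/

/-- A derivation of the field is a section of `K[ε] → K`. The assignment `x_i ↦ x_i + w_i ε`
respects the ideal by `hw`, and it extends to fractions since an element of `K[ε]` with nonzero
constant part is a unit. -/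
theorem exists_derivation (w : Fin (n + 1) → V.K)
    (hw : ∀ f ∈ V.ideal, ∑ i, V.form (pderiv i f) * w i = 0) :
    ∃ D : Derivation ℂ V.K V.K, ∀ f, D (V.form f) = ∑ i, V.form (pderiv i f) * w i := by
  let e : PolyRing n →ₐ[ℂ] TrivSqZeroExt V.K V.K :=
    aeval fun i => TrivSqZeroExt.inl (V.coord i) + TrivSqZeroExt.inr (w i)
  have he : ∀ f, e f = TrivSqZeroExt.inl (V.form f) +
      TrivSqZeroExt.inr (∑ i, V.form (pderiv i f) * w i) := by
    intro f
    induction f using MvPolynomial.induction_on with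
    | C c =>
      simp only [e, aeval_C, pderiv_C, form_zero, zero_mul, Finset.sum_const_zero,
        TrivSqZeroExt.inr_zero, add_zero, form_C]
      rfl
    | add f g hf hg =>
      simp only [map_add, hf, hg, form_add, add_mul, Finset.sum_add_distrib,
        TrivSqZeroExt.inl_add, TrivSqZeroExt.inr_add]
      abel
    | mul_X f j hf =>
      have hs : ∑ i, V.form (pderiv i (f * X j)) * w i =
          V.coord j * (∑ i, V.form (pderiv i f) * w i) + V.form f * w j := by
        simp only [Derivation.leibniz, smul_eq_mul, form_add, form_mul, add_mul,
          Finset.sum_add_distrib]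
        rw [Finset.sum_eq_single j, pderiv_X_self, form_one, mul_one, add_comm, Finset.mul_sum]
        · refine congrArg (· + _) (Finset.sum_congr rfl fun i _ => ?_)
          rw [coord, mul_assoc]
        · intro i _ hij
          rw [pderiv_X_of_ne (Ne.symm hij), form_zero, mul_zero, zero_mul]
        · simp
      rw [map_mul, hf, hs]
      simp only [e, aeval_X, form_mul]
      ext
      · simp [coord]
      · simp only [TrivSqZeroExt.snd_mul, TrivSqZeroExt.fst_add, TrivSqZeroExt.fst_inl,
          TrivSqZeroExt.fst_inr, TrivSqZeroExt.snd_add, TrivSqZeroExt.snd_inl,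
          TrivSqZeroExt.snd_inr, add_zero, zero_add, smul_eq_mul, MulOpposite.smul_eq_mul_unop,
          MulOpposite.unop_op]
        ring
  let eB : V.CoordRing →ₐ[ℂ] TrivSqZeroExt V.K V.K := Ideal.Quotient.liftₐ V.ideal e fun f hf => by
    rw [he, V.form_eq_zero.mpr hf, hw f hf, TrivSqZeroExt.inl_zero, TrivSqZeroExt.inr_zero,
        add_zero]
  have heB : ∀ b, (eB b).fst = algebraMap V.CoordRing V.K b := by
    intro b
    obtain ⟨f, rfl⟩ := Ideal.Quotient.mk_surjective b
    change (e f).fst = _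
    rw [he]
    simp [form]
  let φ : V.K →ₐ[ℂ] TrivSqZeroExt V.K V.K :=
    IsLocalization.liftAlgHom (M := nonZeroDivisors V.CoordRing) (f := eB) fun y => by
      rw [TrivSqZeroExt.isUnit_iff_isUnit_fst, heB]
      exact IsLocalization.map_units V.K y
  have hφB : ∀ b, φ (algebraMap V.CoordRing V.K b) = eB b := fun b => IsLocalization.lift_eq _ b
  have hφ : ∀ x, (φ x).fst = x := by
    have : (TrivSqZeroExt.fstHom ℂ V.K V.K).comp φ = AlgHom.id ℂ V.K := by
      apply IsLocalization.algHom_ext (nonZeroDivisors V.CoordRing)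
      refine AlgHom.ext fun b => ?_
      change (φ (algebraMap V.CoordRing V.K b)).fst = algebraMap V.CoordRing V.K b
      rw [hφB, heB]
    exact fun x => DFunLike.congr_fun this x
  refine ⟨Derivation.mk' ((TrivSqZeroExt.sndHom V.K V.K).restrictScalars ℂ ∘ₗ φ.toLinearMap) ?_, ?_⟩
  · intro a b
    change (φ (a * b)).snd = a * (φ b).snd + b * (φ a).snd
    rw [map_mul, TrivSqZeroExt.snd_mul, hφ, hφ, smul_eq_mul, MulOpposite.smul_eq_mul_unop,
      MulOpposite.unop_op, mul_comm _ b]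
  · intro f
    change (φ (algebraMap V.CoordRing V.K (Ideal.Quotient.mk V.ideal f))).snd = _
    rw [hφB]
    change (e f).snd = _
    rw [he]
    simp

/-- The constants of a derivation. -/
def constants (D : Derivation ℂ V.K V.K) : IntermediateField ℂ V.K where
  carrier := {x | D x = 0}
  mul_mem' := fun {a b} ha hb => by
    simp only [Set.mem_ofPred_eq, Derivation.leibniz] at *
    rw [ha, hb, smul_zero, smul_zero, add_zero]
  add_mem' := fun {a b} ha hb => by
    simp only [Set.mem_ofPred_eq, map_add] at *
    rw [ha, hb, add_zero]
  algebraMap_mem' := fun c => D.map_algebraMap c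
  inv_mem' := fun a ha => by
    change D a⁻¹ = 0
    rw [Derivation.leibniz_inv, show D a = 0 from ha, smul_zero]

/-- Differentiating the minimal polynomial relation gives `μ'(x) * D x = 0`, where `μ'(x) ≠ 0` in
characteristic zero. -/
theorem derivation_eq_zero_of_isIntegral {D : Derivation ℂ V.K V.K} {x : V.K}
    (hx : IsIntegral (constants D) x) : D x = 0 := by
  let D' : Derivation (constants D) V.K V.K :=
    Derivation.mk'
      { toFun := D
        map_add' := map_add D
        map_smul' := fun c y => by
          change D (c.1 * y) = c.1 * D y
          rw [Derivation.leibniz, show D c.1 = 0 from c.2, smul_zero, add_zero, smul_eq_mul] }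
      fun a b => D.leibniz a b
  have h := D'.map_aeval (minpoly (constants D) x) x
  rw [minpoly.aeval, map_zero] at h
  have hs := (minpoly.irreducible hx).separable.aeval_derivative_ne_zero (minpoly.aeval _ x)
  exact (smul_eq_zero.mp h.symm).resolve_left hs

end ProjVariety

/-! ### Gradients and tangent spaces -/

/-- The vector of partial derivatives of a polynomial at a point. -/
noncomputable def gradientAt {n : ℕ} (v : Fin (n + 1) → ℂ) (f : PolyRing n) : Fin (n + 1) → ℂ :=
  fun i => eval v (pderiv i f)

section Gradient

variable {n : ℕ} (v : Fin (n + 1) → ℂ)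

theorem gradientAt_add (f g : PolyRing n) :
    gradientAt v (f + g) = gradientAt v f + gradientAt v g := by
  ext i; simp [gradientAt]

theorem gradientAt_mul (f g : PolyRing n) :
    gradientAt v (f * g) = eval v f • gradientAt v g + eval v g • gradientAt v f := by
  ext i; simp [gradientAt]

theorem gradientAt_C (c : ℂ) : gradientAt v (C c : PolyRing n) = 0 := by
  ext i; simp [gradientAt]

end Gradient

theorem MvPolynomial.isHomogeneous_det {k σ m : Type*} [CommRing k] [Fintype m] [DecidableEq m]
    {A : Matrix m m (MvPolynomial σ k)} {d : m → ℕ} (h : ∀ r i, (A r i).IsHomogeneous (d r)) :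
    A.det.IsHomogeneous (∑ r, d r) := by
  rw [Matrix.det_apply']
  refine IsHomogeneous.sum _ _ _ fun s _ => ?_
  have h1 := IsHomogeneous.prod Finset.univ (fun r => A (s r) r) (fun r => d (s r))
    fun r _ => h (s r) r
  rw [Equiv.sum_comp s d] at h1
  have h2 := (isHomogeneous_C σ (((Equiv.Perm.sign s : ℤˣ) : ℤ) : k)).mul h1
  simpa using h2

theorem isHomogeneous_jacobian {f : Fin 3 → PolyRing 4}
    (hd : ∀ r : Fin 3, (f r).IsHomogeneous (r + 1)) {y z : PolyRing 4} (hy : y.IsHomogeneous 1)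
    (hz : z.IsHomogeneous 1) : (Matrix.of fun r i => pderiv i (![f 0, f 1, f 2, y, z] r) :
      Matrix (Fin 5) (Fin 5) (PolyRing 4)).det.IsHomogeneous 3 := by
  have h := isHomogeneous_det (A := Matrix.of fun r i => pderiv i (![f 0, f 1, f 2, y, z] r))
    (d := ![0, 1, 2, 0, 0]) (by
      intro r i
      fin_cases r
      · exact (hd 0).pderiv
      · exact (hd 1).pderiv
      · exact (hd 2).pderiv
      · exact hy.pderiv
      · exact hz.pderiv)
  exact h

namespace ClosedSubscheme

variable {n : ℕ} {X : ClosedSubscheme n} {p : ℙ ℂ (Fin (n + 1) → ℂ)}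

/-- By the Leibniz rule, the gradient of a multiple of `g` at a point where `g` vanishes is a
multiple of the gradient of `g`. -/
theorem mem_coneTangentSpace_iff {ι : Type*} {f : ι → PolyRing n}
    (hf : X.ideal = Ideal.span (Set.range f)) (hp : p ∈ X.points) {w : Fin (n + 1) → ℂ} :
    w ∈ X.coneTangentSpace p ↔ ∀ r, ∑ i, gradientAt p.rep (f r) i * w i = 0 := by
  refine ⟨fun h r => h (f r) (hf ▸ Ideal.subset_span ⟨r, rfl⟩), fun h g hg => ?_⟩
  have hsum : ∀ g h, (∑ i, gradientAt p.rep (g + h) i * w i) =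
      (∑ i, gradientAt p.rep g i * w i) + ∑ i, gradientAt p.rep h i * w i := fun g h => by
    simp only [gradientAt_add, Pi.add_apply, add_mul, Finset.sum_add_distrib]
  change ∑ i, gradientAt p.rep g i * w i = 0
  have hg' := hg
  rw [hf] at hg
  induction hg using Submodule.span_induction with
  | mem g hg => obtain ⟨r, rfl⟩ := hg; exact h r
  | zero => simp [gradientAt]
  | add a b ha hb iha ihb => rw [hsum, iha (hf ▸ ha), ihb (hf ▸ hb), add_zero]
  | smul a g hg ih =>
    have h1 := ih (hf ▸ hg)
    have h2 : eval p.rep g = 0 := hp g (hf ▸ hg)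
    simp only [smul_eq_mul, gradientAt_mul, h2, zero_smul, add_zero, Pi.smul_apply, smul_eq_mul,
      mul_assoc, ← Finset.mul_sum, h1, mul_zero]

theorem finrank_coneTangentSpace_add {ι : Type*} [Fintype ι] {f : ι → PolyRing n}
    (hf : X.ideal = Ideal.span (Set.range f)) (hp : p ∈ X.points) :
    Module.finrank ℂ (X.coneTangentSpace p) +
      Module.finrank ℂ (Submodule.span ℂ (Set.range fun r => gradientAt p.rep (f r))) = n + 1 := by
  let A : Matrix ι (Fin (n + 1)) ℂ := Matrix.of fun r => gradientAt p.rep (f r)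
  have h1 : X.coneTangentSpace p = LinearMap.ker A.mulVecLin := by
    ext w
    rw [mem_coneTangentSpace_iff hf hp, LinearMap.mem_ker, funext_iff]
    rfl
  have h2 : Module.finrank ℂ (Submodule.span ℂ (Set.range fun r => gradientAt p.rep (f r))) =
      A.rank :=
    A.rank_eq_finrank_span_row.symm
  have h3 := LinearMap.finrank_range_add_finrank_ker A.mulVecLin
  rw [h1, h2, Matrix.rank, add_comm, h3]
  simp

theorem notMem_singularLocus_iff {r d : ℕ} (hd : X.HasDim d) (hr : r + (d + 1) = n + 1)
    {f : Fin r → PolyRing n}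
    (hf : X.ideal = Ideal.span (Set.range f)) (hp : p ∈ X.points) :
    p ∉ X.singularLocus ↔ LinearIndependent ℂ fun r => gradientAt p.rep (f r) := by
  have h := finrank_coneTangentSpace_add hf hp
  rw [linearIndependent_iff_card_eq_finrank_span, Fintype.card_fin, Set.finrank]
  have h1 : p ∉ X.singularLocus ↔ Module.finrank ℂ (X.coneTangentSpace p) = d + 1 := by
    change ¬ (p ∈ X.points ∧ _ ≠ _) ↔ _
    rw [show ringKrullDim (PolyRing n ⧸ X.ideal) = ((d + 1 : ℕ) : WithBot ℕ∞) from hd]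
    simp only [hp, true_and, not_not, ne_eq]
    norm_cast
  rw [h1]
  omega

end ClosedSubscheme

/-! ### Canonical curves of genus four -/

namespace ProjVariety

variable {n : ℕ} {V : ProjVariety n}

theorem sum_form_pderiv_eq_zero {ι : Type*} {f : ι → PolyRing n}
    (hf : V.ideal = Ideal.span (Set.range f)) {w : Fin (n + 1) → V.K}
    (h : ∀ r, ∑ i, V.form (pderiv i (f r)) * w i = 0) (g : PolyRing n) (hg : g ∈ V.ideal) :
    ∑ i, V.form (pderiv i g) * w i = 0 := by
  rw [hf] at hg
  induction hg using Submodule.span_induction with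
  | mem g hg => obtain ⟨r, rfl⟩ := hg; exact h r
  | zero => simp [form_zero]
  | add a b ha hb iha ihb =>
    simp only [map_add, form_add, add_mul, Finset.sum_add_distrib, iha, ihb, add_zero]
  | smul a g hg ih =>
    have h2 : V.form g = 0 := V.form_eq_zero.mpr (hf ▸ hg)
    simp only [smul_eq_mul, Derivation.leibniz, form_add, form_mul, h2, zero_mul, add_zero,
      mul_assoc, ← Finset.mul_sum, ih, mul_zero]

section Canonical

variable (hK : V.CanonicalSheafIsTwist 1) (h1 : V.H0 1 ≤ V.forms 1) (hg : V.arithmeticGenus = 4)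
  {i₀ : V.Chart} {z : PolyRing n} (hz : z.IsHomogeneous 1) {N : ℕ}
  (hx : ∀ i : V.Chart, ∃ a b : PolyRing n, a.IsHomogeneous N ∧ b.IsHomogeneous N ∧
    V.coord i.1 ^ (N + 1) = V.coord i₀.1 * V.form a + V.form z * V.form b)
include hK h1 hg hz hx

theorem exists_coord_mul_eq_add {s : V.K} (hs : s ∈ V.H0 (3 : ℕ)) (j : Fin (n + 1)) :
    ∃ u ∈ V.H0 (3 : ℕ), ∃ t ∈ V.H0 (3 : ℕ),
      V.coord j * s = V.coord i₀.1 * u + V.form z * t := by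
  have h := coord_mul_mem_H0 j hs
  rw [show ((3 : ℕ) : ℤ) + 1 = ((0 + 4 : ℕ) : ℤ) by norm_num] at h
  exact exists_eq_add_of_mem_H0 hK h1 hg hz hx (m := 0) h

/-- The constants of `D` form a field containing `y` and `z`. As `x_j H⁰(3) ⊆ y H⁰(3) + z H⁰(3)`,
the span of `H⁰(3)` over the constants is a finitely generated nonzero module stable under `x_j`,
and the determinant trick makes `x_j` integral over the constants. -/
theorem derivation_coord_eq_zero {D : Derivation ℂ V.K V.K} (hy : D (V.coord i₀.1) = 0)
    (hDz : D (V.form z) = 0) (j : Fin (n + 1)) : D (V.coord j) = 0 := by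
  apply derivation_eq_zero_of_isIntegral
  have hfin : Module.Finite ℂ (V.H0 (3 : ℕ)) := finite_H0_nat hK h1 hg hz hx 3
  obtain ⟨S, hS⟩ := Module.Finite.iff_fg.mp hfin
  have hN : Submodule.span (constants D) (V.H0 (3 : ℕ) : Set V.K) =
        Submodule.span (constants D) S := by
    rw [← hS, Submodule.span_span_of_tower]
  have hne : Submodule.span (constants D) (V.H0 (3 : ℕ) : Set V.K) ≠ ⊥ := by
    rw [Submodule.ne_bot_iff]
    refine ⟨V.form (X i₀.1 ^ 3), Submodule.subset_span
      (form_mem_H0 (isHomogeneous_X_pow (R := ℂ) i₀.1 3) rfl), ?_⟩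
    rw [form_pow]
    exact pow_ne_zero _ (V.coord_ne_zero i₀)
  have hsmul : ∀ x, D x = 0 → ∀ s ∈ Submodule.span (constants D) (V.H0 (3 : ℕ) : Set V.K),
      x * s ∈ Submodule.span (constants D) (V.H0 (3 : ℕ) : Set V.K) :=
    fun x hx s hs => Submodule.smul_mem _ (⟨x, hx⟩ : constants D) hs
  have hmul : ∀ s ∈ Submodule.span (constants D) (V.H0 (3 : ℕ) : Set V.K),
      V.coord j * s ∈ Submodule.span (constants D) (V.H0 (3 : ℕ) : Set V.K) := by
    intro s hs
    induction hs using Submodule.span_induction with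
    | mem s hs =>
      obtain ⟨u, hu, t, ht, h⟩ := exists_coord_mul_eq_add hK h1 hg hz hx hs j
      rw [h]
      exact add_mem (hsmul _ hy _ (Submodule.subset_span hu))
        (hsmul _ hDz _ (Submodule.subset_span ht))
    | zero => rw [mul_zero]; exact zero_mem _
    | add a b _ _ ha hb => rw [mul_add]; exact add_mem ha hb
    | smul c a _ ha =>
      have h : V.coord j * (c • a) = c.1 * (V.coord j * a) := mul_left_comm _ _ _
      exact h ▸ hsmul _ c.2 _ ha
  exact isIntegral_of_smul_mem_submodule (R := constants D) (A := V.K) (M := V.K) _ hne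
    ⟨S, hN.symm⟩ _ hmul

end Canonical

/-! ### Finiteness of the singular locus -/

section Jacobian

variable {V : ProjVariety 4}
  (hK : V.CanonicalSheafIsTwist 1) (h1 : V.H0 1 ≤ V.forms 1) (hg : V.arithmeticGenus = 4)
  {i₀ : V.Chart} {z : PolyRing 4} (hz : z.IsHomogeneous 1) {N : ℕ}
  (hx : ∀ i : V.Chart, ∃ a b : PolyRing 4, a.IsHomogeneous N ∧ b.IsHomogeneous N ∧
    V.coord i.1 ^ (N + 1) = V.coord i₀.1 * V.form a + V.form z * V.form b)
include hK h1 hg hz hx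

/-- A kernel vector of the Jacobian matrix over the function field defines a derivation that kills
`y` and `z`. It kills every coordinate, so the vector is zero. -/
theorem jacobian_notMem {f : Fin 3 → PolyRing 4} (hf : V.ideal = Ideal.span (Set.range f)) :
    (Matrix.of fun r i => pderiv i (![f 0, f 1, f 2, X i₀.1, z] r) :
      Matrix (Fin 5) (Fin 5) (PolyRing 4)).det ∉ V.ideal := by
  intro hdet
  rw [← V.form_eq_zero, ← V.formHom_apply, AlgHom.map_det,
      ← Matrix.exists_mulVec_eq_zero_iff] at hdet
  obtain ⟨w, hw0, hw⟩ := hdet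
  have hw' : ∀ r, ∑ i, V.form (pderiv i (![f 0, f 1, f 2, X i₀.1, z] r)) * w i = 0 :=
    fun r => congrFun hw r
  obtain ⟨D, hD⟩ := exists_derivation w (sum_form_pderiv_eq_zero hf fun r => by
    fin_cases r
    · exact hw' 0
    · exact hw' 1
    · exact hw' 2)
  apply hw0
  ext j
  have hj := derivation_coord_eq_zero hK h1 hg hz hx (D := D) ((hD _).trans (hw' 3))
    ((hD _).trans (hw' 4)) j
  rw [coord, hD, Finset.sum_eq_single j, pderiv_X_self, form_one, one_mul] at hj
  · exact hj
  · intro i _ hij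
    rw [pderiv_X_of_ne (Ne.symm hij), form_zero, zero_mul]
  · simp

/-- The determinant vanishes at singular points by the Jacobian criterion but not on the whole
curve. Hence singular points give minimal primes over a proper closed subset, which are finite in
number. -/
theorem finite_singularLocus (hV : V.IsCurve) {f : Fin 3 → PolyRing 4}
    (hd : ∀ r : Fin 3, (f r).IsHomogeneous (r + 1)) (hf : V.ideal = Ideal.span (Set.range f)) :
    V.singularLocus.Finite := by
  have hdet := jacobian_notMem hK h1 hg hz hx hf
  have hhom := isHomogeneous_jacobian hd (isHomogeneous_X ℂ i₀.1) hz
  set M : Matrix (Fin 5) (Fin 5) (PolyRing 4) :=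
    Matrix.of fun r i => pderiv i (![f 0, f 1, f 2, X i₀.1, z] r)
  have hsing : ∀ p ∈ V.singularLocus, eval p.rep M.det = 0 := by
    intro p hp
    by_contra h
    refine (ClosedSubscheme.notMem_singularLocus_iff hV (by norm_num) hf hp.1).mpr ?_ hp
    rw [RingHom.map_det] at h
    have h2 := Matrix.linearIndependent_rows_iff_isUnit.mpr
      ((Matrix.isUnit_iff_isUnit_det _).mpr (IsUnit.mk0 _ h))
    have h3 := h2.comp (Fin.castLE (by norm_num : 3 ≤ 5)) (Fin.castLE_injective _)
    convert! h3 using 1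
    ext r i
    fin_cases r <;> rfl
  have hfin := (V.ideal ⊔ Ideal.span {M.det}).finite_minimalPrimes_of_isNoetherianRing
  refine Set.Finite.of_finite_image (f := fun p => pointIdeal p.rep) (hfin.subset ?_) ?_
  · rintro _ ⟨p, hp, rfl⟩
    refine pointIdeal_mem_minimalPrimes hV hdet p.rep_nonzero (sup_le ?_ ?_)
    · exact IsHomogIdeal.le_pointIdeal V.homogeneous hp.1
    · rw [Ideal.span_singleton_le_iff_mem, mem_pointIdeal hhom]
      exact hsing p hp
  · intro p _ p' _ h
    obtain ⟨c, hc⟩ := exists_smul_of_pointIdeal_le p.rep_nonzero (le_of_eq h)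
    rw [← p.mk_rep, ← p'.mk_rep, Projectivization.mk_eq_mk_iff']
    obtain ⟨c, hc⟩ := exists_smul_of_pointIdeal_le p'.rep_nonzero (le_of_eq h.symm)
    exact ⟨c, hc.symm⟩

end Jacobian

end ProjVariety

/-- `V` is the projectively normal complete intersection in `ℙ⁴` of the hyperplane `l = 0`, the
quadric `q = 0` and the cubic `c = 0`. -/
structure CanonicalEquations (V : ProjVariety 4) (l q c : PolyRing 4) : Prop where
  hl : l.IsHomogeneous 1
  hq : q.IsHomogeneous 2
  hc : c.IsHomogeneous 3
  l_ne_zero : l ≠ 0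
  q_notMem : q ∉ Ideal.span {l}
  c_notMem : c ∉ Ideal.span {l} ⊔ Ideal.span {q}
  isPrime : (Ideal.span {l} ⊔ Ideal.span {q}).IsPrime
  ideal_eq : V.ideal = Ideal.span {l} ⊔ Ideal.span {q} ⊔ Ideal.span {c}
  H0_le_forms : ∀ m : ℕ, V.H0 m ≤ V.forms m

theorem ProjVariety.canonicalEquations {l : PolyRing 4} (hl : l.IsHomogeneous 1) (h0 : l ≠ 0)
    {C : ProjVariety 4} (hC : C.IsCurve) (hg : C.arithmeticGenus = 4)
    (hcan : C.IsCanonicallyEmbeddedIn (ClosedSubscheme.hypersurface l)) {Q : ClosedSubscheme 4}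
    (hQ : Q.IsQuadricIn (ClosedSubscheme.hypersurface l)) (hCQ : C.IsContainedIn Q) :
    C.singularLocus.Finite ∧ ∃ q c, CanonicalEquations C l q c := by
  obtain ⟨hCH, hK, hlin, h1⟩ := hcan
  obtain ⟨q, hq, hqH, rfl⟩ := hQ
  rw [ClosedSubscheme.hypersurface_linear_ideal hl h0] at hlin hqH
  have hlC : l ∈ C.ideal := hCH (ClosedSubscheme.mem_hypersurface l)
  have hqC : q ∈ C.ideal := hCQ (ClosedSubscheme.ideal_le_inter_right _ _
    (ClosedSubscheme.mem_hypersurface q))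
  have h1' : C.H0 1 ≤ C.forms 1 := fun s hs => by
    obtain ⟨l, hl, rfl⟩ := h1 s hs
    exact ProjVariety.mem_forms.mpr ⟨l, hl, rfl⟩
  obtain ⟨i₀⟩ := ProjVariety.nonempty_chart (V := C) (by rw [hg]; norm_num)
  -- A linear form `z` without common zero with `y = x_{i₀}` on the curve; the identity below spells
  -- this out on each chart.
  obtain ⟨z, hz, N, hN⟩ := exists_linear_disjoint C.homogeneous hC (isHomogeneous_X ℂ i₀.1) i₀.2
  have hx : ∀ i : C.Chart, ∃ a b : PolyRing 4, a.IsHomogeneous N ∧ b.IsHomogeneous N ∧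
      C.coord i.1 ^ (N + 1) = C.coord i₀.1 * C.form a + C.form z * C.form b := by
    intro i
    have hi : (X i.1 : PolyRing 4) ^ (N + 1) ∈ C.ideal ⊔ Ideal.span {X i₀.1} ⊔ Ideal.span {z} := by
      rw [pow_succ]
      exact Ideal.mul_mem_right _ _ (hN i.1)
    have hIy : IsHomogIdeal (C.ideal ⊔ Ideal.span {X i₀.1}) :=
      IsHomogIdeal.sup C.homogeneous (isHomogIdeal_span_singleton (isHomogeneous_X ℂ i₀.1))
    obtain ⟨b, hb, h⟩ := hIy.exists_of_mem_sup_span (isHomogeneous_X_pow _ _) hz hi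
    obtain ⟨a, ha, h⟩ := IsHomogIdeal.exists_of_mem_sup_span C.homogeneous
      ((isHomogeneous_X_pow _ _).sub (hb.mul hz)) (isHomogeneous_X ℂ i₀.1) h
    refine ⟨a, b, ha, hb, ?_⟩
    rw [← C.form_eq_zero, ProjVariety.form_sub, ProjVariety.form_sub, ProjVariety.form_mul,
      ProjVariety.form_mul, ProjVariety.form_pow] at h
    rw [ProjVariety.coord, ProjVariety.coord]
    linear_combination h
  obtain ⟨c, hc, hclq, hI⟩ := ProjVariety.exists_cubic hK h1' hg hz hx hl h0 hlC hlin hq hqC hqH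
  refine ⟨?_, q, c, hl, hq, hc, h0, hqH, hclq,
    isPrime_span_linear_sup_span_quadric C.prime hl h0 hlC hlin hq hqC hqH, hI,
    ProjVariety.H0_le_forms hK h1' hg hz hx hl h0 hlC hlin hq hqC hqH⟩
  refine ProjVariety.finite_singularLocus hK h1' hg hz hx hC (f := ![l, q, c]) ?_ ?_
  · intro r
    fin_cases r
    · exact hl
    · exact hq
    · exact hc
  · rw [hI, Matrix.range_cons, Matrix.range_cons, Matrix.range_cons, Matrix.range_empty,
      Set.union_empty, Ideal.span_union, Ideal.span_union, sup_assoc]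

/-! ### Common equations of two canonical curves -/

namespace CanonicalEquations

variable {V V' : ProjVariety 4} {l q c l' q' c' : PolyRing 4}

theorem span_range (h : CanonicalEquations V l q c) :
    V.ideal = Ideal.span (Set.range ![l, q, c]) := by
  rw [h.ideal_eq, Matrix.range_cons, Matrix.range_cons, Matrix.range_cons, Matrix.range_empty,
    Set.union_empty, Ideal.span_union, Ideal.span_union, sup_assoc]

theorem isHomogIdeal (h : CanonicalEquations V l q c) :
    IsHomogIdeal (Ideal.span {l} ⊔ Ideal.span {q}) := isHomogIdeal_linear_sup_quadric h.hl h.hq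

theorem l_mem (h : CanonicalEquations V l q c) : l ∈ V.ideal :=
  h.ideal_eq ▸ Ideal.mem_sup_left (Ideal.mem_sup_left (Ideal.mem_span_singleton_self l))

theorem q_mem (h : CanonicalEquations V l q c) : q ∈ V.ideal :=
  h.ideal_eq ▸ Ideal.mem_sup_left (Ideal.mem_sup_right (Ideal.mem_span_singleton_self q))

theorem c_mem (h : CanonicalEquations V l q c) : c ∈ V.ideal :=
  h.ideal_eq ▸ Ideal.mem_sup_right (Ideal.mem_span_singleton_self c)

theorem mem_of_quadric (h : CanonicalEquations V l q c) {f : PolyRing 4} (hf : f.IsHomogeneous 2)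
    (hfV : f ∈ V.ideal) : f ∈ Ideal.span {l} ⊔ Ideal.span {q} :=
  h.isHomogIdeal.mem_of_mem_sup_span_of_lt hf h.hc (by norm_num) (h.ideal_eq ▸ hfV)

theorem mem_of_linear (h : CanonicalEquations V l q c) {f : PolyRing 4} (hf : f.IsHomogeneous 1)
    (hfV : f ∈ V.ideal) : f ∈ Ideal.span {l} :=
  (isHomogIdeal_span_singleton h.hl).mem_of_mem_sup_span_of_lt hf h.hq (by norm_num)
    (h.isHomogIdeal.mem_of_mem_sup_span_of_lt hf h.hc (by norm_num) (h.ideal_eq ▸ hfV))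

/-- A hypersurface section of a projectively normal variety by a hyperplane is saturated in
positive degrees. -/
theorem exists_sub_mul_mem (h : CanonicalEquations V l q c) (hl' : l'.IsHomogeneous 1)
    (hlV : l' ∉ V.ideal) {f : PolyRing 4} {m : ℕ} (hf : f.IsHomogeneous (m + 1))
    (hfV : f ∈ (V.inter (ClosedSubscheme.hypersurface l')).ideal) :
    ∃ a : PolyRing 4, a.IsHomogeneous m ∧ f - a * l' ∈ V.ideal := by
  have hl0 : V.form l' ≠ 0 := fun h => hlV (V.form_eq_zero.mp h)
  obtain ⟨N, hN⟩ := ClosedSubscheme.exists_of_mem_inter hfV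
  rw [ClosedSubscheme.hypersurface_linear_ideal hl' (fun h => hlV (h ▸ zero_mem _))] at hN
  -- On the chart of `x_i` the relation `x_i ^ N f ≡ b l'` writes the quotient as `b / x_i ^ N`.
  -- Being a global section, the quotient is given by a form.
  have hs : V.form f / V.form l' ∈ V.H0 m := by
    rw [ProjVariety.mem_H0]
    intro i
    have hhom : (X i.1 ^ N * f).IsHomogeneous (N + m + 1) := (isHomogeneous_X_pow i.1 N).mul hf
    obtain ⟨b, hb, hbV⟩ := IsHomogIdeal.exists_of_mem_sup_span V.homogeneous hhom hl' (hN i.1)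
    rw [ProjVariety.mem_sections_one]
    refine ⟨N, N + m, b, hb, by push_cast; ring, ?_⟩
    rw [← V.form_eq_form, ProjVariety.form_mul, ProjVariety.form_mul, ProjVariety.form_pow] at hbV
    rw [div_mul_eq_mul_div, div_eq_iff hl0, ← hbV, ProjVariety.coord, mul_comm]
  obtain ⟨a, ha, has⟩ := ProjVariety.mem_forms.mp (h.H0_le_forms m hs)
  refine ⟨a, ha, ?_⟩
  rw [← V.form_eq_form, ProjVariety.form_mul, has, div_mul_cancel₀ _ hl0]

theorem span_sup_span_eq_of_sub_mem {R : Type*} [CommRing R] {I : Ideal R} {a b : R} {u : Rˣ}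
    (h : a - u * b ∈ I) : I ⊔ Ideal.span {a} = I ⊔ Ideal.span {b} := by
  have ha := Ideal.mem_span_singleton_self a
  have hb := Ideal.mem_span_singleton_self b
  refine le_antisymm (sup_le le_sup_left ?_) (sup_le le_sup_left ?_)
  · rw [Ideal.span_singleton_le_iff_mem, show a = (a - u * b) + u * b by ring]
    exact Submodule.add_mem_sup h (Ideal.mul_mem_left _ _ hb)
  · rw [Ideal.span_singleton_le_iff_mem,
      show b = ((-(↑u⁻¹ : R)) * (a - u * b)) + ↑u⁻¹ * a by
        linear_combination (-b) * u.inv_mul]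
    exact Submodule.add_mem_sup (Ideal.mul_mem_left _ _ h) (Ideal.mul_mem_left _ _ ha)

/-- The quadric may be replaced. -/
theorem replace_quadric (h : CanonicalEquations V l q c) {g : PolyRing 4} (hg : g.IsHomogeneous 2)
    (hgV : g ∈ V.ideal) (hgl : g ∉ Ideal.span {l}) : CanonicalEquations V l g c := by
  obtain ⟨a, ha, hga⟩ := (isHomogIdeal_span_singleton h.hl).exists_of_mem_sup_span (d := 0)
    hg h.hq (h.mem_of_quadric hg hgV)
  obtain ⟨a, rfl⟩ := homogeneous_eq_C ha
  have ha0 : a ≠ 0 := by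
    rintro rfl
    rw [C_0, zero_mul, sub_zero] at hga
    exact hgl hga
  have e := span_sup_span_eq_of_sub_mem
        (u := (Units.mk0 a ha0).map (C (σ := Fin 5)).toMonoidHom) hga
  exact ⟨h.hl, hg, h.hc, h.l_ne_zero, hgl, e ▸ h.c_notMem, e ▸ h.isPrime, e ▸ h.ideal_eq,
    h.H0_le_forms⟩

/-- The cubic may be replaced. -/
theorem replace_cubic (h : CanonicalEquations V l q c) {f : PolyRing 4} (hf : f.IsHomogeneous 3)
    (hfV : f ∈ V.ideal) (hfl : f ∉ Ideal.span {l} ⊔ Ideal.span {q}) :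
    CanonicalEquations V l q f := by
  obtain ⟨a, ha, hfa⟩ := h.isHomogIdeal.exists_of_mem_sup_span (d := 0) hf h.hc (h.ideal_eq ▸ hfV)
  obtain ⟨a, rfl⟩ := homogeneous_eq_C ha
  have ha0 : a ≠ 0 := by
    rintro rfl
    rw [C_0, zero_mul, sub_zero] at hfa
    exact hfl hfa
  have e := span_sup_span_eq_of_sub_mem
        (u := (Units.mk0 a ha0).map (C (σ := Fin 5)).toMonoidHom) hfa
  exact ⟨h.hl, h.hq, hf, h.l_ne_zero, h.q_notMem, hfl, h.isPrime, e ▸ h.ideal_eq, h.H0_le_forms⟩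

/-- Two canonical curves with the same intersection with the plane `l = l' = 0` are hyperplane
sections of the intersection of a quadric and a cubic. -/
theorem exists_common (h : CanonicalEquations V l q c) (h' : CanonicalEquations V' l' q' c')
    (hll' : l ∉ Ideal.span {l'}) (hl'l : l' ∉ Ideal.span {l})
    (hV : V'.ideal ≤ (V.inter (ClosedSubscheme.hypersurface l')).ideal) :
    ∃ g f, CanonicalEquations V l g f ∧ CanonicalEquations V' l' g f := by
  have hlV' : l ∉ V'.ideal := fun hl => hll' (h'.mem_of_linear h.hl hl)
  have hl'V : l' ∉ V.ideal := fun hl => hl'l (h.mem_of_linear h'.hl hl)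
  have hp := isPrime_span_linear h.hl h.l_ne_zero
  have hp' := isPrime_span_linear h'.hl h'.l_ne_zero
  have hl'mem := Ideal.mem_span_singleton_self l'
  -- The equations of `V'` vanish on `V ∩ {l' = 0}`. Subtracting multiples of `l'` makes them vanish
  -- on `V`, and they continue to vanish on `V'`.
  obtain ⟨a, ha, haV⟩ := h.exists_sub_mul_mem h'.hl hl'V (m := 1) h'.hq (hV h'.q_mem)
  obtain ⟨b, hb, hbV⟩ := h.exists_sub_mul_mem h'.hl hl'V (m := 2) h'.hc (hV h'.c_mem)
  have hg : (q' - a * l').IsHomogeneous 2 := h'.hq.sub (ha.mul h'.hl)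
  have hf : (c' - b * l').IsHomogeneous 3 := h'.hc.sub (hb.mul h'.hl)
  have hgV' : q' - a * l' ∈ V'.ideal := V'.ideal.sub_mem h'.q_mem (V'.ideal.mul_mem_left _ h'.l_mem)
  have hfV' : c' - b * l' ∈ V'.ideal := V'.ideal.sub_mem h'.c_mem (V'.ideal.mul_mem_left _ h'.l_mem)
  set g := q' - a * l' with hgdef
  set f := c' - b * l' with hfdef
  have hgl' : g ∉ Ideal.span {l'} := fun hgl => h'.q_notMem (by
    rw [show q' = g + a * l' by ring]
    exact Ideal.add_mem _ hgl (Ideal.mul_mem_left _ _ hl'mem))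
  have h1' := h'.replace_quadric hg hgV' hgl'
  have hfl' : f ∉ Ideal.span {l'} ⊔ Ideal.span {g} := fun hfl => h1'.c_notMem (by
    rw [show c' = f + b * l' by ring]
    exact Ideal.add_mem _ hfl (Ideal.mul_mem_left _ _ (Ideal.mem_sup_left hl'mem)))
  -- If `g = m l`, then `m` vanishes on the integral curve `V'`, where `l` does not; so `m`, and
  -- with it `g`, would be a multiple of `l'`.
  have hgl : g ∉ Ideal.span {l} := fun hgl => by
    obtain ⟨m, hm, hgm⟩ := isHomogIdeal_bot.exists_of_mem_sup_span (d := 1) hg h.hl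
      (by rwa [bot_sup_eq])
    rw [Ideal.mem_bot, sub_eq_zero] at hgm
    have hmV : m ∈ V'.ideal := (V'.prime.mem_or_mem (hgm ▸ hgV')).resolve_right hlV'
    exact hgl' (hgm ▸ Ideal.mul_mem_right _ _ (h'.mem_of_linear hm hmV))
  have h1 := h.replace_quadric hg haV hgl
  -- Likewise, `f ≡ m l` modulo `g` would make `m` a quadric through `V'`, hence an element of `(l',
  -- g)`, and then `f` as well.
  have hfl : f ∉ Ideal.span {l} ⊔ Ideal.span {g} := fun hfl => by
    rw [sup_comm] at hfl
    obtain ⟨m, hm, hfm⟩ := (isHomogIdeal_span_singleton hg).exists_of_mem_sup_span (d := 2) hf h.hl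
      hfl
    have hle : Ideal.span {g} ≤ V'.ideal := (Ideal.span_singleton_le_iff_mem _).mpr hgV'
    have hmlV : m * l ∈ V'.ideal := by
      rw [show m * l = f - (f - m * l) by ring]
      exact V'.ideal.sub_mem hfV' (hle hfm)
    have hmV := h1'.mem_of_quadric hm ((V'.prime.mem_or_mem hmlV).resolve_right hlV')
    apply hfl'
    rw [show f = m * l + (f - m * l) by ring]
    exact Ideal.add_mem _ (Ideal.mul_mem_right _ _ hmV) (Ideal.mem_sup_right hfm)
  exact ⟨g, f, h1.replace_cubic hf hbV hfl, h1'.replace_cubic hf hfV' hfl'⟩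

end CanonicalEquations

/-! ### Surfaces of degree six in `ℙ⁴` -/

theorem ringKrullDim_quotient_sup_span_succ_le {R : Type*} [CommRing R] {I : Ideal R} {a : R}
    (h : ∀ b, b * a ∈ I → b ∈ I) :
    ringKrullDim (R ⧸ (I ⊔ Ideal.span {a})) + 1 ≤ ringKrullDim (R ⧸ I) := by
  refine ringKrullDim_succ_le_of_surjective (r := Ideal.Quotient.mk I a)
    (Ideal.Quotient.factor le_sup_left) (Ideal.Quotient.factor_surjective _) ?_ ?_
  · rw [mem_nonZeroDivisors_iff_right]
    intro x hx
    obtain ⟨b, rfl⟩ := Ideal.Quotient.mk_surjective x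
    rw [← map_mul, Ideal.Quotient.eq_zero_iff_mem] at hx
    exact Ideal.Quotient.eq_zero_iff_mem.mpr (h b hx)
  · rw [Ideal.Quotient.factor_mk]
    exact Ideal.Quotient.eq_zero_iff_mem.mpr (Ideal.mem_sup_right (Ideal.mem_span_singleton_self a))

namespace CanonicalEquations

variable {V : ProjVariety 4} {l g f : PolyRing 4} (h : CanonicalEquations V l g f)
include h

theorem g_ne_zero : g ≠ 0 := fun h0 => h.q_notMem (h0 ▸ zero_mem _)

theorem f_ne_zero : f ≠ 0 := fun h0 => h.c_notMem (h0 ▸ zero_mem _)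

theorem isPrime_span_l : (Ideal.span {l}).IsPrime := isPrime_span_linear h.hl h.l_ne_zero

theorem isPrime_span_g : (Ideal.span {g}).IsPrime := by
  refine isPrime_of_isPrime_sup_span (isHomogIdeal_span_singleton h.hq) h.hl ?_
    (sup_comm (Ideal.span {l}) _ ▸ h.isPrime)
  intro a ha
  obtain ⟨b, hb⟩ := Ideal.mem_span_singleton'.mp ha
  have hbl : b ∈ Ideal.span {l} := by
    refine (h.isPrime_span_l.mem_or_mem (y := g) ?_).resolve_right h.q_notMem
    rw [hb]
    exact Ideal.mul_mem_left _ _ (Ideal.mem_span_singleton_self l)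
  obtain ⟨b, rfl⟩ := Ideal.mem_span_singleton'.mp hbl
  rw [Ideal.mem_span_singleton']
  exact ⟨b, mul_right_cancel₀ h.l_ne_zero (by linear_combination hb)⟩

theorem f_notMem_span_g : f ∉ Ideal.span {g} := fun hf => h.c_notMem (Ideal.mem_sup_right hf)

/-- This permutes the regular sequence `l, g, f`. From `a l = b g + c f` follows `c = u l + v g`;
then `(b + v f) g` is divisible by `l`, so `b + v f = d l`, and `a = d g + u f`. -/
theorem mem_of_mul_l_mem {a : PolyRing 4} (ha : a * l ∈ Ideal.span {g} ⊔ Ideal.span {f}) :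
    a ∈ Ideal.span {g} ⊔ Ideal.span {f} := by
  obtain ⟨_, hb, _, hc, hbc⟩ := Submodule.mem_sup.mp ha
  obtain ⟨b, rfl⟩ := Ideal.mem_span_singleton'.mp hb
  obtain ⟨c, rfl⟩ := Ideal.mem_span_singleton'.mp hc
  have hcf : c ∈ Ideal.span {l} ⊔ Ideal.span {g} := by
    refine (h.isPrime.mem_or_mem (y := f) ?_).resolve_right h.c_notMem
    rw [show c * f = a * l + -b * g by linear_combination hbc]
    exact Submodule.add_mem_sup (Ideal.mul_mem_left _ _ (Ideal.mem_span_singleton_self l))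
      (Ideal.mul_mem_left _ _ (Ideal.mem_span_singleton_self g))
  obtain ⟨_, hu, _, hv, huv⟩ := Submodule.mem_sup.mp hcf
  obtain ⟨u, rfl⟩ := Ideal.mem_span_singleton'.mp hu
  obtain ⟨v, rfl⟩ := Ideal.mem_span_singleton'.mp hv
  have hd : (b + v * f) ∈ Ideal.span {l} := by
    refine (h.isPrime_span_l.mem_or_mem (y := g) ?_).resolve_right h.q_notMem
    rw [Ideal.mem_span_singleton']
    exact ⟨a - u * f, by linear_combination -hbc - f * huv⟩
  obtain ⟨d, hd⟩ := Ideal.mem_span_singleton'.mp hd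
  have : a = d * g + u * f :=
    mul_right_cancel₀ h.l_ne_zero (by linear_combination -hbc - g * hd - f * huv)
  rw [this]
  exact Submodule.add_mem_sup (Ideal.mul_mem_left _ _ (Ideal.mem_span_singleton_self g))
    (Ideal.mul_mem_left _ _ (Ideal.mem_span_singleton_self f))

theorem sup_eq : Ideal.span {g} ⊔ Ideal.span {f} ⊔ Ideal.span {l} = V.ideal := by
  rw [h.ideal_eq, sup_comm, ← sup_assoc]

theorem isHomogIdeal_surface : IsHomogIdeal (Ideal.span {g} ⊔ Ideal.span {f}) :=
  (isHomogIdeal_span_singleton h.hq).sup (isHomogIdeal_span_singleton h.hc)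

theorem isPrime_surface : (Ideal.span {g} ⊔ Ideal.span {f}).IsPrime :=
  isPrime_of_isPrime_sup_span h.isHomogIdeal_surface h.hl (fun _ => h.mem_of_mul_l_mem)
    (h.sup_eq ▸ V.prime)

theorem linear_notMem_surface {a : PolyRing 4} (ha : a.IsHomogeneous 1) (h0 : a ≠ 0) :
    a ∉ Ideal.span {g} ⊔ Ideal.span {f} := by
  intro h1
  have h2 := (isHomogIdeal_span_singleton h.hq).mem_of_mem_sup_span_of_lt ha h.hc (by norm_num) h1
  rw [← bot_sup_eq (Ideal.span {g})] at h2
  exact h0 (isHomogIdeal_bot.mem_of_mem_sup_span_of_lt ha h.hq (by norm_num) h2)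

/-- The intersection of the quadric and the cubic. -/
noncomputable def surface : ProjVariety 4 where
  ideal := Ideal.span {g} ⊔ Ideal.span {f}
  homogeneous := h.isHomogIdeal_surface
  saturated := ClosedSubscheme.saturated_of_isPrime h.isPrime_surface
    (h.linear_notMem_surface (isHomogeneous_X ℂ 0) (X_ne_zero 0))
  prime := h.isPrime_surface

theorem surface_ideal : h.surface.ideal = Ideal.span {g} ⊔ Ideal.span {f} := rfl

theorem surface_ideal_le : h.surface.ideal ≤ V.ideal := h.sup_eq ▸ le_sup_left

theorem surface_isQuadricCubicIntersection : h.surface.IsQuadricCubicIntersection := by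
  have hg : g ∈ h.surface.ideal := Ideal.mem_sup_left (Ideal.mem_span_singleton_self g)
  have hf : f ∈ h.surface.ideal := Ideal.mem_sup_right (Ideal.mem_span_singleton_self f)
  refine ⟨g, f, h.hq, h.g_ne_zero, h.hc, h.f_ne_zero,
    (ClosedSubscheme.zeroScheme_ideal _ (Set.union_subset ?_ ?_) (sup_le ?_ ?_)).symm⟩
  · exact ClosedSubscheme.zeroScheme_ideal_le _ (Set.singleton_subset_iff.mpr hg)
  · exact ClosedSubscheme.zeroScheme_ideal_le _ (Set.singleton_subset_iff.mpr hf)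
  · exact (Ideal.span_singleton_le_iff_mem _).mpr
      (Ideal.subset_span (Or.inl (ClosedSubscheme.mem_hypersurface g)))
  · exact (Ideal.span_singleton_le_iff_mem _).mpr
      (Ideal.subset_span (Or.inr (ClosedSubscheme.mem_hypersurface f)))

theorem surface_inter : h.surface.inter (ClosedSubscheme.hypersurface l) = V.toClosedSubscheme :=
  ClosedSubscheme.inter_eq (by
    rw [ClosedSubscheme.hypersurface_linear_ideal h.hl h.l_ne_zero]
    exact h.sup_eq)

/-- Each nonzerodivisor lowers the dimension at least by one: `g` and `f` give the upper bound `5 -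
2`, and `l` gives the lower bound `2 + 1` from the curve. -/
theorem surface_hasDim (hV : V.IsCurve) : h.surface.HasDim 2 := by
  have h1 : ringKrullDim (PolyRing 4) = ((5 : ℕ) : WithBot ℕ∞) := by
    refine (MvPolynomial.ringKrullDim_of_isNoetherianRing (R := ℂ) (ι := Fin 5)).trans ?_
    rw [ringKrullDim_eq_zero_of_field, zero_add, Nat.card_fin]
  have h2 : ringKrullDim (PolyRing 4 ⧸ Ideal.span {g}) + 1 ≤ ringKrullDim (PolyRing 4) :=
    ringKrullDim_quotient_succ_le_of_nonZeroDivisor (mem_nonZeroDivisors_of_ne_zero h.g_ne_zero)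
  have h3 : ringKrullDim (PolyRing 4 ⧸ h.surface.ideal) + 1 ≤
      ringKrullDim (PolyRing 4 ⧸ Ideal.span {g}) :=
    ringKrullDim_quotient_sup_span_succ_le fun b hb =>
      (h.isPrime_span_g.mem_or_mem hb).resolve_right h.f_notMem_span_g
  have h4 : ringKrullDim (PolyRing 4 ⧸ V.ideal) + 1 ≤ ringKrullDim (PolyRing 4 ⧸ h.surface.ideal)
      := by
    rw [← h.sup_eq]
    exact ringKrullDim_quotient_sup_span_succ_le fun b hb => h.mem_of_mul_l_mem hb
  rw [show ringKrullDim (PolyRing 4 ⧸ V.ideal) = ((2 : ℕ) : WithBot ℕ∞) from hV] at h4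
  rw [h1] at h2
  change ringKrullDim (PolyRing 4 ⧸ h.surface.ideal) = ((3 : ℕ) : WithBot ℕ∞)
  refine le_antisymm ?_ (le_trans (le_of_eq (by norm_num)) h4)
  have h5 : ringKrullDim (PolyRing 4 ⧸ h.surface.ideal) + 1 + 1 ≤ ((5 : ℕ) : WithBot ℕ∞) :=
    (add_le_add_left h3 1).trans h2
  generalize ringKrullDim (PolyRing 4 ⧸ h.surface.ideal) = d at *
  induction d with
  | bot => exact bot_le
  | coe d =>
    induction d with
    | top => exact absurd h5 (by decide)
    | coe d =>
      have h6 : ((d : ℕ) : WithBot ℕ∞) + 1 + 1 ≤ ((5 : ℕ) : WithBot ℕ∞) := h5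
      have h7 : d + 1 + 1 ≤ 5 := by exact_mod_cast h6
      have h8 : d ≤ 3 := by omega
      change ((d : ℕ) : WithBot ℕ∞) ≤ ((3 : ℕ) : WithBot ℕ∞)
      exact_mod_cast h8

end CanonicalEquations

/-! ### Vanishing of the first cohomology -/

namespace ProjVariety

variable {n : ℕ} {V : ProjVariety n}

/-- A power of `x_i` clears the poles of all `c_{ij}` along `x_i = 0`; the sections `x_i ^ K c_{ij}`
of the charts `j` then have coboundary `x_i ^ K c`. -/
theorem exists_coord_pow_smul_mem_B1 {m : ℕ} {c : V.Chart → V.Chart → V.K} (hc : c ∈ V.Z1 m)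
    (i : Fin (n + 1)) : ∃ k : ℕ, V.coord i ^ k • c ∈ V.B1 (m + k : ℕ) := by
  by_cases hi : (X i : PolyRing n) ∈ V.ideal
  · refine ⟨1, ?_⟩
    have h0 : V.coord i ^ 1 • c = 0 := by
      have : V.coord i = 0 := V.form_eq_zero.mpr hi
      ext a b
      change V.coord i ^ 1 * c a b = 0
      rw [this, pow_one, zero_mul]
    exact h0 ▸ zero_mem _
  · cases nonempty_fintype V.Chart
    choose k hk using fun j : V.Chart => exists_coord_pow_mul_mem (hc.1 ⟨i, hi⟩ j)
    refine ⟨∑ j, k j, fun j => V.coord i ^ (∑ j, k j) * c ⟨i, hi⟩ j, fun j => ?_, fun a b => ?_⟩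
    · have := hk j _ (Finset.single_le_sum (fun _ _ => Nat.zero_le _) (Finset.mem_univ j))
      exact_mod_cast this
    · change V.coord i ^ (∑ j, k j) * c a b = _
      rw [← mul_sub, ← hc.2 ⟨i, hi⟩ a b, add_sub_cancel_left]

theorem exists_form_pow_smul_mem_B1 {c : V.Chart → V.Chart → V.K} (hc : c ∈ V.Z1 0)
    {w : PolyRing n} (hw : w.IsHomogeneous 1) : ∃ k : ℕ, V.form w ^ k • c ∈ V.B1 k := by
  refine exists_form_pow_smul_mem (V := V) (fun d : ℕ => V.B1 d) (fun d i e he => ?_) c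
    (fun i => ?_) hw
  · exact V.mulCochain_mem_B1 i he
  · obtain ⟨k, hk⟩ := exists_coord_pow_smul_mem_B1 (m := 0) hc i
    rw [zero_add] at hk
    exact ⟨k, hk⟩

theorem exists_form_eq_of_mem_sections {m : ℕ} {i : V.Chart} {s : V.K}
    (hs : s ∈ V.sections m ![i]) : ∃ (k : ℕ) (a : PolyRing n), a.IsHomogeneous (m + k) ∧
      s * V.coord i.1 ^ k = V.form a := by
  rw [mem_sections_one] at hs
  obtain ⟨k, d, a, ha, hd, h⟩ := hs
  obtain rfl : d = m + k := by exact_mod_cast hd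
  exact ⟨k, a, ha, h⟩

end ProjVariety

namespace CanonicalEquations

variable {V : ProjVariety 4} {l g f : PolyRing 4} (h : CanonicalEquations V l g f)
include h

theorem form_l_ne_zero : h.surface.form l ≠ 0 := fun h0 =>
  h.linear_notMem_surface h.hl h.l_ne_zero (h.surface.form_eq_zero.mp h0)

/-- Sections on the charts of the surface that agree on the hyperplane section `V` come from a
form, modulo the equation of the hyperplane. -/
theorem exists_form_eq {S : ProjVariety 4}
    (hS : S.ideal = Ideal.span {g} ⊔ Ideal.span {f}) {m : ℕ} {s : S.Chart → S.K}
    (hs : ∀ i, s i ∈ S.sections (m + 1 : ℕ) ![i])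
    (hss : ∀ i j, ∃ c ∈ S.sections m ![i, j], s j - s i = S.form l * c) :
    ∃ b : PolyRing 4, b.IsHomogeneous (m + 1) ∧ ∀ i, ∃ u ∈ S.sections m ![i],
      s i = S.form b + S.form l * u := by
  have hSV : S.ideal ≤ V.ideal := hS.trans_le h.surface_ideal_le
  choose k a ha hka using fun i => ProjVariety.exists_form_eq_of_mem_sections (hs i)
  -- Modulo `l` the differences vanish, so on `V` the fractions `a_i / x_i ^ k_i` agree; this is the
  -- cross-multiplied form. They glue to a section on `V`, which is the class of a form `b`.
  have hcong : ∀ i j : S.Chart, ∃ r : ℕ,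
      V.coord i.1 ^ (r + k i) * V.coord j.1 ^ r * V.form (a j) =
        V.coord j.1 ^ (r + k j) * V.coord i.1 ^ r * V.form (a i) := by
    intro i j
    obtain ⟨c, hc, hsc⟩ := hss i j
    rw [ProjVariety.mem_sections_two] at hc
    obtain ⟨r, d, b, -, -, hrb⟩ := hc
    refine ⟨r, ?_⟩
    have h1 : S.form (X i.1 ^ (r + k i) * X j.1 ^ r * a j -
        (X j.1 ^ (r + k j) * X i.1 ^ r * a i + X i.1 ^ k i * X j.1 ^ k j * b * l)) = 0 := by
      simp only [ProjVariety.form_sub, ProjVariety.form_add, ProjVariety.form_mul,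
        ProjVariety.form_pow, ← hka, ← hrb]
      change S.coord i.1 ^ (r + k i) * S.coord j.1 ^ r * _ - (S.coord j.1 ^ (r + k j) *
        S.coord i.1 ^ r * _ + S.coord i.1 ^ k i * S.coord j.1 ^ k j * _ * _) = 0
      linear_combination S.coord i.1 ^ (r + k i) * S.coord j.1 ^ (r + k j) * hsc
    have h2 := hSV (S.form_eq_zero.mp h1)
    rw [← V.form_eq_zero] at h2
    simp only [ProjVariety.form_sub, ProjVariety.form_add, ProjVariety.form_mul,
        ProjVariety.form_pow, V.form_eq_zero.mpr h.l_mem, mul_zero, add_zero] at h2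
    exact sub_eq_zero.mp h2
  have hchart : ∀ i : V.Chart, (X i.1 : PolyRing 4) ∉ S.ideal := fun i hi =>
    i.2 (hSV hi)
  let σ : V.Chart → V.K := fun i => V.form (a ⟨i.1, hchart i⟩) / V.coord i.1 ^ k ⟨i.1, hchart i⟩
  have hσ : ∀ i j, σ i = σ j := by
    intro i j
    obtain ⟨r, hr⟩ := hcong ⟨i.1, hchart i⟩ ⟨j.1, hchart j⟩
    have hi := V.coord_ne_zero i
    have hj := V.coord_ne_zero j
    simp only [σ]
    rw [div_eq_div_iff (pow_ne_zero _ hi) (pow_ne_zero _ hj)]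
    refine mul_left_cancel₀ (mul_ne_zero (pow_ne_zero r hi) (pow_ne_zero r hj)) ?_
    simp only [pow_add] at hr
    linear_combination -hr
  obtain ⟨b, hb, hbσ⟩ : ∃ b : PolyRing 4, b.IsHomogeneous (m + 1) ∧ ∀ i, V.form b = σ i := by
    rcases isEmpty_or_nonempty V.Chart with hV | ⟨⟨i₀⟩⟩
    · exact ⟨0, isHomogeneous_zero _ _ _, fun i => hV.elim i⟩
    · have : σ i₀ ∈ V.H0 (m + 1 : ℕ) := by
        rw [ProjVariety.mem_H0]
        intro i
        rw [hσ i₀ i, ProjVariety.mem_sections_one]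
        exact ⟨k _, _, a ⟨i.1, hchart i⟩, ha _, by push_cast; ring,
          div_mul_cancel₀ _ (pow_ne_zero _ (V.coord_ne_zero i))⟩
      obtain ⟨b, hb, hbσ⟩ := ProjVariety.mem_forms.mp (h.H0_le_forms _ this)
      exact ⟨b, hb, fun i => hbσ.trans (hσ _ _)⟩
  refine ⟨b, hb, fun i => ?_⟩
  -- The extra factor `x_i` covers charts of the surface that do not meet `V`.
  have hmem : X i.1 * (a i - b * X i.1 ^ k i) ∈ V.ideal := by
    by_cases hi : (X i.1 : PolyRing 4) ∈ V.ideal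
    · exact V.ideal.mul_mem_right _ hi
    · refine V.ideal.mul_mem_left _ ?_
      rw [← V.form_eq_form, ProjVariety.form_mul, ProjVariety.form_pow, hbσ ⟨i.1, hi⟩]
      exact (div_mul_cancel₀ _ (pow_ne_zero _ (V.coord_ne_zero ⟨i.1, hi⟩))).symm
  have hhom : (X i.1 * (a i - b * X i.1 ^ k i)).IsHomogeneous (m + (k i + 1) + 1) := by
    rw [show m + (k i + 1) + 1 = 1 + (m + 1 + k i) by ring]
    exact (isHomogeneous_X ℂ i.1).mul ((ha i).sub (hb.mul (isHomogeneous_X_pow i.1 (k i))))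
  rw [← h.sup_eq, ← hS] at hmem
  obtain ⟨e, he, hel⟩ := IsHomogIdeal.exists_of_mem_sup_span S.homogeneous hhom h.hl hmem
  have hi := S.coord_ne_zero i
  refine ⟨S.form e / S.coord i.1 ^ (k i + 1), ?_, ?_⟩
  · rw [ProjVariety.mem_sections_one]
    exact ⟨k i + 1, _, e, he, by push_cast; ring, div_mul_cancel₀ _ (pow_ne_zero _ hi)⟩
  · have h3 : S.form (X i.1 * (a i - b * X i.1 ^ k i)) = S.form (e * l) := S.form_eq_form.mpr hel
    rw [ProjVariety.form_mul, ProjVariety.form_sub, ProjVariety.form_mul, ProjVariety.form_pow,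
      ProjVariety.form_mul, ← hka] at h3
    change S.coord i.1 * (s i * S.coord i.1 ^ k i - S.form b * S.coord i.1 ^ k i) = _ at h3
    refine mul_right_cancel₀ (pow_ne_zero (k i + 1) hi) ?_
    rw [add_mul, mul_assoc, div_mul_cancel₀ _ (pow_ne_zero _ hi)]
    linear_combination h3

/-- In the exact sequence of the hyperplane section `V`, multiplication by `l` on `H¹` is injective
because every section on `V` is a form and so lifts to the surface. Subtracting the lift `b` from
all `s i` leaves their coboundary unchanged and makes them divisible by `l`. -/
theorem mem_B1_of_form_smul_mem_B1 {m : ℕ} {c : h.surface.Chart → h.surface.Chart → h.surface.K}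
    (hc : c ∈ h.surface.Z1 m) (hlc : h.surface.form l • c ∈ h.surface.B1 (m + 1 : ℕ)) :
    c ∈ h.surface.B1 m := by
  obtain ⟨s, hs, hsc⟩ := hlc
  obtain ⟨b, -, hbs⟩ := h.exists_form_eq h.surface_ideal hs fun i j => ⟨c i j, hc.1 i j,
      (hsc i j).symm⟩
  choose u hu hsu using hbs
  refine ⟨u, hu, fun i j => mul_left_cancel₀ h.form_l_ne_zero ?_⟩
  have := hsc i j
  rw [hsu i, hsu j] at this
  change h.surface.form l * c i j = _ at this
  rw [this]
  ring

theorem form_pow_smul_mem_Z1 {c : h.surface.Chart → h.surface.Chart → h.surface.K}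
    (hc : c ∈ h.surface.Z1 0) (k : ℕ) : h.surface.form l ^ k • c ∈ h.surface.Z1 k := by
  refine ⟨fun i j => ?_, fun i j r => ?_⟩
  · have := ProjVariety.form_mul_mem_sections (h.hl.pow k) (hc.1 i j)
    rw [one_mul, zero_add, ProjVariety.form_pow] at this
    exact this
  · change h.surface.form l ^ k * c i j + h.surface.form l ^ k * c j r =
      h.surface.form l ^ k * c i r
    rw [← mul_add, hc.2]

/-- A power of `l` turns each cocycle into a coboundary, and the factors `l` are cancelled one at a
time. -/
theorem subsingleton_surface_H1 : Subsingleton (h.surface.H1 0) := by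
  refine subsingleton_of_forall_eq 0 fun x => ?_
  obtain ⟨⟨c, hc⟩, rfl⟩ := Submodule.mkQ_surjective _ x
  rw [Submodule.mkQ_apply, Submodule.Quotient.mk_eq_zero, mem_submoduleOf_iff]
  obtain ⟨k, hk⟩ := ProjVariety.exists_form_pow_smul_mem_B1 hc h.hl
  induction k with
  | zero =>
    rw [pow_zero, one_smul] at hk
    exact hk
  | succ k ih =>
    apply ih
    apply h.mem_B1_of_form_smul_mem_B1 (h.form_pow_smul_mem_Z1 hc k)
    rwa [smul_smul, ← pow_succ']

end CanonicalEquations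

/-! ### Generic linear forms -/

/-- The transcendence degree of `ℂ` over a countable field is infinite, for reasons of cardinality.
-/
theorem exists_algebraicIndependent {k : Subfield ℂ} (hk : Cardinal.mk k ≤ Cardinal.aleph0)
    (r : ℕ) : ∃ m : Fin r → ℂ, AlgebraicIndependent k m := by
  obtain ⟨s, hs⟩ := exists_isTranscendenceBasis k ℂ
  have h := IsAlgClosed.cardinal_eq_cardinal_transcendence_basis_of_aleph0_lt' _ hs hk
    (by rw [Cardinal.mk_complex]; exact Cardinal.aleph0_lt_continuum)
  have : Infinite s := by
    rw [← Cardinal.aleph0_le_mk_iff, ← h, Cardinal.mk_complex]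
    exact Cardinal.aleph0_le_continuum
  let e := (Fin.valEmbedding (n := r)).trans (Infinite.natEmbedding s)
  exact ⟨fun i : Fin r => e i, hs.1.comp e e.injective⟩

/-- A field generated by as many elements as its transcendence degree requires at least has these
generators as a transcendence basis. -/
theorem algebraicIndependent_of_mem_adjoin {k E ι : Type} [Field k] [Field E] [Algebra k E]
    [Finite ι] {m u : ι → E} (hm : AlgebraicIndependent k m)
    (h : ∀ i, m i ∈ IntermediateField.adjoin k (Set.range u)) : AlgebraicIndependent k u := by
  set A := IntermediateField.adjoin k (Set.range u)
  let x : ι → A := fun i => ⟨u i, IntermediateField.subset_adjoin _ _ ⟨i, rfl⟩⟩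
  let m' : ι → A := fun i => ⟨m i, h i⟩
  have hm' : AlgebraicIndependent k m' :=
    AlgebraicIndependent.of_comp A.val hm
  have htop : IntermediateField.adjoin k (Set.range x) = ⊤ := by
    apply IntermediateField.map_injective A.val
    rw [IntermediateField.adjoin_map, ← Set.range_comp, ← AlgHom.fieldRange_eq_map,
      IntermediateField.fieldRange_val]
    rfl
  have halg : Algebra.IsAlgebraic (Algebra.adjoin k (Set.range x)) A := by
    rw [← IntermediateField.isAlgebraic_adjoin_iff_top]
    refine ⟨fun y => ?_⟩
    have hy : y ∈ IntermediateField.adjoin k (Set.range x) := htop ▸ IntermediateField.mem_top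
    exact isAlgebraic_algebraMap (⟨y, hy⟩ : IntermediateField.adjoin k (Set.range x))
  have hx := Algebra.IsAlgebraic.isTranscendenceBasis_of_le_trdeg_of_finite k x
      hm'.cardinalMk_le_trdeg
  exact hx.1.map' (f := A.val) A.val.injective

/-- Polynomials with coefficients in a subfield. -/
def IsDefinedOver (k : Subfield ℂ) {n : ℕ} (f : PolyRing n) : Prop :=
  ∃ f₀ : MvPolynomial (Fin (n + 1)) k, map (algebraMap k ℂ) f₀ = f

namespace IsDefinedOver

variable {k : Subfield ℂ} {n : ℕ} {f g : PolyRing n}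

theorem of_coeffs (h : ∀ c ∈ f.coeffs, c ∈ k) : IsDefinedOver k f :=
  mem_range_map_iff_coeffs_subset.mpr fun c hc => ⟨⟨c, h c hc⟩, rfl⟩

theorem add (hf : IsDefinedOver k f) (hg : IsDefinedOver k g) : IsDefinedOver k (f + g) := by
  obtain ⟨f₀, rfl⟩ := hf
  obtain ⟨g₀, rfl⟩ := hg
  exact ⟨f₀ + g₀, map_add _ _ _⟩

theorem mul (hf : IsDefinedOver k f) (hg : IsDefinedOver k g) : IsDefinedOver k (f * g) := by
  obtain ⟨f₀, rfl⟩ := hf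
  obtain ⟨g₀, rfl⟩ := hg
  exact ⟨f₀ * g₀, map_mul _ _ _⟩

theorem C {c : ℂ} (hc : c ∈ k) : IsDefinedOver k (MvPolynomial.C c : PolyRing n) :=
  ⟨MvPolynomial.C ⟨c, hc⟩, map_C _ _⟩

theorem pderiv (hf : IsDefinedOver k f) (i : Fin (n + 1)) :
    IsDefinedOver k (MvPolynomial.pderiv i f) := by
  obtain ⟨f₀, rfl⟩ := hf
  exact ⟨MvPolynomial.pderiv i f₀, (pderiv_map ..).symm⟩

theorem eval_mem (hf : IsDefinedOver k f) {A : IntermediateField k ℂ} {x : Fin (n + 1) → ℂ}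
    (hx : ∀ i, x i ∈ A) : eval x f ∈ A := by
  obtain ⟨f₀, rfl⟩ := hf
  rw [eval_map]
  induction f₀ using MvPolynomial.induction_on with
  | C c => rw [eval₂_C]; exact A.algebraMap_mem c
  | add f g hf hg => rw [eval₂_add]; exact add_mem hf hg
  | mul_X f i hf => rw [eval₂_mul, eval₂_X]; exact mul_mem hf (hx i)

end IsDefinedOver

theorem MvPolynomial.IsHomogeneous.eval_smul {n d : ℕ} {f : PolyRing n} (hf : f.IsHomogeneous d)
    (c : ℂ) (v : Fin (n + 1) → ℂ) : eval (c • v) f = c ^ d * eval v f := by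
  have h := congrArg (Polynomial.aeval c) (aeval_line (v := v) hf)
  rw [← AlgHom.comp_apply, MvPolynomial.comp_aeval] at h
  have e : (fun i => Polynomial.aeval c (Polynomial.C (v i) * (Polynomial.X : Polynomial ℂ))) =
      c • v := by
    ext i
    rw [map_mul, Polynomial.aeval_C, Polynomial.aeval_X]
    exact mul_comm _ _
  rw [e] at h
  rw [map_mul, map_pow, Polynomial.aeval_C, Polynomial.aeval_X, aeval_eq_eval] at h
  exact h.trans (mul_comm _ _)

theorem gradientAt_smul {n d : ℕ} {f : PolyRing n} (hf : f.IsHomogeneous d) (c : ℂ)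
    (v : Fin (n + 1) → ℂ) : gradientAt (c • v) f = c ^ (d - 1) • gradientAt v f :=
  _root_.funext fun _ => hf.pderiv.eval_smul c v

theorem eval_sum_C_mul_X {n : ℕ} (m v : Fin (n + 1) → ℂ) :
    eval v (∑ i, C (m i) * X i : PolyRing n) = ∑ i, m i * v i := by
  simp

theorem gradientAt_sum_C_mul_X {n : ℕ} (m v : Fin (n + 1) → ℂ) :
    gradientAt v (∑ i, C (m i) * X i : PolyRing n) = m := by
  ext j
  simp [gradientAt, pderiv_X, Pi.single_apply]

/-- A generic member of the linear system of hypersurfaces `f + p * (∑ i, m i * x i) = 0` is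
tangent to the hypersurface `g = 0` at most where `p = 0`. -/
theorem eval_eq_zero_of_tangent {k : Subfield ℂ} {n d e : ℕ} {m : Fin (n + 1) → ℂ}
    (hm : AlgebraicIndependent k m) {g f p : PolyRing n} (hg : IsDefinedOver k g)
    (hf : IsDefinedOver k f) (hp : IsDefinedOver k p) (hgd : g.IsHomogeneous d) (hg0 : g ≠ 0)
    (hfe : (f + p * ∑ i, C (m i) * X i).IsHomogeneous e) {v : Fin (n + 1) → ℂ} (hv : v ≠ 0)
    (hgv : eval v g = 0) (hfv : eval v (f + p * ∑ i, C (m i) * X i) = 0) {μ : ℂ}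
    (hμ : gradientAt v (f + p * ∑ i, C (m i) * X i) = μ • gradientAt v g) {r : ℕ}
    (hpr : p.IsHomogeneous r) : eval v p = 0 := by
  obtain ⟨a, ha⟩ : ∃ a, v a ≠ 0 := by
    by_contra! h0
    exact hv (_root_.funext h0)
  set F := f + p * ∑ i, C (m i) * X i with hF
  by_contra hpv
  set x := (v a)⁻¹ • v with hx
  have hxa : x a = 1 := inv_mul_cancel₀ ha
  have hi : (v a)⁻¹ ≠ 0 := inv_ne_zero ha
  have hgx : eval x g = 0 := by rw [hgd.eval_smul, hgv, mul_zero]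
  have hfx : eval x F = 0 := by rw [hfe.eval_smul, hfv, mul_zero]
  have hpx : eval x p ≠ 0 := by
    rw [hpr.eval_smul]
    exact mul_ne_zero (pow_ne_zero _ hi) hpv
  obtain ⟨ν, hν⟩ : ∃ ν : ℂ, gradientAt x F = ν • gradientAt x g := by
    refine ⟨(v a)⁻¹ ^ (e - 1) * μ * ((v a)⁻¹ ^ (d - 1))⁻¹, ?_⟩
    rw [gradientAt_smul hfe, gradientAt_smul hgd, hμ, smul_smul, smul_smul,
        mul_assoc _ _ (_ ^ (d - 1)),
      inv_mul_cancel₀ (pow_ne_zero _ hi), mul_one]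
  -- As `x a = 1` carries no information, its slot takes the multiplier `ν`. The `n + 1` numbers `u`
  -- generate a field containing the `n + 1` independent numbers `m`.
  let u : Fin (n + 1) → ℂ := Function.update x a ν
  have hu : ∀ i, i ≠ a → u i = x i := fun i hi => Function.update_of_ne hi _ _
  have hxA : ∀ i, x i ∈ IntermediateField.adjoin k (Set.range u) := by
    intro i
    by_cases hia : i = a
    · rw [hia, hxa]
      exact one_mem _
    · rw [← hu i hia]
      exact IntermediateField.subset_adjoin _ _ ⟨i, rfl⟩
  have hνA : ν ∈ IntermediateField.adjoin k (Set.range u) :=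
    IntermediateField.subset_adjoin _ _ ⟨a, Function.update_self _ _ _⟩
  have hmA : ∀ i, m i ∈ IntermediateField.adjoin k (Set.range u) := by
    intro i
    have h1 := congrFun hν i
    rw [hF, gradientAt_add, gradientAt_mul, gradientAt_sum_C_mul_X] at h1
    rw [hF, map_add, map_mul] at hfx
    simp only [Pi.add_apply, Pi.smul_apply, smul_eq_mul, gradientAt] at h1
    -- The tangency equation is solved for `m i`; the value of the linear form at `x` is `-f(x) /
    -- p(x)` because `x` lies on the hypersurface.
    have h2 : m i = (ν * eval x (pderiv i g) - eval x (pderiv i f) +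
        eval x f / eval x p * eval x (pderiv i p)) / eval x p := by
      field_simp
      linear_combination eval x p * h1 - eval x (pderiv i p) * hfx
    rw [h2]
    refine div_mem (add_mem (sub_mem (mul_mem hνA ?_) ?_) (mul_mem (div_mem ?_ ?_) ?_)) ?_
    · exact (hg.pderiv i).eval_mem hxA
    · exact (hf.pderiv i).eval_mem hxA
    · exact hf.eval_mem hxA
    · exact hp.eval_mem hxA
    · exact (hp.pderiv i).eval_mem hxA
    · exact hp.eval_mem hxA
  have hind := algebraicIndependent_of_mem_adjoin hm hmA
  obtain ⟨g₀, hg₀⟩ := hg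
  -- Dehomogenisation at `x a = 1`. Since `g` vanishes at `x`, this is an algebraic relation among
  -- the independent numbers `u`, so it is trivial.
  let θ : MvPolynomial (Fin (n + 1)) k →ₐ[k] MvPolynomial (Fin (n + 1)) k :=
    aeval fun i => if i = a then 1 else X i
  have hθ : ∀ w y : Fin (n + 1) → ℂ, y a = 1 → (∀ i, i ≠ a → w i = y i) →
      aeval w (θ g₀) = eval y g := by
    intro w y hya hwy
    rw [← hg₀, eval_map, ← aeval_def, ← AlgHom.comp_apply, MvPolynomial.comp_aeval]
    congr 2
    ext i
    by_cases hia : i = a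
    · rw [if_pos hia, map_one, hia, hya]
    · rw [if_neg hia, aeval_X, hwy i hia]
  have hθ0 : θ g₀ = 0 := by
    rw [← map_eq_zero_iff _ hind, hθ u x hxa hu, hgx]
  have hX : g * X a = 0 := by
    apply MvPolynomial.funext
    intro y
    rw [map_mul, eval_X, map_zero]
    by_cases hya : y a = 0
    · rw [hya, mul_zero]
    · have h1 : eval ((y a)⁻¹ • y) g = 0 := by
        rw [← hθ ((y a)⁻¹ • y) _ (inv_mul_cancel₀ hya) (fun _ _ => rfl), hθ0, map_zero]
      rw [hgd.eval_smul] at h1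
      rw [(mul_eq_zero.mp h1).resolve_left (pow_ne_zero _ (inv_ne_zero hya)), zero_mul]
  exact hg0 ((mul_eq_zero.mp hX).resolve_right (X_ne_zero a))

/-! ### Smooth members of the linear system -/

section LinearAlgebra

variable {E : Type*} [AddCommGroup E] [Module ℂ E] {x y z : E}

theorem linearIndependent_pair_add_smul (h : LinearIndependent ℂ ![x, y, z]) (a b : ℂ) :
    LinearIndependent ℂ ![y + a • x, z + b • x] := by
  rw [LinearIndependent.pair_iff]
  intro s t hst
  rw [Fintype.linearIndependent_iff] at h
  have h1 := h ![s * a + t * b, s, t] (by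
    simp only [Fin.sum_univ_three, Matrix.cons_val]
    rw [← hst]
    module)
  exact ⟨h1 1, h1 2⟩

/-- Two bad parameters make `x` a multiple of `y + a • x`; then `y` and `z` are multiples as well,
and the three vectors span at most a line. -/
theorem subsingleton_dependent {a c : ℂ} (hc : c ≠ 0) (hA : y + a • x ≠ 0)
    (h : 2 ≤ Module.finrank ℂ (Submodule.span ℂ (Set.range ![x, y, z]))) :
    {μ : ℂ | ¬ LinearIndependent ℂ ![y + a • x, z + (μ * c) • x]}.Subsingleton := by
  intro μ hμ ν hν
  by_contra hne
  rw [Set.mem_ofPred_eq, LinearIndependent.pair_iff' hA] at hμ hν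
  push Not at hμ hν
  obtain ⟨α, hα⟩ := hμ
  obtain ⟨β, hβ⟩ := hν
  set A := y + a • x with hAdef
  have hx : x = ((α - β) / ((μ - ν) * c)) • A := by
    have h1 : ((μ - ν) * c) • x = (α - β) • A := by
      rw [sub_smul, hα, hβ]
      module
    rw [div_eq_inv_mul, mul_smul, ← h1, smul_smul,
      inv_mul_cancel₀ (mul_ne_zero (sub_ne_zero.mpr hne) hc), one_smul]
  have hxA : x ∈ Submodule.span ℂ {A} := by
    rw [hx]
    exact Submodule.smul_mem _ _ (Submodule.mem_span_singleton_self A)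
  have hyA : y ∈ Submodule.span ℂ {A} := by
    rw [show y = A - a • x by rw [hAdef, add_sub_cancel_right]]
    exact sub_mem (Submodule.mem_span_singleton_self A) (Submodule.smul_mem _ _ hxA)
  have hzA : z ∈ Submodule.span ℂ {A} := by
    rw [show z = α • A - (μ * c) • x by rw [hα, add_sub_cancel_right]]
    exact sub_mem (Submodule.smul_mem _ _ (Submodule.mem_span_singleton_self A))
      (Submodule.smul_mem _ _ hxA)
  have hle : Submodule.span ℂ (Set.range ![x, y, z]) ≤ Submodule.span ℂ {A} := by
    rw [Submodule.span_le]
    rintro _ ⟨i, rfl⟩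
    fin_cases i
    · exact hxA
    · exact hyA
    · exact hzA
  have h1 := Submodule.finrank_mono hle
  rw [finrank_span_singleton hA] at h1
  omega

end LinearAlgebra

/-! ### Singular members of a pencil of quadrics -/

section Quadrics

variable {n : ℕ}

theorem gradientAt_linear {l : PolyRing n} (hl : l.IsHomogeneous 1) :
    ∃ a : Fin (n + 1) → ℂ, (∀ v, gradientAt v l = a) ∧ (∀ v, eval v l = ∑ i, a i * v i) ∧
      (l ≠ 0 → a ≠ 0) := by
  obtain ⟨a, rfl⟩ := hl.eq_sum_coeff
  refine ⟨a, fun v => gradientAt_sum_C_mul_X a v, fun v => eval_sum_C_mul_X a v, ?_⟩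
  rintro h rfl
  simp at h

theorem pderiv_pderiv_comm (i j : Fin (n + 1)) (f : PolyRing n) :
    pderiv i (pderiv j f) = pderiv j (pderiv i f) := by
  have h : ⁅(pderiv i : Derivation ℂ (PolyRing n) (PolyRing n)),
      (pderiv j : Derivation ℂ (PolyRing n) (PolyRing n))⁆ = 0 := by
    apply derivation_ext
    intro k
    simp only [Derivation.commutator_apply, pderiv_X, Derivation.zero_apply, Pi.single_apply]
    split_ifs <;> simp
  have h1 := DFunLike.congr_fun h f
  rw [Derivation.commutator_apply] at h1
  exact sub_eq_zero.mp h1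

/-- Both sides are the polar form of `g`, which is symmetric because second derivatives commute. -/
theorem gradientAt_symm {g : PolyRing n} (hg : g.IsHomogeneous 2) (u v : Fin (n + 1) → ℂ) :
    ∑ i, gradientAt u g i * v i = ∑ i, gradientAt v g i * u i := by
  have h : ∀ i w, gradientAt w g i = ∑ j, eval 0 (pderiv j (pderiv i g)) * w j := by
    intro i w
    obtain ⟨a, ha, ha', -⟩ := gradientAt_linear (hg.pderiv (i := i))
    have h0 := ha 0
    refine (ha' w).trans (Finset.sum_congr rfl fun j _ => ?_)
    rw [← h0]
    rfl
  simp only [h, Finset.sum_mul]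
  rw [Finset.sum_comm]
  refine Finset.sum_congr rfl fun i _ => Finset.sum_congr rfl fun j _ => ?_
  rw [pderiv_pderiv_comm]
  ring

variable {l l' g : PolyRing n}

theorem gradientAt_mul_linear (hl : l.IsHomogeneous 1) (hl' : l'.IsHomogeneous 1)
    (u v : Fin (n + 1) → ℂ) :
    ∑ i, gradientAt u (l * l') i * v i = eval u l * eval v l' + eval u l' * eval v l := by
  obtain ⟨a, ha, ha', -⟩ := gradientAt_linear hl
  obtain ⟨b, hb, hb', -⟩ := gradientAt_linear hl'
  rw [gradientAt_mul, ha, hb, ha' v, hb' v]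
  simp only [Pi.add_apply, Pi.smul_apply, smul_eq_mul, add_mul, Finset.sum_add_distrib, mul_assoc,
    ← Finset.mul_sum]

theorem gradientAt_add_C_mul (v : Fin (n + 1) → ℂ) (t : ℂ) (p : PolyRing n) :
    gradientAt v (g + C t * p) = gradientAt v g + t • gradientAt v p := by
  rw [gradientAt_add, gradientAt_mul, gradientAt_C, smul_zero, add_zero, eval_C]

/-- Only finitely many members of a pencil spanned by a quadric and a pair of hyperplanes have a
vertex outside of these hyperplanes. -/
theorem finite_singular_members (hl : l.IsHomogeneous 1) (hl' : l'.IsHomogeneous 1)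
    (hg : g.IsHomogeneous 2) :
    {t : ℂ | ∃ v, eval v l ≠ 0 ∧ eval v l' ≠ 0 ∧ gradientAt v (g + C t * (l * l')) = 0}.Finite := by
  -- Each vertex is in the kernel of the polar form of its quadric; the difference of the two
  -- pairings of `u` and `v` is `s - t` times the polar form of `l l'`.
  have key : ∀ s t : ℂ, s ≠ t → ∀ u v, gradientAt u (g + C s * (l * l')) = 0 →
      gradientAt v (g + C t * (l * l')) = 0 →
      eval u l * eval v l' + eval u l' * eval v l = 0 := by
    intro s t hst u v hu hv
    have h1 : ∀ (s : ℂ) (u v : Fin (n + 1) → ℂ), ∑ i, gradientAt u (g + C s * (l * l')) i * v i =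
        ∑ i, gradientAt u g i * v i + s * ∑ i, gradientAt u (l * l') i * v i := by
      intro s u v
      simp only [gradientAt_add_C_mul, Pi.add_apply, Pi.smul_apply, smul_eq_mul, add_mul,
        Finset.sum_add_distrib, mul_assoc, ← Finset.mul_sum]
    have h2 := h1 s u v
    have h3 := h1 t v u
    rw [hu, gradientAt_mul_linear hl hl'] at h2
    rw [hv, ← gradientAt_symm hg u v, gradientAt_mul_linear hl hl'] at h3
    simp only [Pi.zero_apply, zero_mul, Finset.sum_const_zero] at h2 h3
    refine (mul_eq_zero.mp (?_ : (s - t) * _ = 0)).resolve_left (sub_ne_zero.mpr hst)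
    linear_combination h3 - h2
  by_contra hinf
  obtain ⟨s, hs, -⟩ := Set.Infinite.exists_notMem_finset hinf ∅
  obtain ⟨t, ht, hts⟩ := Set.Infinite.exists_notMem_finset hinf {s}
  obtain ⟨r, hr, hrs⟩ := Set.Infinite.exists_notMem_finset hinf {s, t}
  simp only [Finset.mem_singleton, Finset.mem_insert, not_or] at hts hrs
  obtain ⟨u, hu, hu', hu0⟩ := hs
  obtain ⟨v, hv, hv', hv0⟩ := ht
  obtain ⟨w, hw, hw', hw0⟩ := hr
  have h1 := key t s hts v u hv0 hu0
  have h2 := key r s hrs.1 w u hw0 hu0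
  have h3 := key r t hrs.2 w v hw0 hv0
  -- For three vertices the ratios of `l` to `l'` are pairwise opposite, hence zero; so at most two
  -- parameters occur.
  have h4 : 2 * (eval u l * eval v l * eval w l') = 0 := by
    refine (mul_eq_zero.mp (?_ : eval w l * _ = 0)).resolve_left hw
    linear_combination (eval w l * eval v l) * h2 + (eval w l * eval u l) * h3 -
        (eval w l * eval w l) * h1
  simp_all

end Quadrics

/-- Equality would be a nontrivial linear relation over `k` among the independent numbers `m`. -/
theorem sum_mul_ne_of_algebraicIndependent {k : Subfield ℂ} {n : ℕ} {m : Fin n → ℂ}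
    (hm : AlgebraicIndependent k m) {v : Fin n → ℂ} (hv0 : v ≠ 0) (hv : ∀ i, v i ∈ k) {c : ℂ}
    (hc : c ∈ k) : ∑ i, m i * v i ≠ c := by
  intro h
  let P : MvPolynomial (Fin n) k := ∑ i, C ⟨v i, hv i⟩ * X i - C ⟨c, hc⟩
  have hP : P = 0 := by
    rw [← map_eq_zero_iff _ hm]
    simp only [P, map_sub, map_sum, map_mul, aeval_X, algHom_C]
    rw [sub_eq_zero]
    exact (Finset.sum_congr rfl fun i _ => mul_comm _ _).trans h
  apply hv0
  ext i
  have h2 := congrArg (coeff (Finsupp.single i 1)) hP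
  simp only [P, coeff_sub, coeff_sum, coeff_C_mul, coeff_X, coeff_C, coeff_zero] at h2
  rw [Finset.sum_eq_single i] at h2
  · have hne : (0 : Fin n →₀ ℕ) ≠ Finsupp.single i 1 := fun h => by
      simpa using DFunLike.congr_fun h i
    rw [if_neg hne] at h2
    simpa using congrArg Subtype.val h2
  · intro j _ hj
    simp [Finsupp.single_left_inj, hj]
  · simp

namespace CanonicalEquations

variable {V V' : ProjVariety 4} {l l' g f : PolyRing 4}

section

variable (h : CanonicalEquations V l g f) {p : ℙ ℂ (Fin (4 + 1) → ℂ)}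
include h

theorem mem_points_iff : p ∈ V.points ↔
    eval p.rep l = 0 ∧ eval p.rep g = 0 ∧ eval p.rep f = 0 := by
  refine ⟨fun hp => ⟨hp l h.l_mem, hp g h.q_mem, hp f h.c_mem⟩, fun ⟨h1, h2, h3⟩ => ?_⟩
  have hle : V.ideal ≤ RingHom.ker (eval p.rep) := by
    rw [h.ideal_eq]
    refine sup_le (sup_le ?_ ?_) ?_ <;> rw [Ideal.span_singleton_le_iff_mem] <;> assumption
  exact fun q hq => hle hq

theorem linearIndependent_gradientAt (hV : V.IsCurve) (hp : p ∈ V.points)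
    (hs : p ∉ V.singularLocus) :
    LinearIndependent ℂ ![gradientAt p.rep l, gradientAt p.rep g, gradientAt p.rep f] := by
  have h1 := (ClosedSubscheme.notMem_singularLocus_iff hV (by norm_num) h.span_range hp).mp hs
  convert! h1 using 1
  ext r i
  fin_cases r <;> rfl

/-- The cone tangent space has dimension at most `3` in `ℂ⁵`, and the span of the gradients has the
complementary dimension. -/
theorem two_le_finrank_span (hpl : V.HasPlanarSingularities) (hs : p ∈ V.singularLocus) :
    2 ≤ Module.finrank ℂ (Submodule.span ℂ
      (Set.range ![gradientAt p.rep l, gradientAt p.rep g, gradientAt p.rep f])) := by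
  have h1 := ClosedSubscheme.finrank_coneTangentSpace_add h.span_range hs.1
  have h2 := hpl p hs
  have h3 : (fun r => gradientAt p.rep (![l, g, f] r)) =
      ![gradientAt p.rep l, gradientAt p.rep g, gradientAt p.rep f] := by
    ext r i
    fin_cases r <;> rfl
  rw [h3] at h1
  omega

theorem gradientAt_l_ne_zero (v : Fin (4 + 1) → ℂ) : gradientAt v l ≠ 0 := by
  obtain ⟨a, ha, -, ha0⟩ := gradientAt_linear h.hl
  rw [ha]
  exact ha0 h.l_ne_zero

/-- The members of the pencil of quadrics that are singular at a singular point of `V`. -/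
theorem finite_bad_quadrics (hfin : V.singularLocus.Finite) (l' : PolyRing 4) :
    {t : ℂ | ∃ p ∈ V.singularLocus, eval p.rep l' ≠ 0 ∧
      gradientAt p.rep g + (t * eval p.rep l') • gradientAt p.rep l = 0}.Finite := by
  have h1 : {t : ℂ | ∃ p ∈ V.singularLocus, eval p.rep l' ≠ 0 ∧
      gradientAt p.rep g + (t * eval p.rep l') • gradientAt p.rep l = 0} ⊆
      ⋃ p ∈ V.singularLocus, {t : ℂ | eval p.rep l' ≠ 0 ∧
        gradientAt p.rep g + (t * eval p.rep l') • gradientAt p.rep l = 0} := by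
    rintro t ⟨p, hp, ht⟩
    exact Set.mem_biUnion hp ht
  refine (hfin.biUnion fun p _ => Set.Subsingleton.finite ?_).subset h1
  rintro s ⟨hs0, hs⟩ t ⟨-, ht⟩
  have h2 : ((s - t) * eval p.rep l') • gradientAt p.rep l = 0 := by
    rw [sub_mul, sub_smul, ← add_sub_add_left_eq_sub _ _ (gradientAt p.rep g), hs, ht, sub_zero]
  exact sub_eq_zero.mp ((mul_eq_zero.mp ((smul_eq_zero.mp h2).resolve_right
    (h.gradientAt_l_ne_zero _))).resolve_right hs0)

theorem finite_bad_cubics (hfin : V.singularLocus.Finite) (hpl : V.HasPlanarSingularities)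
    (l' : PolyRing 4) {t : ℂ} (ht : ∀ p ∈ V.singularLocus, eval p.rep l' ≠ 0 →
      gradientAt p.rep g + (t * eval p.rep l') • gradientAt p.rep l ≠ 0) :
    {μ : ℂ | ∃ p ∈ V.singularLocus, eval p.rep l' ≠ 0 ∧ ¬ LinearIndependent ℂ
      ![gradientAt p.rep g + (t * eval p.rep l') • gradientAt p.rep l,
        gradientAt p.rep f + (μ * eval p.rep l') • gradientAt p.rep l]}.Finite := by
  have h1 : {μ : ℂ | ∃ p ∈ V.singularLocus, eval p.rep l' ≠ 0 ∧ ¬ LinearIndependent ℂ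
      ![gradientAt p.rep g + (t * eval p.rep l') • gradientAt p.rep l,
        gradientAt p.rep f + (μ * eval p.rep l') • gradientAt p.rep l]} ⊆
      ⋃ p ∈ V.singularLocus, {μ : ℂ | eval p.rep l' ≠ 0 ∧ ¬ LinearIndependent ℂ
      ![gradientAt p.rep g + (t * eval p.rep l') • gradientAt p.rep l,
        gradientAt p.rep f + (μ * eval p.rep l') • gradientAt p.rep l]} := by
    rintro t ⟨p, hp, ht⟩
    exact Set.mem_biUnion hp ht
  refine (hfin.biUnion fun p hp => Set.Subsingleton.finite ?_).subset h1
  rintro μ ⟨h0, hμ⟩ ν ⟨-, hν⟩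
  exact subsingleton_dependent h0 (ht p hp h0) (h.two_le_finrank_span hpl hp) hμ hν

/-- Adding multiples of `l` to the equations. -/
theorem add_mul_l {a b : PolyRing 4} (ha : a.IsHomogeneous 1) (hb : b.IsHomogeneous 2) :
    CanonicalEquations V l (g + a * l) (f + b * l) := by
  have hl := Ideal.mem_span_singleton_self l
  have h1 := h.replace_quadric (h.hq.add (ha.mul h.hl))
    (V.ideal.add_mem h.q_mem (V.ideal.mul_mem_left _ h.l_mem)) fun hg => h.q_notMem (by
      rw [show g = (g + a * l) - a * l by ring]
      exact sub_mem hg (Ideal.mul_mem_left _ _ hl))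
  refine h1.replace_cubic (h.hc.add (hb.mul h.hl))
    (V.ideal.add_mem h.c_mem (V.ideal.mul_mem_left _ h.l_mem)) fun hf => h1.c_notMem ?_
  rw [show f = (f + b * l) - b * l by ring]
  exact sub_mem hf (Ideal.mem_sup_left (Ideal.mul_mem_left _ _ hl))

/-- Smoothness along `l = 0`, away from the intersection with `l' = 0` at the singular points. -/
theorem linearIndependent_of_l_eq_zero (hV : V.IsCurve) {t μ : ℂ} {l' : PolyRing 4}
    (hp : p ∈ V.points)
    (ht : p ∈ V.singularLocus → eval p.rep l' ≠ 0 ∧ LinearIndependent ℂ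
      ![gradientAt p.rep g + (t * eval p.rep l') • gradientAt p.rep l,
        gradientAt p.rep f + (μ * eval p.rep l') • gradientAt p.rep l]) :
    LinearIndependent ℂ
      ![gradientAt p.rep g + (t * eval p.rep l') • gradientAt p.rep l,
        gradientAt p.rep f + (μ * eval p.rep l') • gradientAt p.rep l] := by
  by_cases hs : p ∈ V.singularLocus
  · exact (ht hs).2
  · exact linearIndependent_pair_add_smul (h.linearIndependent_gradientAt hV hp hs) _ _

end

theorem gradientAt_quadric {v : Fin (4 + 1) → ℂ} {t : ℂ} (hlv : eval v l = 0) :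
    gradientAt v (g + C t * (l * l')) = gradientAt v g + (t * eval v l') • gradientAt v l := by
  rw [gradientAt_add_C_mul, gradientAt_mul, hlv, zero_smul, zero_add, smul_smul]

theorem gradientAt_cubic {v m : Fin (4 + 1) → ℂ} (hlv : eval v l = 0) :
    gradientAt v (f + l * l' * ∑ i, C (m i) * X i) =
      gradientAt v f + ((∑ i, m i * v i) * eval v l') • gradientAt v l := by
  rw [gradientAt_add, gradientAt_mul, gradientAt_mul, map_mul, hlv, zero_mul, zero_smul, zero_smul,
    zero_add, zero_add, smul_smul, eval_sum_C_mul_X]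

/-- Two canonical curves of genus four whose equations differ by a hyperplane are hyperplane
sections of a smooth surface. -/
theorem exists_smooth (h : CanonicalEquations V l g f) (h' : CanonicalEquations V' l' g f)
    (hV : V.IsCurve) (hV' : V'.IsCurve) (hfin : V.singularLocus.Finite)
    (hfin' : V'.singularLocus.Finite) (hpl : V.HasPlanarSingularities)
    (hpl' : V'.HasPlanarSingularities) (hsing : V.singularLocus ∩ V'.singularLocus = ∅) :
    ∃ G F, CanonicalEquations V l G F ∧ CanonicalEquations V' l' G F ∧
      ∀ p : ℙ ℂ (Fin (4 + 1) → ℂ), eval p.rep G = 0 → eval p.rep F = 0 →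
        LinearIndependent ℂ ![gradientAt p.rep G, gradientAt p.rep F] := by
  -- The parameter avoids quadrics with a vertex off both hyperplanes and quadrics singular at a
  -- singular point of one curve off the other hyperplane.
  obtain ⟨t, -, ht⟩ := Set.Infinite.exists_notMem_finite (Set.infinite_univ (α := ℂ))
    ((finite_singular_members h.hl h'.hl h.hq).union
      ((h.finite_bad_quadrics hfin l').union (h'.finite_bad_quadrics hfin' l)))
  simp only [Set.mem_union, not_or, Set.mem_ofPred_eq, not_exists, not_and] at ht
  obtain ⟨ht1, ht2, ht3⟩ := ht
  have hM := h.finite_bad_cubics hfin hpl l' ht2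
  have hM' := h'.finite_bad_cubics hfin' hpl' l ht3
  set M : Set ℂ := {μ : ℂ | ∃ p ∈ V.singularLocus, _}
  set M' : Set ℂ := {μ : ℂ | ∃ p ∈ V'.singularLocus, _}
  -- The field generated by `T` contains all data, in particular the bad values of the linear form
  -- and the coordinates of the singular points; so a linear form with independent coefficients
  -- takes no bad value at these points.
  let T : Set ℂ := l.coeffs ∪ l'.coeffs ∪ g.coeffs ∪ f.coeffs ∪ {t} ∪ M ∪ M' ∪
    ⋃ p ∈ V.singularLocus ∪ V'.singularLocus, Set.range p.rep
  have hT : T.Finite := by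
    refine Set.Finite.union ?_ ((hfin.union hfin').biUnion fun p _ => Set.finite_range _)
    refine ((Set.Finite.union ?_ (Set.finite_singleton t)).union hM).union hM'
    exact (((Finset.finite_toSet _).union (Finset.finite_toSet _)).union
      (Finset.finite_toSet _)).union (Finset.finite_toSet _)
  let k := Subfield.closure T
  have hTk : T ⊆ k := Subfield.subset_closure
  have hk : Cardinal.mk k ≤ Cardinal.aleph0 :=
    (Subfield.cardinalMk_closure_le_max T).trans
      (max_le (Cardinal.mk_le_aleph0_iff.mpr hT.countable) le_rfl)
  obtain ⟨m, hm⟩ := exists_algebraicIndependent hk (4 + 1)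
  have hlk : IsDefinedOver k l := .of_coeffs fun c hc => hTk (by simp [T, hc])
  have hlk' : IsDefinedOver k l' := .of_coeffs fun c hc => hTk (by simp [T, hc])
  have hgk : IsDefinedOver k g := .of_coeffs fun c hc => hTk (by simp [T, hc])
  have hfk : IsDefinedOver k f := .of_coeffs fun c hc => hTk (by simp [T, hc])
  have htk : t ∈ k := hTk (by simp [T])
  have hMk : ∀ μ ∈ M, μ ∈ k := fun μ hμ => hTk (by simp [T, hμ])
  have hMk' : ∀ μ ∈ M', μ ∈ k := fun μ hμ => hTk (by simp [T, hμ])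
  have hrep : ∀ p ∈ V.singularLocus ∪ V'.singularLocus, ∀ i, p.rep i ∈ k := fun p hp i =>
    hTk (Or.inr (Set.mem_biUnion hp ⟨i, rfl⟩))
  have hL := isHomogeneous_sum_C_mul_X (n := 4) m
  have hc1 := h.add_mul_l (h'.hl.C_mul t) (h'.hl.mul hL)
  have hc2 := h'.add_mul_l (h.hl.C_mul t) (h.hl.mul hL)
  rw [show g + C t * l' * l = g + C t * (l * l') by ring,
    show f + l' * (∑ i, C (m i) * X i) * l = f + l * l' * ∑ i, C (m i) * X i by ring] at hc1
  rw [show g + C t * l * l' = g + C t * (l * l') by ring,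
    show f + l * (∑ i, C (m i) * X i) * l' = f + l * l' * ∑ i, C (m i) * X i by ring] at hc2
  refine ⟨_, _, hc1, hc2, fun p hG hF => ?_⟩
  have hnot : p ∈ V.singularLocus → p ∉ V'.singularLocus := fun h1 h2 =>
    (hsing ▸ (⟨h1, h2⟩ : p ∈ V.singularLocus ∩ V'.singularLocus) : p ∈ (∅ : Set _))
  have hgood : p ∈ V.singularLocus → eval p.rep l' ≠ 0 → LinearIndependent ℂ
      ![gradientAt p.rep g + (t * eval p.rep l') • gradientAt p.rep l,
        gradientAt p.rep f + ((∑ i, m i * p.rep i) * eval p.rep l') • gradientAt p.rep l] := by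
    intro hs h0
    by_contra hdep
    exact sum_mul_ne_of_algebraicIndependent hm p.rep_nonzero (hrep p (Or.inl hs))
      (hMk _ ⟨p, hs, h0, hdep⟩) rfl
  have hgood' : p ∈ V'.singularLocus → eval p.rep l ≠ 0 → LinearIndependent ℂ
      ![gradientAt p.rep g + (t * eval p.rep l) • gradientAt p.rep l',
        gradientAt p.rep f + ((∑ i, m i * p.rep i) * eval p.rep l) • gradientAt p.rep l'] := by
    intro hs h0
    by_contra hdep
    exact sum_mul_ne_of_algebraicIndependent hm p.rep_nonzero (hrep p (Or.inr hs))
      (hMk' _ ⟨p, hs, h0, hdep⟩) rfl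
  -- A point on both hyperplanes is treated with a curve on which it is smooth; at a singular point
  -- of a curve the other hyperplane must be avoided.
  by_cases hp : eval p.rep l = 0 ∧ (eval p.rep l' = 0 → p ∉ V.singularLocus)
  · have hpV := hc1.mem_points_iff.mpr ⟨hp.1, hG, hF⟩
    rw [gradientAt_quadric hp.1, gradientAt_cubic hp.1]
    refine h.linearIndependent_of_l_eq_zero hV hpV fun hs => ?_
    have h0 : eval p.rep l' ≠ 0 := fun h0 => hp.2 h0 hs
    exact ⟨h0, hgood hs h0⟩
  by_cases hp' : eval p.rep l' = 0 ∧ (eval p.rep l = 0 → p ∉ V'.singularLocus)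
  · have hpV := hc2.mem_points_iff.mpr ⟨hp'.1, hG, hF⟩
    rw [mul_comm l l', gradientAt_quadric hp'.1, gradientAt_cubic hp'.1]
    refine h'.linearIndependent_of_l_eq_zero hV' hpV fun hs => ?_
    have h0 : eval p.rep l ≠ 0 := fun h0 => hp'.2 h0 hs
    exact ⟨h0, hgood' hs h0⟩
  have h0 : eval p.rep l ≠ 0 ∧ eval p.rep l' ≠ 0 := by
    by_contra hcon
    simp only [not_and, not_not, Classical.not_imp] at hp hp' hcon
    by_cases h1 : eval p.rep l = 0
    · exact hnot (hp h1).2 (hp' (hp h1).1).2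
    · exact h1 (hp' (hcon h1)).1
  -- Off both hyperplanes the gradient of the quadric is nonzero, so dependence means tangency, and
  -- the generic linear form allows it only where `l l' = 0`.
  have hGne : gradientAt p.rep (g + C t * (l * l')) ≠ 0 := ht1 p.rep h0.1 h0.2
  by_contra hdep
  rw [LinearIndependent.pair_iff' hGne] at hdep
  push Not at hdep
  obtain ⟨μ, hμ⟩ := hdep
  have hz := eval_eq_zero_of_tangent hm (hgk.add ((IsDefinedOver.C htk).mul (hlk.mul hlk'))) hfk
    (hlk.mul hlk') hc1.hq hc1.g_ne_zero hc1.hc p.rep_nonzero hG hF hμ.symm (h.hl.mul h'.hl)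
  rw [map_mul] at hz
  exact (mul_ne_zero h0.1 h0.2) hz

end CanonicalEquations

/-! ### Alternating maps on a five-dimensional space -/

section Alternating

variable {F : Type*} [Field F]

theorem Matrix.exists_det_updateRow_ne_zero {ι : Type*} [Fintype ι] [DecidableEq ι]
    {M : Matrix ι ι F} (h : M.det ≠ 0) (r : ι) : ∃ a, (M.updateRow r (Pi.single a 1)).det ≠ 0 := by
  by_contra! h0
  apply h
  rw [M.det_eq_sum_mul_adjugate_row r]
  refine Finset.sum_eq_zero fun a _ => ?_
  rw [Matrix.adjugate_apply, h0, mul_zero]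

/-- After extension to a basis, Laplace expansion along a row shows that this row can be exchanged
for a standard basis vector. -/
theorem exists_det_ne_zero {y z : Fin 5 → F} (h : LinearIndependent F ![y, z]) :
    ∃ a b e : Fin 5, (Matrix.of ![y, z, Pi.single a 1, Pi.single b 1, Pi.single e 1]).det ≠ 0 := by
  have hfin : Module.finrank F (Fin 5 → F) = 5 := by simp
  obtain ⟨u, hu⟩ := exists_linearIndependent_cons_of_lt_finrank h (by rw [hfin]; norm_num)
  obtain ⟨v, hv⟩ := exists_linearIndependent_cons_of_lt_finrank hu (by rw [hfin]; norm_num)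
  obtain ⟨w, hw⟩ := exists_linearIndependent_cons_of_lt_finrank hv (by rw [hfin]; norm_num)
  have h1 : (Matrix.of ![y, z, u, v, w]).det ≠ 0 := by
    rw [← isUnit_iff_ne_zero, ← Matrix.isUnit_iff_isUnit_det,
      ← Matrix.linearIndependent_rows_iff_isUnit]
    have h2 := hw.comp ![3, 4, 2, 1, 0] (by decide)
    convert! h2 using 1
    ext r i
    fin_cases r <;> rfl
  obtain ⟨a, ha⟩ := Matrix.exists_det_updateRow_ne_zero h1 2
  obtain ⟨b, hb⟩ := Matrix.exists_det_updateRow_ne_zero ha 3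
  obtain ⟨e, he⟩ := Matrix.exists_det_updateRow_ne_zero hb 4
  refine ⟨a, b, e, ?_⟩
  convert! he using 2
  ext r i
  fin_cases r <;> simp [Matrix.updateRow_apply]

variable {E M : Type*} [AddCommGroup E] [Module F E] [AddCommGroup M] [Module F M]

theorem alternatingMap_ext (B : Module.Basis (Fin 5) F E) {f g : E [⋀^Fin 3]→ₗ[F] M}
    (hf : ∀ v i, v i = B 0 ∨ v i = B 1 → f v = 0) (hg : ∀ v i, v i = B 0 ∨ v i = B 1 → g v = 0)
    (h : f ![B 2, B 3, B 4] = g ![B 2, B 3, B 4]) : f = g := by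
  refine Module.Basis.ext_alternating B fun v hv => ?_
  by_cases h01 : ∃ i, v i = 0 ∨ v i = 1
  · obtain ⟨i, hi⟩ := h01
    have hi' : B (v i) = B 0 ∨ B (v i) = B 1 := hi.imp (congrArg B) (congrArg B)
    rw [hf _ i hi', hg _ i hi']
  · push Not at h01
    have hge : ∀ i, 2 ≤ (v i).val := by
      intro i
      have := h01 i
      omega
    let s : Fin 3 → Fin 3 := fun i => ⟨(v i).val - 2, by have := hge i; omega⟩
    have hs : Function.Injective s := by
      intro i j hij
      apply hv
      have h1 := congrArg Fin.val hij
      simp only [s] at h1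
      have h2 := hge i
      have h3 := hge j
      omega
    let σ : Equiv.Perm (Fin 3) := Equiv.ofBijective s (Finite.injective_iff_bijective.mp hs)
    have hσ : (fun i => B (v i)) = ![B 2, B 3, B 4] ∘ σ := by
      have h3 : ∀ j : Fin 3, ![B 2, B 3, B 4] j = B (j.addNat 2) := by
        intro j
        fin_cases j <;> rfl
      ext i
      rw [Function.comp_apply, h3]
      congr 1
      ext
      change _ = (v i).val - 2 + 2
      have := hge i
      omega
    rw [hσ, AlternatingMap.map_perm, AlternatingMap.map_perm, h]

theorem detRowAlternating_curryLeft {n : ℕ} (y z : Fin (n + 2) → F) (v : Fin n → Fin (n + 2) → F) :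
    (((Matrix.detRowAlternating : (Fin (n + 2) → F) [⋀^Fin (n + 2)]→ₗ[F] F).curryLeft y).curryLeft
      z) v = (Matrix.of (Matrix.vecCons y (Matrix.vecCons z v))).det := rfl

/-- An alternating three-form on a five-dimensional space that kills `y` and `z` comes from the
three-dimensional quotient, so it is determined by one value. The determinant with first rows `y`
and `z` is such a form. -/
theorem exists_eq_det_smul {y z : Fin 5 → F} {u : Fin 3 → Fin 5 → F}
    (hdet : (Matrix.of ![y, z, u 0, u 1, u 2]).det ≠ 0) (Ψ : (Fin 5 → F) [⋀^Fin 3]→ₗ[F] M)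
    (hΨ : ∀ v i, v i = y ∨ v i = z → Ψ v = 0) :
    ∃ η : M, ∀ v, Ψ v = (Matrix.of ![y, z, v 0, v 1, v 2]).det • η := by
  let D : (Fin 5 → F) [⋀^Fin 3]→ₗ[F] F :=
    ((Matrix.detRowAlternating : (Fin (3 + 2) → F) [⋀^Fin (3 + 2)]→ₗ[F] F).curryLeft y).curryLeft z
  have hD : ∀ v, D v = (Matrix.of ![y, z, v 0, v 1, v 2]).det := by
    intro v
    have hv : Matrix.vecCons y (Matrix.vecCons z v) = ![y, z, v 0, v 1, v 2] := by
      ext r i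
      fin_cases r <;> rfl
    have h1 := detRowAlternating_curryLeft y z v
    rw [hv] at h1
    exact h1
  have hli := Matrix.linearIndependent_rows_iff_isUnit.mpr
    ((Matrix.isUnit_iff_isUnit_det _).mpr (isUnit_iff_ne_zero.mpr hdet))
  let B := basisOfLinearIndependentOfCardEqFinrank hli (by simp)
  have hB : ∀ r, B r = ![y, z, u 0, u 1, u 2] r := fun r =>
    congrFun (coe_basisOfLinearIndependentOfCardEqFinrank hli (by simp)) r
  let G : (Fin 5 → F) [⋀^Fin 3]→ₗ[F] M :=
    (LinearMap.toSpanSingleton F M ((Matrix.of ![y, z, u 0, u 1, u 2]).det⁻¹ • Ψ u)).compAlternatingMap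
      D
  have hG : ∀ v, G v = D v • ((Matrix.of ![y, z, u 0, u 1, u 2]).det⁻¹ • Ψ u) := fun v => rfl
  refine ⟨(Matrix.of ![y, z, u 0, u 1, u 2]).det⁻¹ • Ψ u, fun v => ?_⟩
  rw [← hD, ← hG]
  have hu : ![B 2, B 3, B 4] = u := by
    ext i
    fin_cases i
    · exact congrFun (hB 2) _
    · exact congrFun (hB 3) _
    · exact congrFun (hB 4) _
  refine DFunLike.congr_fun (alternatingMap_ext B (f := Ψ) (g := G) ?_ ?_ ?_) v
  · intro v i hi
    rw [hB, hB] at hi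
    exact hΨ v i hi
  · intro v i hi
    rw [hB, hB] at hi
    have h0 : D v = 0 := by
      rw [hD]
      rcases hi with hi | hi
      · fin_cases i
        · exact Matrix.det_zero_of_row_eq (i := 0) (j := 2) (by decide) hi.symm
        · exact Matrix.det_zero_of_row_eq (i := 0) (j := 3) (by decide) hi.symm
        · exact Matrix.det_zero_of_row_eq (i := 0) (j := 4) (by decide) hi.symm
      · fin_cases i
        · exact Matrix.det_zero_of_row_eq (i := 1) (j := 2) (by decide) hi.symm
        · exact Matrix.det_zero_of_row_eq (i := 1) (j := 3) (by decide) hi.symm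
        · exact Matrix.det_zero_of_row_eq (i := 1) (j := 4) (by decide) hi.symm
    rw [hG, h0, zero_smul]
  · rw [hu, hG, hD, smul_smul, mul_inv_cancel₀ hdet, one_smul]

variable {W : Type*} [AddCommGroup W] [Module F W]

/-- The contraction of a three-form with a vector field, as an alternating map. -/
def contraction (ξ : E →ₗ[F] F) (δ : E →ₗ[F] W) (w : W →ₗ[F] W →ₗ[F] M) (hw : ∀ a, w a a = 0) :
    E [⋀^Fin 3]→ₗ[F] M where
  toFun v := ξ (v 0) • w (δ (v 1)) (δ (v 2)) - ξ (v 1) • w (δ (v 0)) (δ (v 2)) +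
    ξ (v 2) • w (δ (v 0)) (δ (v 1))
  map_update_add' := by
    intro inst v i a b
    obtain rfl := Subsingleton.elim inst (instDecidableEqFin 3)
    obtain rfl | rfl | rfl : i = 0 ∨ i = 1 ∨ i = 2 := by omega
    all_goals
      simp
      module
  map_update_smul' := by
    intro inst v i a b
    obtain rfl := Subsingleton.elim inst (instDecidableEqFin 3)
    obtain rfl | rfl | rfl : i = 0 ∨ i = 1 ∨ i = 2 := by omega
    all_goals
      simp
      module
  map_eq_zero_of_eq' := by
    intro v i j h hij
    have hswap : ∀ a b, w a b = - w b a := by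
      intro a b
      have := hw (a + b)
      simp only [map_add, LinearMap.add_apply, hw, zero_add, add_zero] at this
      exact eq_neg_of_add_eq_zero_right this
    fin_cases i <;> fin_cases j <;> simp at hij h <;> simp [h, hw]
    all_goals
      rw [hswap]
      module

end Alternating

/-! ### Exterior products and derivations -/

section Wedge

theorem update_cons_one {M : Type*} (a b c : M) : Function.update ![a, b] 1 c = ![a, c] := by
  ext i
  fin_cases i <;> rfl

variable (R M : Type*) [CommRing R] [AddCommGroup M] [Module R M]

/-- The exterior product of two elements of a module, as a bilinear map. -/
noncomputable def wedge : M →ₗ[R] M →ₗ[R] ⋀[R]^2 M :=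
  LinearMap.mk₂ R (fun a b => exteriorPower.ιMulti R 2 ![a, b])
    (fun a a' b => (exteriorPower.ιMulti R 2).map_vecCons_add ![b] a a')
    (fun c a b => (exteriorPower.ιMulti R 2).map_vecCons_smul ![b] c a)
    (fun a b b' => by
      have h := (exteriorPower.ιMulti R 2).map_update_add ![a, b] 1 b b'
      rwa [update_cons_one, update_cons_one, update_cons_one] at h)
    (fun c a b => by
      have h := (exteriorPower.ιMulti R 2).map_update_smul ![a, b] 1 c b
      rwa [update_cons_one, update_cons_one] at h)

variable {R M}

theorem wedge_apply (a b : M) : wedge R M a b = exteriorPower.ιMulti R 2 ![a, b] := rfl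

theorem wedge_self (a : M) : wedge R M a a = 0 :=
  (exteriorPower.ιMulti R 2).map_eq_zero_of_eq ![a, a] (i := 0) (j := 1) rfl (by decide)

theorem exists_map_wedge (φ ψ : M →ₗ[R] R) :
    ∃ L : ⋀[R]^2 M →ₗ[R] R, ∀ a b, L (wedge R M a b) = φ a * ψ b - ψ a * φ b := by
  refine ⟨exteriorPower.alternatingMapLinearEquiv
    ((Matrix.detRowAlternating (n := Fin 2) (R := R)).compLinearMap (LinearMap.pi ![φ, ψ])),
    fun a b => ?_⟩
  rw [wedge_apply, exteriorPower.alternatingMapLinearEquiv_apply_ιMulti]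
  exact Matrix.det_fin_two _

end Wedge

section Triple

variable {F E W M ι : Type*} [Field F] [AddCommGroup E] [Module F E] [AddCommGroup W] [Module F W]
  [AddCommGroup M] [Module F M] (w : W →ₗ[F] W →ₗ[F] M)

/-- The three-form `dx_a ∧ dx_b ∧ dx_e`, contracted with the Euler vector field. -/
def eulerContraction (x : ι → F) (dx : ι → W) (a b e : ι) : M :=
  x a • w (dx b) (dx e) - x b • w (dx a) (dx e) + x e • w (dx a) (dx b)

/-- With `u` in the role of `dc`, the Leibniz terms cancel by alternation, and the contraction has
weight three. -/
theorem eulerContraction_smul (hw : ∀ a, w a a = 0) (x : ι → F) (dx : ι → W) (c : F) (u : W)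
    (a b e : ι) : eulerContraction w (fun i => c * x i) (fun i => c • dx i + x i • u) a b e =
      c ^ 3 • eulerContraction w x dx a b e := by
  have hswap : ∀ a, w a u = - w u a := by
    intro a
    have := hw (a + u)
    simp only [map_add, LinearMap.add_apply, hw, zero_add, add_zero] at this
    exact eq_neg_of_add_eq_zero_right this
  simp only [eulerContraction, map_add, map_smul, LinearMap.add_apply, LinearMap.smul_apply, hw,
    hswap]
  module

theorem eulerContraction_of_eq_one {x : ι → F} {dx : ι → W} {a : ι} (ha : x a = 1) (hda : dx a = 0)
    (b e : ι) : eulerContraction w x dx a b e = w (dx b) (dx e) := by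
  simp [eulerContraction, ha, hda]

theorem eulerContraction_mem {x : ι → F} {dx : ι → W} {N : AddSubgroup M}
    (h : ∀ a b e, x a • w (dx b) (dx e) ∈ N) (a b e : ι) : eulerContraction w x dx a b e ∈ N :=
  N.add_mem (N.sub_mem (h a b e) (h b a e)) (h e a b)

theorem contraction_single (hw : ∀ a, w a a = 0) [Fintype ι] [DecidableEq ι] (x : ι → F)
    (dx : ι → W) (a b e : ι) :
    contraction (Fintype.linearCombination F x) (Fintype.linearCombination F dx) w hw
      ![Pi.single a 1, Pi.single b 1, Pi.single e 1] = eulerContraction w x dx a b e := by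
  change Fintype.linearCombination F x (Pi.single a 1) •
      w (Fintype.linearCombination F dx (Pi.single b 1))
        (Fintype.linearCombination F dx (Pi.single e 1)) -
    Fintype.linearCombination F x (Pi.single b 1) •
      w (Fintype.linearCombination F dx (Pi.single a 1))
        (Fintype.linearCombination F dx (Pi.single e 1)) +
    Fintype.linearCombination F x (Pi.single e 1) •
      w (Fintype.linearCombination F dx (Pi.single a 1))
        (Fintype.linearCombination F dx (Pi.single b 1)) = _
  simp only [Fintype.linearCombination_apply_single, one_smul]
  rfl

theorem contraction_eq_zero {ξ : E →ₗ[F] F} {δ : E →ₗ[F] W} (hw : ∀ a, w a a = 0) {v : Fin 3 → E}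
    {i : Fin 3} (hξ : ξ (v i) = 0) (hδ : δ (v i) = 0) : contraction ξ δ w hw v = 0 := by
  change ξ (v 0) • w (δ (v 1)) (δ (v 2)) - ξ (v 1) • w (δ (v 0)) (δ (v 2)) +
    ξ (v 2) • w (δ (v 0)) (δ (v 1)) = 0
  obtain rfl | rfl | rfl : i = 0 ∨ i = 1 ∨ i = 2 := by omega
  all_goals simp [hξ, hδ]

end Triple

theorem Derivation.map_aeval_eq_sum {k A M σ : Type*} [CommRing k] [CommRing A] [Algebra k A]
    [AddCommGroup M] [Module k M] [Module A M] [Fintype σ] (D : Derivation k A M) (y : σ → A)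
    (p : MvPolynomial σ k) : D (aeval y p) = ∑ i, aeval y (pderiv i p) • D (y i) := by
  classical
  induction p using MvPolynomial.induction_on with
  | C c => simp
  | add p q hp hq => simp only [map_add, hp, hq, add_smul, Finset.sum_add_distrib]
  | mul_X p j hp =>
    simp only [map_mul, aeval_X, Derivation.leibniz, hp, pderiv_X, smul_eq_mul, map_add, add_smul,
      Finset.sum_add_distrib, Finset.smul_sum, smul_smul]
    congr 1
    rw [Finset.sum_eq_single j]
    · simp
    · intro i _ hij
      simp [Ne.symm hij]
    · simp

theorem Derivation.bilin_aeval_mem {k A M N σ : Type*} [CommRing k] [CommRing A] [Algebra k A]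
    [AddCommGroup M] [Module k M] [Module A M] [AddCommGroup N] [Module A N] [Fintype σ]
    (D : Derivation k A M) (w : M →ₗ[A] M →ₗ[A] N) (y : σ → A) {S : AddSubgroup N}
    (h : ∀ (r : MvPolynomial σ k) (i j), aeval y r • w (D (y i)) (D (y j)) ∈ S)
    (p q : MvPolynomial σ k) : w (D (aeval y p)) (D (aeval y q)) ∈ S := by
  rw [D.map_aeval_eq_sum, D.map_aeval_eq_sum]
  simp only [map_sum, LinearMap.sum_apply]
  refine sum_mem fun j _ => sum_mem fun i _ => ?_
  rw [LinearMap.map_smul₂, _root_.map_smul, smul_smul, ← map_mul]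
  exact h _ _ _

theorem MvPolynomial.IsHomogeneous.aeval_const_mul {k A σ : Type*} [CommRing k] [CommRing A]
    [Algebra k A] [Fintype σ] {f : MvPolynomial σ k} {d : ℕ} (hf : f.IsHomogeneous d) (c : A)
    (x : σ → A) : MvPolynomial.aeval (fun i => c * x i) f =
    c ^ d * MvPolynomial.aeval x f := by
  rw [aeval_def, eval₂_eq', aeval_def, eval₂_eq', Finset.mul_sum]
  refine Finset.sum_congr rfl fun s hs => ?_
  have hd : ∑ i, s i = d := by
    rw [hf.degree_eq_sum_deg_support hs]
    exact (Finset.sum_subset (Finset.subset_univ _) (by simp)).symm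
  simp only [mul_pow, Finset.prod_mul_distrib, Finset.prod_pow_eq_pow_sum, hd]
  ring

theorem map_smul_mem_of_mem_span {P R M : Type*} [CommRing P] [CommRing R] [AddCommGroup M]
    [Module R M] (φ : P →+* R) {N : AddSubgroup M} (hN : ∀ q, ∀ ω ∈ N, φ q • ω ∈ N) {η : M}
    {S : Set P} (hS : ∀ s ∈ S, φ s • η ∈ N) {v : P} (hv : v ∈ Ideal.span S) : φ v • η ∈ N := by
  induction hv using Submodule.span_induction with
  | mem v hv => exact hS v hv
  | zero => rw [map_zero, zero_smul]; exact N.zero_mem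
  | add a b _ _ ha hb => rw [map_add, add_smul]; exact N.add_mem ha hb
  | smul a v _ hv => rw [smul_eq_mul, map_mul, mul_smul]; exact hN a _ hv

/-- The minors of the Jacobian matrix of two polynomials, indexed by the complementary sets of
variables. -/
noncomputable def jacobianMinor (G F : PolyRing 4) (T : Fin 5 × Fin 5 × Fin 5) : PolyRing 4 :=
  (Matrix.of ![fun i => pderiv i G, fun i => pderiv i F, Pi.single T.1 1, Pi.single T.2.1 1,
    Pi.single T.2.2 1] : Matrix (Fin 5) (Fin 5) (PolyRing 4)).det

theorem isHomogeneous_jacobianMinor {G F : PolyRing 4} (hG : G.IsHomogeneous 2)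
    (hF : F.IsHomogeneous 3) (T : Fin 5 × Fin 5 × Fin 5) :
        (jacobianMinor G F T).IsHomogeneous 3 := by
  have hs : ∀ a i : Fin 5, ((Pi.single a 1 : Fin 5 → PolyRing 4) i).IsHomogeneous 0 := by
    intro a i
    rw [Pi.single_apply]
    split_ifs
    · exact isHomogeneous_one _ _
    · exact isHomogeneous_zero _ _ _
  have h := isHomogeneous_det (A := Matrix.of ![fun i => pderiv i G, fun i => pderiv i F,
    Pi.single T.1 1, Pi.single T.2.1 1, Pi.single T.2.2 1]) (d := ![1, 2, 0, 0, 0]) (by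
      intro r i
      fin_cases r
      · exact hG.pderiv
      · exact hF.pderiv
      · exact hs _ _
      · exact hs _ _
      · exact hs _ _)
  exact h

theorem map_jacobianMinor {S : Type*} [CommRing S] (φ : PolyRing 4 →+* S) (G F : PolyRing 4)
    (a b e : Fin 5) : φ (jacobianMinor G F (a, b, e)) =
      (Matrix.of ![fun i => φ (pderiv i G), fun i => φ (pderiv i F), Pi.single a 1, Pi.single b 1,
        Pi.single e 1] : Matrix (Fin 5) (Fin 5) S).det := by
  rw [jacobianMinor, RingHom.map_det]
  congr 1
  have hs : ∀ a i : Fin 5, φ ((Pi.single a 1 : Fin 5 → PolyRing 4) i) =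
      (Pi.single a 1 : Fin 5 → S) i := by
    intro a i
    simp only [Pi.single_apply]
    split_ifs <;> simp
  ext r i
  fin_cases r
  · rfl
  · rfl
  · exact hs a i
  · exact hs b i
  · exact hs e i

/-- The determinant provides functionals dual to `dx_a`, `dx_b`, `dx_e`. Pairing a vanishing
contraction with two of them at a time gives `x_a = x_b = x_e = 0`, and together with `hy` and `hz`
this forces `x = 0`. -/
theorem eulerContraction_wedge_ne_zero {k W : Type*} [Field k] [AddCommGroup W] [Module k W]
    {x : Fin 5 → k} {dx : Fin 5 → W} {y z : Fin 5 → k} {a b e : Fin 5}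
    (hdet : (Matrix.of ![y, z, Pi.single a 1, Pi.single b 1, Pi.single e 1]).det ≠ 0)
    (hy : ∑ i, y i * x i = 0) (hz : ∑ i, z i * x i = 0) (hx : x ≠ 0)
    (h : ∀ p : Fin 5 → k, ∑ i, y i * p i = 0 → ∑ i, z i * p i = 0 →
      ∃ φ : W →ₗ[k] k, ∀ i, φ (dx i) = p i) :
    eulerContraction (wedge k W) x dx a b e ≠ 0 := by
  intro h0
  set A : Matrix (Fin 5) (Fin 5) k :=
    Matrix.of ![y, z, Pi.single a 1, Pi.single b 1, Pi.single e 1] with hA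
  have hmul : ∀ p, A.mulVec p = ![∑ i, y i * p i, ∑ i, z i * p i, p a, p b, p e] := by
    intro p
    ext r
    fin_cases r
    · rfl
    · rfl
    · exact single_one_dotProduct a p
    · exact single_one_dotProduct b p
    · exact single_one_dotProduct e p
  have hunit : IsUnit A := (Matrix.isUnit_iff_isUnit_det A).mpr (isUnit_iff_ne_zero.mpr hdet)
  have hex : ∀ s t u : k, ∃ φ : W →ₗ[k] k, φ (dx a) = s ∧ φ (dx b) = t ∧ φ (dx e) = u := by
    intro s t u
    obtain ⟨p, hp⟩ := (Matrix.mulVec_surjective_iff_isUnit.mpr hunit) ![0, 0, s, t, u]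
    rw [hmul] at hp
    obtain ⟨φ, hφ⟩ := h p (congrFun hp 0) (congrFun hp 1)
    exact ⟨φ, (hφ a).trans (congrFun hp 2), (hφ b).trans (congrFun hp 3),
      (hφ e).trans (congrFun hp 4)⟩
  obtain ⟨φ, φa, φb, φe⟩ := hex 1 0 0
  obtain ⟨ψ, ψa, ψb, ψe⟩ := hex 0 1 0
  obtain ⟨χ, χa, χb, χe⟩ := hex 0 0 1
  have key : ∀ α β : W →ₗ[k] k,
      x a * (α (dx b) * β (dx e) - β (dx b) * α (dx e)) -
        x b * (α (dx a) * β (dx e) - β (dx a) * α (dx e)) +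
        x e * (α (dx a) * β (dx b) - β (dx a) * α (dx b)) = 0 := by
    intro α β
    obtain ⟨L, hL⟩ := exists_map_wedge α β
    have h1 := congrArg L h0
    simpa only [eulerContraction, map_add, map_sub, map_smul, hL, smul_eq_mul, map_zero] using h1
  have hxa : x a = 0 := by simpa [ψa, ψb, ψe, χa, χb, χe] using key ψ χ
  have hxb : x b = 0 := by simpa [φa, φb, φe, χa, χb, χe] using key φ χ
  have hxe : x e = 0 := by simpa [ψa, ψb, ψe, φa, φb, φe] using key φ ψ
  apply hx
  apply Matrix.mulVec_injective_of_isUnit hunit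
  rw [hmul, hy, hz, hxa, hxb, hxe, Matrix.mulVec_zero]
  ext r
  fin_cases r <;> rfl

namespace ProjVariety

variable {V : ProjVariety 4} {G F : PolyRing 4}

/-! ### Two-forms on a complete intersection surface -/

theorem aeval_coord (p : PolyRing 4) : aeval V.coord p = V.form p :=
  (DFunLike.congr_fun (aeval_unique V.formHom) p).symm

/-- The differentials of the homogeneous coordinates. -/
noncomputable def dCoord (V : ProjVariety 4) (i : Fin (4 + 1)) : Ω[V.K⁄ℂ] :=
  KaehlerDifferential.D ℂ V.K (V.coord i)

theorem D_form (p : PolyRing 4) : KaehlerDifferential.D ℂ V.K (V.form p) =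
    ∑ i, V.form (pderiv i p) • V.dCoord i := by
  have h := (KaehlerDifferential.D ℂ V.K).map_aeval_eq_sum V.coord p
  simp only [aeval_coord] at h
  exact h

theorem sum_form_pderiv_mul_coord {p : PolyRing 4} {d : ℕ} (hp : p.IsHomogeneous d)
    (hV : p ∈ V.ideal) : ∑ i, V.form (pderiv i p) * V.coord i = 0 := by
  have h := congrArg V.formHom hp.sum_X_mul_pderiv
  have h1 : V.formHom (d • p) = 0 := V.form_eq_zero.mpr (nsmul_mem hV d)
  rw [map_sum, h1] at h
  rw [← h]
  refine Finset.sum_congr rfl fun i _ => ?_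
  rw [map_mul]
  exact mul_comm _ _

theorem exists_notMem_jacobianMinor {i₀ : V.Chart}
    (h : ∀ i, ∃ N : ℕ, (X i : PolyRing 4) ^ N ∈ V.ideal ⊔ Ideal.span (Set.range
        (jacobianMinor G F))) :
    ∃ T, jacobianMinor G F T ∉ V.ideal := by
  by_contra! h0
  obtain ⟨N, hN⟩ := h i₀.1
  have h1 : Ideal.span (Set.range (jacobianMinor G F)) ≤ V.ideal := by
    rw [Ideal.span_le]
    rintro _ ⟨T, rfl⟩
    exact h0 T
  rw [sup_eq_left.mpr h1] at hN
  exact i₀.2 (V.prime.mem_of_pow_mem N hN)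

/-- The contraction kills the gradients of `G` and `F`: the Euler field does so by Euler's formula,
the differential because `dG = dF = 0` on the surface. Such a three-form is proportional to the
determinant with these two gradients as rows; the factor `η` is the residue form. -/
theorem exists_eulerContraction_eq (hG : G.IsHomogeneous 2) (hF : F.IsHomogeneous 3)
    (hGV : G ∈ V.ideal) (hFV : F ∈ V.ideal) {a b e : Fin 5}
    (hT : jacobianMinor G F (a, b, e) ∉ V.ideal) :
    ∃ η : ⋀[V.K]^2 Ω[V.K⁄ℂ], ∀ a b e : Fin 5,
      eulerContraction (wedge V.K Ω[V.K⁄ℂ]) V.coord V.dCoord a b e =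
        V.form (jacobianMinor G F (a, b, e)) • η := by
  have hform : ∀ a b e : Fin 5, V.form (jacobianMinor G F (a, b, e)) = _ :=
    map_jacobianMinor V.formHom.toRingHom G F
  have hdet := mt V.form_eq_zero.mp hT
  rw [hform] at hdet
  have hker : ∀ (p : PolyRing 4) (d : ℕ), p.IsHomogeneous d → p ∈ V.ideal →
      Fintype.linearCombination V.K V.coord (fun i => V.form (pderiv i p)) = 0 ∧
      Fintype.linearCombination V.K V.dCoord (fun i => V.form (pderiv i p)) = 0 := by
    intro p d hp hpV
    constructor
    · exact (Fintype.linearCombination_apply V.K V.coord _).trans (sum_form_pderiv_mul_coord hp hpV)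
    · rw [Fintype.linearCombination_apply, ← D_form, V.form_eq_zero.mpr hpV, map_zero]
  obtain ⟨η, hη⟩ := exists_eq_det_smul (u := ![Pi.single a 1, Pi.single b 1, Pi.single e 1]) hdet
    (contraction (Fintype.linearCombination V.K V.coord) (Fintype.linearCombination V.K V.dCoord)
      (wedge V.K Ω[V.K⁄ℂ]) wedge_self) (by
      rintro v i (hi | hi)
      · exact contraction_eq_zero _ _ (hi ▸ (hker G 2 hG hGV).1) (hi ▸ (hker G 2 hG hGV).2)
      · exact contraction_eq_zero _ _ (hi ▸ (hker F 3 hF hFV).1) (hi ▸ (hker F 3 hF hFV).2))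
  refine ⟨η, fun a b e => ?_⟩
  rw [hform, ← contraction_single (wedge V.K Ω[V.K⁄ℂ]) wedge_self]
  exact hη ![Pi.single a 1, Pi.single b 1, Pi.single e 1]

theorem eulerContraction_ne_zero (hG : G.IsHomogeneous 2) (hF : F.IsHomogeneous 3)
    (hI : V.ideal = Ideal.span (Set.range ![G, F]))
    (i₀ : V.Chart) {a b e : Fin 5} (hT : jacobianMinor G F (a, b, e) ∉ V.ideal) :
    eulerContraction (wedge V.K Ω[V.K⁄ℂ]) V.coord V.dCoord a b e ≠ 0 := by
  have hdet := mt V.form_eq_zero.mp hT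
  rw [show V.form (jacobianMinor G F (a, b, e)) = _ from
    map_jacobianMinor V.formHom.toRingHom G F a b e] at hdet
  have hGV : G ∈ V.ideal := hI ▸ Ideal.subset_span ⟨0, rfl⟩
  have hFV : F ∈ V.ideal := hI ▸ Ideal.subset_span ⟨1, rfl⟩
  refine eulerContraction_wedge_ne_zero hdet (sum_form_pderiv_mul_coord hG hGV)
    (sum_form_pderiv_mul_coord hF hFV) (fun h => V.coord_ne_zero i₀ (congrFun h _)) ?_
  intro p hp1 hp2
  obtain ⟨D, hD⟩ := exists_derivation p (sum_form_pderiv_eq_zero hI (by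
    intro r
    fin_cases r
    · exact hp1
    · exact hp2))
  refine ⟨D.liftKaehlerDifferential, fun i => ?_⟩
  rw [dCoord, Derivation.liftKaehlerDifferential_comp_D, coord, hD, Finset.sum_eq_single i]
  · rw [pderiv_X_self, form_one, one_mul]
  · intro j _ hj
    rw [pderiv_X_of_ne (Ne.symm hj), form_zero, zero_mul]
  · simp

end ProjVariety

/-! ### Generation of the regular two-forms on the standard charts -/

namespace ProjVariety

variable {V : ProjVariety 4} {G F : PolyRing 4}

/-- The affine coordinates on a standard chart. -/
noncomputable def affineCoord (i : V.Chart) (j : Fin (4 + 1)) : V.K := (V.coord i.1)⁻¹ * V.coord j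

theorem affineCoord_self (i : V.Chart) : affineCoord i i.1 = 1 :=
  inv_mul_cancel₀ (V.coord_ne_zero i)

theorem denom_singleton (i : V.Chart) : V.denom ![i] = X i.1 := by
  simp [denom]

theorem affineCoord_mem (i : V.Chart) (j : Fin (4 + 1)) : affineCoord i j ∈ V.chartRing i := by
  refine ⟨1, 1, X j, isHomogeneous_X ℂ j, by norm_num, ?_⟩
  rw [pow_one, denom_singleton, affineCoord]
  change (V.coord i.1)⁻¹ * V.coord j * V.coord i.1 = V.coord j
  rw [mul_right_comm, inv_mul_cancel₀ (V.coord_ne_zero i), one_mul]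

theorem aeval_affineCoord {i : V.Chart} {p : PolyRing 4} {d : ℕ} (hp : p.IsHomogeneous d) :
    aeval (affineCoord i) p = (V.coord i.1)⁻¹ ^ d * V.form p := by
  rw [← aeval_coord]
  exact hp.aeval_const_mul _ _

theorem aeval_affineCoord_mem (i : V.Chart) (p : PolyRing 4) :
    aeval (affineCoord i) p ∈ V.chartRing i := by
  induction p using MvPolynomial.induction_on with
  | C c => rw [aeval_C]; exact (V.chartRing i).algebraMap_mem c
  | add p q hp hq => rw [map_add]; exact add_mem hp hq
  | mul_X p j hp => rw [map_mul, aeval_X]; exact mul_mem hp (affineCoord_mem i j)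

theorem exists_aeval_affineCoord {i : V.Chart} {a : V.K} (ha : a ∈ V.chartRing i) :
    ∃ p : PolyRing 4, a = aeval (affineCoord i) p := by
  obtain ⟨k, d, q, hq, hd, h⟩ := ha
  refine ⟨q, ?_⟩
  have hdk : d = k := by
    have : (d : ℤ) = k := by rw [hd]; norm_num
    exact_mod_cast this
  rw [aeval_affineCoord hq, ← h, hdk, denom_singleton, form_pow, inv_pow]
  have h0 : V.coord i.1 ^ k ≠ 0 := pow_ne_zero k (V.coord_ne_zero i)
  exact ((mul_comm _ _).trans (mul_inv_cancel_right₀ h0 a)).symm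

theorem aeval_affineCoord_eq_zero (hG : G.IsHomogeneous 2) (hF : F.IsHomogeneous 3)
    (hI : V.ideal = Ideal.span (Set.range ![G, F])) (i : V.Chart) {p : PolyRing 4}
    (hp : p ∈ V.ideal) : aeval (affineCoord i) p = 0 := by
  have h1 : V.ideal ≤ RingHom.ker (aeval (R := ℂ) (affineCoord i)) := by
    have hGV : G ∈ V.ideal := hI ▸ Ideal.subset_span ⟨0, rfl⟩
    have hFV : F ∈ V.ideal := hI ▸ Ideal.subset_span ⟨1, rfl⟩
    refine hI.le.trans (Ideal.span_le.mpr ?_)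
    rintro _ ⟨r, rfl⟩
    fin_cases r
    · change aeval (affineCoord i) G = 0
      rw [aeval_affineCoord hG, V.form_eq_zero.mpr hGV, mul_zero]
    · change aeval (affineCoord i) F = 0
      rw [aeval_affineCoord hF, V.form_eq_zero.mpr hFV, mul_zero]
  exact h1 hp

theorem aeval_smul_mem (i : V.Chart) (q : PolyRing 4) {ω : ⋀[V.K]^2 Ω[V.K⁄ℂ]}
    (hω : ω ∈ V.regularTwoForms i) : aeval (affineCoord i) q • ω ∈ V.regularTwoForms i :=
  (V.regularTwoForms i).smul_mem ⟨_, aeval_affineCoord_mem i q⟩ hω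

section Generator

variable {η : ⋀[V.K]^2 Ω[V.K⁄ℂ]} (hη : ∀ a b e : Fin 5,
  eulerContraction (wedge V.K Ω[V.K⁄ℂ]) V.coord V.dCoord a b e =
    V.form (jacobianMinor G F (a, b, e)) • η)
include hη

/-- The minors have degree `(2 - 1) + (3 - 1) = 3`, equal to the weight of the contraction. The
powers of `x_i` cancel, and the same `η` serves on every chart. -/
theorem eulerContraction_affineCoord (hG : G.IsHomogeneous 2) (hF : F.IsHomogeneous 3)
    (i : V.Chart) (a b e : Fin 5) :
    eulerContraction (wedge V.K Ω[V.K⁄ℂ]) (affineCoord i)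
      (fun j => KaehlerDifferential.D ℂ V.K (affineCoord i j)) a b e =
      aeval (affineCoord i) (jacobianMinor G F (a, b, e)) • η := by
  rw [aeval_affineCoord (isHomogeneous_jacobianMinor hG hF _), mul_smul, ← hη,
    ← eulerContraction_smul _ wedge_self V.coord V.dCoord (V.coord i.1)⁻¹
      (KaehlerDifferential.D ℂ V.K (V.coord i.1)⁻¹)]
  congr 1
  ext j
  rw [affineCoord, Derivation.leibniz]
  rfl

theorem wedge_D_affineCoord (hG : G.IsHomogeneous 2) (hF : F.IsHomogeneous 3) (i : V.Chart)
    (j k : Fin 5) :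
    wedge V.K Ω[V.K⁄ℂ] (KaehlerDifferential.D ℂ V.K (affineCoord i j))
      (KaehlerDifferential.D ℂ V.K (affineCoord i k)) =
      aeval (affineCoord i) (jacobianMinor G F (i.1, j, k)) • η := by
  have h0 : KaehlerDifferential.D ℂ V.K (affineCoord i i.1) = 0 := by
    rw [affineCoord_self, Derivation.map_one_eq_zero]
  rw [← eulerContraction_affineCoord hη hG hF]
  exact (eulerContraction_of_eq_one (wedge V.K Ω[V.K⁄ℂ])
    (dx := fun j => KaehlerDifferential.D ℂ V.K (affineCoord i j)) (affineCoord_self i) h0 j k).symm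

/-- The chart ring is generated by affine coordinates, and every product of two of their
differentials is a minor times `η`. -/
theorem regularTwoForms_le (hG : G.IsHomogeneous 2) (hF : F.IsHomogeneous 3) (i : V.Chart) :
    V.regularTwoForms i ≤ Submodule.span (V.chartRing i) {η} := by
  rw [regularTwoForms, Submodule.span_le]
  rintro _ ⟨⟨a, ha⟩, ⟨b, hb⟩, rfl⟩
  obtain ⟨p, rfl⟩ := exists_aeval_affineCoord ha
  obtain ⟨q, rfl⟩ := exists_aeval_affineCoord hb
  refine (KaehlerDifferential.D ℂ V.K).bilin_aeval_mem (wedge V.K Ω[V.K⁄ℂ]) (affineCoord i)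
    (S := (Submodule.span (V.chartRing i) {η}).toAddSubgroup) (fun r j k => ?_) p q
  rw [wedge_D_affineCoord hη hG hF, smul_smul, ← map_mul]
  exact Submodule.mem_span_singleton.mpr ⟨⟨_, aeval_affineCoord_mem i _⟩, rfl⟩

theorem aeval_jacobianMinor_smul_mem (hG : G.IsHomogeneous 2) (hF : F.IsHomogeneous 3)
    (i : V.Chart) (a b e : Fin 5) :
    aeval (affineCoord i) (jacobianMinor G F (a, b, e)) • η ∈ V.regularTwoForms i := by
  have h := eulerContraction_mem (wedge V.K Ω[V.K⁄ℂ]) (x := affineCoord i)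
    (dx := fun j => KaehlerDifferential.D ℂ V.K (affineCoord i j))
    (N := (V.regularTwoForms i).toAddSubgroup) (fun a b e =>
      (V.regularTwoForms i).smul_mem ⟨_, affineCoord_mem i a⟩
        (Submodule.subset_span ⟨⟨_, affineCoord_mem i b⟩, ⟨_, affineCoord_mem i e⟩, rfl⟩)) a b e
  rw [eulerContraction_affineCoord hη hG hF] at h
  exact h

theorem aeval_smul_mem_regularTwoForms (hG : G.IsHomogeneous 2) (hF : F.IsHomogeneous 3)
    (hI : V.ideal = Ideal.span (Set.range ![G, F])) (i : V.Chart) {p : PolyRing 4}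
    (hp : p ∈ V.ideal ⊔ Ideal.span (Set.range (jacobianMinor G F))) :
    aeval (affineCoord i) p • η ∈ V.regularTwoForms i := by
  obtain ⟨u, hu, v, hv, rfl⟩ := Submodule.mem_sup.mp hp
  rw [map_add, aeval_affineCoord_eq_zero hG hF hI i hu, zero_add]
  refine map_smul_mem_of_mem_span (aeval (R := ℂ) (affineCoord i)).toRingHom
    (N := (V.regularTwoForms i).toAddSubgroup) (fun q _ hω => aeval_smul_mem i q hω) ?_ hv
  rintro _ ⟨⟨a, b, e⟩, rfl⟩
  exact aeval_jacobianMinor_smul_mem hη hG hF i a b e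

end Generator

theorem twoFormsTrivial (hG : G.IsHomogeneous 2) (hF : F.IsHomogeneous 3)
    (hI : V.ideal = Ideal.span (Set.range ![G, F])) (i₀ : V.Chart)
    (hs : ∀ v : Fin (4 + 1) → ℂ, v ≠ 0 → eval v G = 0 → eval v F = 0 →
      LinearIndependent ℂ ![gradientAt v G, gradientAt v F]) : V.TwoFormsTrivial := by
  have hGV : G ∈ V.ideal := hI ▸ Ideal.subset_span ⟨0, rfl⟩
  have hFV : F ∈ V.ideal := hI ▸ Ideal.subset_span ⟨1, rfl⟩
  -- By smoothness `G`, `F` and the minors have no common projective zero. On chart `i` the power of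
  -- `x_i` becomes `1`, so the minors generate the unit ideal there and `η` itself is regular.
  have hN : ∀ i, ∃ N : ℕ,
      (X i : PolyRing 4) ^ N ∈ V.ideal ⊔ Ideal.span (Set.range (jacobianMinor G F)) := by
    refine exists_X_pow_mem fun v hv => ?_
    by_contra hv0
    obtain ⟨a, b, e, h⟩ := exists_det_ne_zero (hs v hv0 (hv G (Ideal.mem_sup_left hGV))
      (hv F (Ideal.mem_sup_left hFV)))
    exact h ((map_jacobianMinor (eval v) G F a b e).symm.trans
      (hv _ (Ideal.mem_sup_right (Ideal.subset_span ⟨_, rfl⟩))))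
  obtain ⟨⟨a, b, e⟩, hT⟩ := exists_notMem_jacobianMinor (i₀ := i₀) hN
  obtain ⟨η, hη⟩ := exists_eulerContraction_eq hG hF hGV hFV hT
  refine ⟨η, ?_, fun i => le_antisymm (regularTwoForms_le hη hG hF i) ?_⟩
  · rintro rfl
    exact eulerContraction_ne_zero hG hF hI i₀ hT (by rw [hη, smul_zero])
  · rw [Submodule.span_singleton_le_iff_mem]
    obtain ⟨N, hN⟩ := hN i.1
    have h := aeval_smul_mem_regularTwoForms hη hG hF hI i hN
    rwa [map_pow, aeval_X, affineCoord_self, one_pow, one_smul] at h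

end ProjVariety

/-! ### The K3 property and the existence theorem -/

namespace CanonicalEquations

variable {V V' : ProjVariety 4} {l l' g f : PolyRing 4}

theorem isK3Surface (h : CanonicalEquations V l g f) (hV : V.IsCurve)
    (hs : ∀ p : ℙ ℂ (Fin (4 + 1) → ℂ), eval p.rep g = 0 → eval p.rep f = 0 →
      LinearIndependent ℂ ![gradientAt p.rep g, gradientAt p.rep f]) : h.surface.IsK3Surface := by
  have hI : h.surface.ideal = Ideal.span (Set.range ![g, f]) := by
    rw [h.surface_ideal, Matrix.range_cons, Matrix.range_cons, Matrix.range_empty, Set.union_empty,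
      Ideal.span_union]
  refine ⟨h.surface_hasDim hV, ?_, ?_, h.subsingleton_surface_H1⟩
  · refine Set.eq_empty_of_forall_notMem fun p hp => ?_
    refine (ClosedSubscheme.notMem_singularLocus_iff (h.surface_hasDim hV) (by norm_num) hI
      hp.1).mpr ?_ hp
    convert! hs p (hp.1 g (hI ▸ Ideal.subset_span ⟨0, rfl⟩))
      (hp.1 f (hI ▸ Ideal.subset_span ⟨1, rfl⟩)) using 1
    ext r i
    fin_cases r <;> rfl
  · refine ProjVariety.twoFormsTrivial h.hq h.hc hI
      ⟨0, h.linear_notMem_surface (isHomogeneous_X ℂ 0) (X_ne_zero 0)⟩ fun v hv hvg hvf => ?_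
    let p : ℙ ℂ (Fin (4 + 1) → ℂ) := Projectivization.mk ℂ v hv
    obtain ⟨c, hc⟩ := Projectivization.exists_smul_eq_mk_rep ℂ v hv
    have hc0 : (c : ℂ) ≠ 0 := c.ne_zero
    have hp : p.rep = (c : ℂ) • v := hc.symm
    have h1 := hs p (by rw [hp, h.hq.eval_smul, hvg, mul_zero])
      (by rw [hp, h.hc.eval_smul, hvf, mul_zero])
    rw [hp, gradientAt_smul h.hq, gradientAt_smul h.hc] at h1
    rw [LinearIndependent.pair_iff] at h1 ⊢
    intro s t hst
    -- Passing from `v` to `c • v` scales the gradients of the quadric and the cubic by `c` and `c ^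
    -- 2`; the extra factor on `s` compensates for the difference.
    have h2 := h1 (s * c) t (by
      rw [smul_smul, smul_smul, ← smul_zero ((c : ℂ) ^ 2), ← hst, smul_add, smul_smul, smul_smul]
      congr 2 <;> ring)
    exact ⟨(mul_eq_zero.mp h2.1).resolve_right hc0, h2.2⟩

end CanonicalEquations

theorem linear_notMem_span {l l' : PolyRing 4} (hl : l.IsHomogeneous 1) (h0 : l ≠ 0)
    (hl' : l'.IsHomogeneous 1)
    (hne : ClosedSubscheme.hypersurface l ≠ ClosedSubscheme.hypersurface l') :
    l ∉ Ideal.span {l'} := by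
  intro hmem
  rw [← bot_sup_eq (Ideal.span {l'})] at hmem
  obtain ⟨a, ha, hal⟩ := isHomogIdeal_bot.exists_of_mem_sup_span (d := 0)
    (by simpa using hl) hl' hmem
  obtain ⟨c, rfl⟩ := homogeneous_eq_C ha
  have hc : l = C c * l' := sub_eq_zero.mp hal
  have hc0 : c ≠ 0 := by
    rintro rfl
    exact h0 (by rw [hc, C_0, zero_mul])
  have hu : IsUnit (C c : PolyRing 4) := (isUnit_iff_ne_zero.mpr hc0).map C
  have h0' : l' ≠ 0 := by
    rintro rfl
    exact h0 (by rw [hc, mul_zero])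
  apply hne
  ext1
  rw [ClosedSubscheme.hypersurface_linear_ideal hl h0,
    ClosedSubscheme.hypersurface_linear_ideal hl' h0', hc, Ideal.span_singleton_mul_left_unit hu]

theorem mainTheorem12
    (H H' : ClosedSubscheme 4) (hH : H.IsHyperplane) (hH' : H'.IsHyperplane) (hne : H ≠ H')
    (C C' : ProjVariety 4) (hC : C.IsCurve) (hC' : C'.IsCurve)
    (hgenus : C.arithmeticGenus = 4) (hgenus' : C'.arithmeticGenus = 4)
    (hcan : C.IsCanonicallyEmbeddedIn H) (hcan' : C'.IsCanonicallyEmbeddedIn H')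
    (Q Q' : ClosedSubscheme 4) (hQ : Q.IsQuadricIn H) (hQ' : Q'.IsQuadricIn H')
    (hCQ : C.IsContainedIn Q) (hCQ' : C'.IsContainedIn Q')
    (hCC' : C'.inter H = C.inter H') (hQQ' : Q'.inter H = Q.inter H')
    (hplanar : C.HasPlanarSingularities) (hplanar' : C'.HasPlanarSingularities)
    (hsingQ : Q'.singularLocus ∩ Q.singularLocus = ∅)
    (hsingC : C.singularLocus ∩ C'.singularLocus = ∅) :
    ∃ S : ProjVariety 4, S.IsK3Surface ∧ S.IsQuadricCubicIntersection ∧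
      S.inter H = C.toClosedSubscheme ∧ S.inter H' = C'.toClosedSubscheme := by
  obtain ⟨l, hl, h0, rfl⟩ := hH
  obtain ⟨l', hl', h0', rfl⟩ := hH'
  obtain ⟨hfin, q, c, hE⟩ := ProjVariety.canonicalEquations hl h0 hC hgenus hcan hQ hCQ
  obtain ⟨hfin', q', c', hE'⟩ := ProjVariety.canonicalEquations hl' h0' hC' hgenus' hcan' hQ' hCQ'
  obtain ⟨g, f, hgf, hgf'⟩ := hE.exists_common hE' (linear_notMem_span hl h0 hl' hne)
    (linear_notMem_span hl' h0' hl hne.symm)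
    (hCC' ▸ ClosedSubscheme.ideal_le_inter_left _ _)
  obtain ⟨G, F, hGF, hGF', hs⟩ :=
    hgf.exists_smooth hgf' hC hC' hfin hfin' hplanar hplanar' hsingC
  exact ⟨hGF.surface, hGF.isK3Surface hC hs, hGF.surface_isQuadricCubicIntersection,
    hGF.surface_inter, hGF'.surface_inter⟩
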